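/- Let $k,r\ge 1$ and let $m_1,\dots,m_k,n_1,\dots,n_r$ be positive integers; put $m=\sum_i m_i$, $n=\sum_j n_j$, $d=m+n$. Fix arbitrary norms on $\mathbb{R}^{m_1},\dots,\mathbb{R}^{m_k},\mathbb{R}^{n_1},\dots,\mathbb{R}^{n_r}$, all denoted $\|\cdot\|$, and equip $\mathbb{R}^m=\prod_i\mathbb{R}^{m_i}$, $\mathbb{R}^n=\prod_j\mathbb{R}^{n_j}$ and $\mathbb{R}^d=\mathbb{R}^m\times\mathbb{R}^n$ with the corresponding maximum norms. Write $\rho_i:\mathbb{R}^m\to\mathbb{R}^{m_i}$ and $\rho'_j:\mathbb{R}^n\to\mathbb{R}^{n_j}$ for the coordinate projections. Fix real numbers $\eta_1,\dots,\eta_k>0$ and $\varepsilon>0$. For $\theta\in M_{m\times n}(\mathbb{R})$, a vector $(p,q)\in\mathbb{Z}^m\times\mathbb{Z}^n$ is called an $\varepsilon$-approximate of $\theta$ if $\gcd(p,q)=1$ (that is, the $d$ integer coordinates of $(p,q)$ have greatest common divisor $1$), $\|\rho_i(p+\theta q)\|\le\eta_i$ for all $1\le i\le k$, and $$\Bigl(\prod_{i=1}^k\|\rho_i(p+\theta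 q)\|^{m_i}\Bigr)\Bigl(\prod_{j=1}^r\max\{1,\|\rho'_j(q)\|^{n_j}\}\Bigr)\le\varepsilon .$$ Let $D^\sharp(T,\theta)$ be the number of $\varepsilon$-approximates $(p,q)$ of $\theta$ with $\|q\|\le e^T$. Let $B^d_1$ be the unit ball of $\mathbb{R}^d$ for the norm above, $\mathrm{vol}$ Lebesgue measure on $\mathbb{R}^d$, $\zeta$ the Riemann zeta function, and $$c_{k+r-1}(n_1,\dots,n_r)=\sum_{(x_1,\dots,x_r)\in\{0,1\}^r}(-1)^{r-(x_1+\dots+x_r)}(n_1x_1+\dots+n_rx_r)^{k+r-1}.$$ Then for Lebesgue almost every $\theta\in M_{m\times n}(\mathbb{R})$, $$\limsup_{T\to\infty}\frac{D^\sharp(T,\theta)}{T^{k+r-1}}\le\frac{\varepsilon}{\zeta(d)}\,\frac{\mathrm{vol}(B^d_1)}{(k+r-1)!}\,c_{k+r-1}(n_1,\dots,n_r).$$ -/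

import Mathlib

open Filter MeasureTheory
open scoped ENNReal Nat

noncomputable section

namespace MultDioph

/-- Coordinates of `ℝ^m = ℝ^{m_1} × ⋯ × ℝ^{m_k}`: a block `i` and a position inside that block. -/
abbrev Idx {k : ℕ} (m : Fin k → ℕ) : Type := Σ i : Fin k, Fin (m i)

/-- The projection of `ℝ^m = ℝ^{m_1} × ⋯ × ℝ^{m_k}` onto its `i`-th component `ℝ^{m_i}`. -/
def block {k : ℕ} {m : Fin k → ℕ} (i : Fin k) (x : Idx m → ℝ) : Fin (m i) → ℝ :=
  fun a => x ⟨i, a⟩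

/-- The norm `‖(x_1, …, x_k)‖ = max_i ‖x_i‖` built from norms on the blocks. -/
def maxNorm {k : ℕ} {m : Fin k → ℕ} (N : ∀ i, Seminorm ℝ (Fin (m i) → ℝ))
    (x : Idx m → ℝ) : ℝ :=
  ⨆ i, N i (block i x)

/-- The closed unit ball of `ℝ^d = ℝ^m × ℝ^n` for the norm `max {‖x‖, ‖y‖}`. -/
def unitBall {k r : ℕ} {m : Fin k → ℕ} {n : Fin r → ℕ}
    (N : ∀ i, Seminorm ℝ (Fin (m i) → ℝ)) (N' : ∀ j, Seminorm ℝ (Fin (n j) → ℝ)) :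
    Set ((Idx m → ℝ) × (Idx n → ℝ)) :=
  {z | max (maxNorm N z.1) (maxNorm N' z.2) ≤ 1}

/-- An integer vector seen as a real vector. -/
def intToReal {ι : Type} (q : ι → ℤ) : ι → ℝ := fun b => (q b : ℝ)

/-- The real vector `p + θ q`. -/
def affineValue {ι κ : Type} [Fintype κ] (θ : ι → κ → ℝ) (p : ι → ℤ) (q : κ → ℤ) : ι → ℝ :=
  intToReal p + Matrix.mulVec (Matrix.of θ) (intToReal q)

/-- `(p, q)` is an `ε`-approximation of the matrix `θ`, with respect to the block decompositions
`m`, `n`, the norms `N i` and `N' j` on the blocks, and the constants `η i`. -/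
structure IsApprox {k r : ℕ} {m : Fin k → ℕ} {n : Fin r → ℕ}
    (N : ∀ i, Seminorm ℝ (Fin (m i) → ℝ)) (N' : ∀ j, Seminorm ℝ (Fin (n j) → ℝ))
    (η : Fin k → ℝ) (ε : ℝ) (θ : Idx m → Idx n → ℝ)
    (p : Idx m → ℤ) (q : Idx n → ℤ) : Prop where
  block_le : ∀ i, N i (block i (affineValue θ p q)) ≤ η i
  prod_le : (∏ i, N i (block i (affineValue θ p q)) ^ m i) *
      (∏ j, max 1 (N' j (block j (intToReal q)) ^ n j)) ≤ ε
  gcd_eq_one : Finset.univ.gcd (Sum.elim p q) = 1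

/-- `D^♯(T, θ)`: the number of `ε`-approximations `(p, q)` of `θ` with `‖q‖ ≤ e^T`. -/
def countApprox {k r : ℕ} {m : Fin k → ℕ} {n : Fin r → ℕ}
    (N : ∀ i, Seminorm ℝ (Fin (m i) → ℝ)) (N' : ∀ j, Seminorm ℝ (Fin (n j) → ℝ))
    (η : Fin k → ℝ) (ε : ℝ) (θ : Idx m → Idx n → ℝ) (T : ℝ) : ℕ∞ :=
  {v : (Idx m → ℤ) × (Idx n → ℤ) |
    IsApprox N N' η ε θ v.1 v.2 ∧ maxNorm N' (intToReal v.2) ≤ Real.exp T}.encard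

/-- `c_l(n_1, …, n_r) = ∑_{x ∈ {0,1}^r} (-1)^{r - (x_1 + ⋯ + x_r)} (n_1 x_1 + ⋯ + n_r x_r)^l`. -/
def cCoeff (l : ℕ) {r : ℕ} (n : Fin r → ℕ) : ℤ :=
  ∑ x : Fin r → Fin 2,
    (-1 : ℤ) ^ (r - ∑ j, (x j : ℕ)) * (∑ j, (n j : ℤ) * ((x j : ℕ) : ℤ)) ^ l

end MultDioph

end

/-! Fix an integer P and a residue class (c, c') modulo P. If p = c + Pz, put a = c/P and x = θ/P;
then p + θq = P(z + a + qx). For fixed q the admissible p are therefore counted by the integer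
translates of a + qx lying in the region Ω(q) where each block has norm at most η_i and the product
of the powers m_i of the block norms, times the weight w(q) = ∏ max(1, ‖q_j‖^{n_j}), is at most ε.
All norms on the p side are multiplied by P.

First moment. Let x be uniform in a unit box of matrices. For q ≠ 0, a + qx is equidistributed on
the torus, so the mean count is the sum of vol Ω(q) over the q in the class with ‖q‖ ≤ e^T. Since
N^s carries Lebesgue measure to a multiple of Lebesgue measure on (0, ∞), vol Ω(q) is at most a
constant times ε w⁻¹ (log w + C)^{k-1}/(k-1)!. On a logarithmic scale each factor 1/max(1,
‖q_j‖^{n_j}) becomes Lebesgue measure on (0, n_j T], and the iterated integral of x^{k-1}/(k-1)!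
over the resulting box is an alternating sum with leading term c_{k+r-1}(n) T^{k+r-1}/(k+r-1)!. Put
R = k + r - 1.

Second moment. Counts for non-parallel q, q' are exactly uncorrelated; parallel pairs are the
difficulty. A truncation with parameter L discards translates with a block of norm at most 1/(L
w(q)), or for which some e > L divides both q and a block of p; the expected loss is O(T^R L^{-1/2})
(`exists_lintegral_badCount_le`). For q = αw, q' = βw with α, β coprime, moving the two arguments by
ω/β and ω/α in complementary blocks makes them jointly equidistributed, because (α, β) completes to
a matrix of determinant ±1 (`lintegral_perCount_mul_perCount_perturbed`). The move is harmless in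
blocks where |β| or |α| times the norm is at least K. This gives three bounds: a nearly sharp one
when one multiplier is large against the other weight, a bound up to a constant when α or β exceeds
L, and the trivial bound for the O(L²) remaining partners of each q. Parallel pairs outside the
sharp range contribute only O(T^{2R-1}(KL)^{1/2}) to the second bound (`exists_sum_comparable_le`).

With K = L = T^{1/4}, a one-sided Chebyshev inequality bounds the probability of an excess κT^R by
O(T^{-1/8}). This is summable along T = τ^j, so Borel–Cantelli and monotonicity in T give the almost
sure upper bound for every class (`ae_eventually_class_le`).

Finally, let S be the set of classes modulo P of primitive vectors. If every e ≤ z divides P, the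
sets eS for e ≤ z are disjoint and |eS| ≥ |S|/e^d, hence |S| ∑_{e ≤ z} e^{-d} ≤ P^d. A class has
P^{-d} times the full density, so P = z! gives the full density divided by ∑_{e ≤ z} e^{-d}, and z →
∞ produces 1/ζ(d). -/

noncomputable section

namespace MultDioph

set_option linter.unusedSectionVars false

/-! ### Equidistribution of integer linear forms on the torus -/

section Torus

variable {ι κ : Type}

/-- The number of integer translates of `y` lying in `X`. -/
def perCount (X : Set (ι → ℝ)) (y : ι → ℝ) : ℝ≥0∞ :=
  ∑' z : ι → ℤ, X.indicator 1 (intToReal z + y)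

/-- The projection of `ℝ^ι` onto the torus. -/
def toTorus (y : ι → ℝ) : ι → UnitAddCircle := fun i => (y i : UnitAddCircle)

/-- A measurable section of the projection onto the torus. -/
def torusRep (t : ι → UnitAddCircle) : ι → ℝ := fun i => (AddCircle.equivIoc 1 0 (t i) : ℝ)

/-- `perCount` as a function on the torus. -/
def torusCount (X : Set (ι → ℝ)) (t : ι → UnitAddCircle) : ℝ≥0∞ := perCount X (torusRep t)

lemma perCount_add_int (X : Set (ι → ℝ)) (y : ι → ℝ) (w : ι → ℤ) :
    perCount X (intToReal w + y) = perCount X y := by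
  unfold perCount
  rw [← (Equiv.addRight w).tsum_eq (fun z : ι → ℤ => X.indicator 1 (intToReal z + y))]
  congr 1; ext z
  congr 1; ext i
  simp [intToReal]; ring

lemma exists_int_of_toTorus_eq {y y' : ι → ℝ} (h : toTorus y = toTorus y') :
    ∃ w : ι → ℤ, y = intToReal w + y' := by
  have : ∀ i, ∃ w : ℤ, y i = w + y' i := by
    intro i
    have h1 := congrFun h i
    simp only [toTorus] at h1
    rw [← sub_eq_zero, ← AddCircle.coe_sub, AddCircle.coe_eq_zero_iff] at h1
    obtain ⟨w, hw⟩ := h1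
    exact ⟨w, by simp at hw; linarith⟩
  choose w hw using this
  exact ⟨w, funext fun i => by simpa [intToReal] using hw i⟩

lemma toTorus_torusRep (t : ι → UnitAddCircle) : toTorus (torusRep t) = t := by
  ext i
  exact (AddCircle.equivIoc 1 0).symm_apply_apply (t i)

lemma torusCount_toTorus (X : Set (ι → ℝ)) (y : ι → ℝ) :
    torusCount X (toTorus y) = perCount X y := by
  obtain ⟨w, hw⟩ := exists_int_of_toTorus_eq (toTorus_torusRep (toTorus y))
  rw [torusCount, hw, perCount_add_int]

lemma measurable_torusRep : Measurable (torusRep : (ι → UnitAddCircle) → ι → ℝ) := by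
  refine measurable_pi_lambda _ fun i => ?_
  exact measurable_subtype_coe.comp
    ((AddCircle.measurableEquivIoc 1 0).measurable.comp (measurable_pi_apply i))

variable [Fintype ι] [Fintype κ]

/-- The uniform measure on the unit box with corner `b`. -/
def boxMeasure (b : ι → ℝ) : Measure (ι → ℝ) :=
  Measure.pi fun i => volume.restrict (Set.Ioc (b i) (b i + 1))

/-- The uniform measure on the unit box of matrices with corner `b`. -/
def boxMeasure₂ (b : ι → κ → ℝ) : Measure (ι → κ → ℝ) := Measure.pi fun i => boxMeasure (b i)

/-- The vector `c · x` whose `i`-th coordinate is the product of the rows `c i` and `x i`. -/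
def rowMul (c : ι → κ → ℤ) (x : ι → κ → ℝ) : ι → ℝ := fun i => ∑ j, (c i j : ℝ) * x i j

lemma measurable_perCount {X : Set (ι → ℝ)} (hX : MeasurableSet X) :
    Measurable (perCount X) := by
  refine Measurable.tsum fun z => ?_
  exact (measurable_one.indicator hX).comp (measurable_const.add measurable_id)

lemma measurable_torusCount {X : Set (ι → ℝ)} (hX : MeasurableSet X) :
    Measurable (torusCount X) :=
  (measurable_perCount hX).comp measurable_torusRep

lemma measurePreserving_toTorus (b : ι → ℝ) :
    MeasurePreserving (toTorus : (ι → ℝ) → _) (boxMeasure b) volume :=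
  measurePreserving_pi _ _ fun i => AddCircle.measurePreserving_mk 1 (b i)

lemma measurePreserving_toTorus₂ (b : ι → κ → ℝ) :
    MeasurePreserving (fun x : ι → κ → ℝ => fun i => toTorus (x i)) (boxMeasure₂ b) volume := by
  exact measurePreserving_pi _ _ fun i => measurePreserving_toTorus (b i)

instance (b : ι → ℝ) : IsProbabilityMeasure (boxMeasure b) := by
  have : ∀ i, IsProbabilityMeasure (volume.restrict (Set.Ioc (b i) (b i + 1))) := fun i =>
    ⟨by simp⟩
  unfold boxMeasure; infer_instance

instance (b : ι → κ → ℝ) : IsProbabilityMeasure (boxMeasure₂ b) := by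
  unfold boxMeasure₂; infer_instance

lemma boxMeasure_eq (b : ι → ℝ) :
    boxMeasure b = volume.restrict (Set.univ.pi fun i => Set.Ioc (b i) (b i + 1)) :=
  (Measure.restrict_pi_pi _ _).symm

/-- Unfolding: the integer translates of a unit box tile the space. -/
lemma tsum_lintegral_boxMeasure (F : (ι → ℝ) → ℝ≥0∞) (b : ι → ℝ) :
    ∑' z : ι → ℤ, ∫⁻ y, F (intToReal z + y) ∂boxMeasure b = ∫⁻ y, F y := by
  set S : (ι → ℤ) → Set (ι → ℝ) := fun z =>
    Set.univ.pi fun i => Set.Ioc (b i + z i) (b i + z i + 1) with hS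
  have hSm : ∀ z, MeasurableSet (S z) := fun z =>
    MeasurableSet.univ_pi fun i => measurableSet_Ioc
  have hint : ∀ z : ι → ℤ, ∫⁻ y, F (intToReal z + y) ∂boxMeasure b = ∫⁻ y in S z, F y := by
    intro z
    rw [boxMeasure_eq, ← lintegral_indicator (MeasurableSet.univ_pi fun i => measurableSet_Ioc),
      ← lintegral_indicator (hSm z)]
    have h1 : ∀ y, (Set.univ.pi fun i => Set.Ioc (b i) (b i + 1)).indicator
        (fun y => F (intToReal z + y)) y = (S z).indicator F (intToReal z + y) := by
      intro y
      have h2 : intToReal z + y ∈ S z ↔ y ∈ Set.univ.pi fun i => Set.Ioc (b i) (b i + 1) := by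
        simp only [hS, Set.mem_univ_pi, Set.mem_Ioc, intToReal, Pi.add_apply]
        exact forall_congr' fun i => ⟨fun h => ⟨by linarith, by linarith⟩,
          fun h => ⟨by linarith, by linarith⟩⟩
      by_cases hy : y ∈ Set.univ.pi fun i => Set.Ioc (b i) (b i + 1)
      · rw [Set.indicator_of_mem hy, Set.indicator_of_mem (h2.2 hy)]
      · rw [Set.indicator_of_notMem hy, Set.indicator_of_notMem (fun h => hy (h2.1 h))]
    simp_rw [h1]
    exact lintegral_add_left_eq_self (fun y => (S z).indicator F y) _
  simp_rw [hint]
  rw [← lintegral_iUnion hSm]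
  · have : ⋃ z, S z = Set.univ := by
      refine Set.eq_univ_of_forall fun y => Set.mem_iUnion.2 ?_
      have : ∀ i, ∃ n : ℤ, y i ∈ Set.Ioc (b i + n) (b i + n + 1) := fun i => by
        have := iUnion_Ioc_add_intCast (b i)
        exact Set.mem_iUnion.1 (this ▸ Set.mem_univ (y i))
      choose z hz using this
      exact ⟨z, fun i _ => hz i⟩
    rw [this, Measure.restrict_univ]
  · intro z z' hzz
    refine Set.disjoint_left.2 fun y hy hy' => hzz ?_
    ext i
    by_contra hne
    exact Set.disjoint_left.1 (Set.pairwise_disjoint_Ioc_add_intCast (b i) hne)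
      (hy i trivial) (hy' i trivial)

lemma lintegral_perCount_box {X : Set (ι → ℝ)} (hX : MeasurableSet X) (b : ι → ℝ) :
    ∫⁻ y, perCount X y ∂boxMeasure b = volume X := by
  have hm : ∀ z : ι → ℤ, Measurable fun y => X.indicator (1 : (ι → ℝ) → ℝ≥0∞) (intToReal z + y) :=
    fun z => (measurable_one.indicator hX).comp (measurable_const_add _)
  unfold perCount
  rw [lintegral_tsum fun z => (hm z).aemeasurable,
    tsum_lintegral_boxMeasure (X.indicator 1) b, lintegral_indicator_one hX]

/-- A bounded set contains a bounded number of integer translates of any point. -/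
lemma perCount_le {X : Set (ι → ℝ)} {R : ℝ} (hR : 0 ≤ R) (hX : ∀ x ∈ X, ∀ i, |x i| ≤ R)
    (y : ι → ℝ) : perCount X y ≤ ENNReal.ofReal ((2 * R + 1) ^ Fintype.card ι) := by
  classical
  set F : Finset (ι → ℤ) := Fintype.piFinset fun i => Finset.Icc ⌈-R - y i⌉ ⌊R - y i⌋ with hF
  have h0 : ∀ z ∉ F, X.indicator (1 : (ι → ℝ) → ℝ≥0∞) (intToReal z + y) = 0 := by
    intro z hz
    refine Set.indicator_of_notMem (fun hx => hz ?_) _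
    refine Fintype.mem_piFinset.2 fun i => Finset.mem_Icc.2 ?_
    have h1 := abs_le.1 (hX _ hx i)
    simp only [intToReal, Pi.add_apply] at h1
    exact ⟨Int.ceil_le.2 (by linarith), Int.le_floor.2 (by linarith)⟩
  have hcard : ∀ i, ((Finset.Icc ⌈-R - y i⌉ ⌊R - y i⌋).card : ℝ) ≤ 2 * R + 1 := by
    intro i
    rw [Int.card_Icc]
    have h1 := Int.le_ceil (-R - y i)
    have h2 := Int.floor_le (R - y i)
    have h3 : (((⌊R - y i⌋ + 1 - ⌈-R - y i⌉).toNat : ℤ) : ℝ) =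
      max ((⌊R - y i⌋ + 1 - ⌈-R - y i⌉ : ℤ) : ℝ) 0 := by
      rw [Int.toNat_eq_max]; push_cast; rfl
    rw [← Int.cast_natCast, h3]
    refine max_le ?_ (by positivity)
    push_cast; linarith
  unfold perCount
  rw [tsum_eq_sum (s := F) fun z hz => h0 z hz]
  calc ∑ z ∈ F, X.indicator (1 : (ι → ℝ) → ℝ≥0∞) (intToReal z + y) ≤ ∑ z ∈ F, 1 :=
        Finset.sum_le_sum fun z _ => Set.indicator_le_self' (by simp) _
    _ = ((F.card : NNReal) : ℝ≥0∞) := by simp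
    _ ≤ ENNReal.ofReal ((2 * R + 1) ^ Fintype.card ι) := by
      rw [ENNReal.ofReal]
      refine ENNReal.coe_le_coe.2 (NNReal.le_toNNReal_of_coe_le ?_)
      rw [hF, Fintype.card_piFinset]
      push_cast
      calc ∏ i, ((Finset.Icc ⌈-R - y i⌉ ⌊R - y i⌋).card : ℝ) ≤ ∏ _i : ι, (2 * R + 1) :=
            Finset.prod_le_prod (fun i _ => by positivity) fun i _ => hcard i
        _ = _ := by simp

lemma lintegral_torusCount {X : Set (ι → ℝ)} (hX : MeasurableSet X) :
    ∫⁻ t, torusCount X t = volume X := by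
  rw [← (measurePreserving_toTorus (0 : ι → ℝ)).lintegral_comp (measurable_torusCount hX)]
  simp_rw [torusCount_toTorus]
  exact lintegral_perCount_box hX 0

instance secondCountableTopology_unitAddCircle : SecondCountableTopology UnitAddCircle :=
  inferInstanceAs (SecondCountableTopology (ℝ ⧸ AddSubgroup.zmultiples (1 : ℝ)))

instance isAddHaarMeasure_torus : (volume : Measure (ι → UnitAddCircle)).IsAddHaarMeasure :=
  inferInstanceAs (Measure.pi fun _ => volume).IsAddHaarMeasure

instance isAddHaarMeasure_torus₂ :
    (volume : Measure (ι → κ → UnitAddCircle)).IsAddHaarMeasure :=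
  Measure.pi.isAddHaarMeasure fun _ => volume

instance measurableAdd_torus_prod :
    MeasurableAdd ((ι → UnitAddCircle) × (ι → UnitAddCircle)) :=
  ContinuousAdd.measurableAdd

instance isAddHaarMeasure_torus_prod :
    ((volume : Measure (ι → UnitAddCircle)).prod
      (volume : Measure (ι → UnitAddCircle))).IsAddHaarMeasure :=
  Measure.prod.instIsAddHaarMeasure _ _

lemma volume_torus_univ : (volume : Measure (ι → UnitAddCircle)) Set.univ = 1 := by
  rw [← (measurePreserving_toTorus (0 : ι → ℝ)).measure_preimage MeasurableSet.univ.nullMeasurableSet]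
  simp

lemma volume_torus₂_univ : (volume : Measure (ι → κ → UnitAddCircle)) Set.univ = 1 := by
  rw [← (measurePreserving_toTorus₂ (0 : ι → κ → ℝ)).measure_preimage
    MeasurableSet.univ.nullMeasurableSet]
  simp

lemma toTorus_add (y x : ι → ℝ) : toTorus (y + x) = toTorus y + toTorus x := rfl

/-- The homomorphism `Θ ↦ c · Θ` of tori. -/
def torusMul (c : ι → κ → ℤ) : (ι → κ → UnitAddCircle) →+ (ι → UnitAddCircle) where
  toFun t := fun i => ∑ j, c i j • t i j
  map_zero' := by ext; simp
  map_add' s t := by ext i; simp [Finset.sum_add_distrib]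

lemma continuous_torusMul (c : ι → κ → ℤ) : Continuous (torusMul c) := by
  refine continuous_pi fun i => continuous_finsetSum _ fun j _ => ?_
  exact (continuous_apply_apply i j).zsmul (c i j)

lemma torusMul_toTorus (c : ι → κ → ℤ) (x : ι → κ → ℝ) :
    torusMul c (fun i => toTorus (x i)) = toTorus (rowMul c x) := by
  ext i
  change ∑ j, c i j • ((x i j : ℝ) : UnitAddCircle) = ((∑ j, (c i j : ℝ) * x i j : ℝ) : UnitAddCircle)
  rw [← QuotientAddGroup.mk'_apply, map_sum]
  refine Finset.sum_congr rfl fun j _ => ?_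
  rw [← zsmul_eq_mul, map_zsmul]
  rfl

/-- A continuous surjective homomorphism of compact groups carries Haar probability to Haar
probability. Surjectivity holds row by row, by dividing by a nonzero coefficient of a real lift. -/
lemma measurePreserving_torusMul (c : ι → κ → ℤ) (hc : ∀ i, ∃ j, c i j ≠ 0) :
    MeasurePreserving (torusMul c) volume volume := by
  have hsurj : Function.Surjective (torusMul c) := by
    intro t
    choose j hj using hc
    classical
    let x : ι → κ → ℝ := fun i a => if a = j i then torusRep t i / c i (j i) else 0
    have h1 : rowMul c x = torusRep t := by
      ext i
      have : (c i (j i) : ℝ) ≠ 0 := Int.cast_ne_zero.2 (hj i)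
      simp only [rowMul, x, mul_ite, mul_zero, Finset.sum_ite_eq', Finset.mem_univ, if_true]
      field_simp
    refine ⟨fun i => toTorus (x i), ?_⟩
    rw [torusMul_toTorus, h1, toTorus_torusRep]
  exact AddMonoidHom.measurePreserving (continuous_torusMul c) hsurj
      (by rw [volume_torus_univ, volume_torus₂_univ])

/-- A single integer linear form on a torus whose rows are nonzero is equidistributed. -/
lemma lintegral_perCount {X : Set (ι → ℝ)} (hX : MeasurableSet X) (b : ι → κ → ℝ)
    (c : ι → κ → ℤ) (hc : ∀ i, ∃ j, c i j ≠ 0) (y : ι → ℝ) :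
    ∫⁻ x, perCount X (y + rowMul c x) ∂boxMeasure₂ b = volume X := by
  have hmp := measurePreserving_torusMul c hc
  have hadd : MeasurePreserving (fun p : ι → UnitAddCircle => toTorus y + p) volume volume :=
    measurePreserving_add_left _ _
  have key := ((hadd.comp hmp).comp (measurePreserving_toTorus₂ b)).lintegral_comp
    (measurable_torusCount hX)
  rw [lintegral_torusCount hX] at key
  rw [← key]
  refine lintegral_congr fun x => ?_
  simp only [Function.comp_apply, torusMul_toTorus, ← toTorus_add, torusCount_toTorus]

/-- Two integer linear forms whose rows are independent are jointly equidistributed. -/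
lemma lintegral_perCount_mul_perCount {X Y : Set (ι → ℝ)} (hX : MeasurableSet X)
    (hY : MeasurableSet Y) (b : ι → κ → ℝ) (c c' : ι → κ → ℤ)
    (hc : ∀ i, ∃ j l, c i j * c' i l - c i l * c' i j ≠ 0) (y y' : ι → ℝ) :
    ∫⁻ x, perCount X (y + rowMul c x) * perCount Y (y' + rowMul c' x) ∂boxMeasure₂ b =
      volume X * volume Y := by
  have hsurj : Function.Surjective ((torusMul c).prod (torusMul c')) := by
    rintro ⟨t, t'⟩
    choose j l hjl using hc
    classical
    let D : ι → ℝ := fun i => ((c i (j i) * c' i (l i) - c i (l i) * c' i (j i) : ℤ) : ℝ)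
    have hD : ∀ i, D i ≠ 0 := fun i => Int.cast_ne_zero.2 (hjl i)
    let s := torusRep t
    let s' := torusRep t'
    -- Cramer's rule in the columns j i and l i of each row, for the real lifts of the two targets.
    let x : ι → κ → ℝ := fun i a =>
      (if a = j i then (s i * c' i (l i) - s' i * c i (l i)) / D i else 0) +
      (if a = l i then (s' i * c i (j i) - s i * c' i (j i)) / D i else 0)
    have h1 : rowMul c x = s := by
      ext i
      have := hD i
      simp only [rowMul, x, mul_add, Finset.sum_add_distrib, mul_ite, mul_zero,
        Finset.sum_ite_eq', Finset.mem_univ, if_true]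
      field_simp
      simp only [D]; push_cast; ring
    have h2 : rowMul c' x = s' := by
      ext i
      have := hD i
      simp only [rowMul, x, mul_add, Finset.sum_add_distrib, mul_ite, mul_zero,
        Finset.sum_ite_eq', Finset.mem_univ, if_true]
      field_simp
      simp only [D]; push_cast; ring
    refine ⟨fun i => toTorus (x i), ?_⟩
    rw [AddMonoidHom.prod_apply, torusMul_toTorus, torusMul_toTorus, h1, h2,
      toTorus_torusRep, toTorus_torusRep]
  have hmp : MeasurePreserving ((torusMul c).prod (torusMul c'))
      (volume : Measure (ι → κ → UnitAddCircle)) (volume.prod volume) := by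
    refine AddMonoidHom.measurePreserving
      ((continuous_torusMul c).prodMk (continuous_torusMul c')) hsurj ?_
    rw [volume_torus₂_univ, ← Set.univ_prod_univ, Measure.prod_prod, volume_torus_univ, one_mul]
  have hadd : MeasurePreserving (fun p : (ι → UnitAddCircle) × (ι → UnitAddCircle) =>
      (toTorus y, toTorus y') + p) (volume.prod volume) (volume.prod volume) :=
    measurePreserving_add_left _ _
  have hm : Measurable fun p : (ι → UnitAddCircle) × (ι → UnitAddCircle) =>
      torusCount X p.1 * torusCount Y p.2 :=
    ((measurable_torusCount hX).comp measurable_fst).mul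
      ((measurable_torusCount hY).comp measurable_snd)
  have key := ((hadd.comp hmp).comp (measurePreserving_toTorus₂ b)).lintegral_comp hm
  rw [lintegral_prod_mul (measurable_torusCount hX).aemeasurable
    (measurable_torusCount hY).aemeasurable, lintegral_torusCount hX,
    lintegral_torusCount hY] at key
  rw [← key]
  refine lintegral_congr fun x => ?_
  simp only [Function.comp_apply, AddMonoidHom.prod_apply, torusMul_toTorus, Prod.mk_add_mk,
    ← toTorus_add, torusCount_toTorus]

end Torus

/-! ### Joint equidistribution of parallel forms after a perturbation -/

section Parallel

variable {ι κ : Type} [Fintype ι] [Fintype κ]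

/-- The homomorphism `(t, τ) ↦ (A t + B τ, C t + D τ)` of tori, coordinate by coordinate. -/
def torusPair (A B C D : ι → ℤ) :
    ((ι → UnitAddCircle) × (ι → UnitAddCircle)) →+
      ((ι → UnitAddCircle) × (ι → UnitAddCircle)) where
  toFun p := (fun i => A i • p.1 i + B i • p.2 i, fun i => C i • p.1 i + D i • p.2 i)
  map_zero' := by ext <;> simp
  map_add' p q := by ext i <;> simp <;> abel

/-- The determinant δ is ±1 in each coordinate, so the inverse is δ times the adjugate, still with
integer entries. -/
lemma measurePreserving_torusPair (A B C D : ι → ℤ)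
    (h : ∀ i, A i * D i - B i * C i = 1 ∨ A i * D i - B i * C i = -1) :
    MeasurePreserving (torusPair A B C D) (volume.prod volume) (volume.prod volume) := by
  refine AddMonoidHom.measurePreserving ?_ ?_ rfl
  · refine Continuous.prodMk (continuous_pi fun i => ?_) (continuous_pi fun i => ?_)
    · exact (((continuous_apply i).comp continuous_fst).zsmul _).add
        (((continuous_apply i).comp continuous_snd).zsmul _)
    · exact (((continuous_apply i).comp continuous_fst).zsmul _).add
        (((continuous_apply i).comp continuous_snd).zsmul _)
  · rintro ⟨t, t'⟩
    let δ : ι → ℤ := fun i => A i * D i - B i * C i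
    have hδ : ∀ i, δ i * δ i = 1 := fun i => by
      rcases h i with h | h <;> simp [δ, h]
    refine ⟨(fun i => (δ i * D i) • t i - (δ i * B i) • t' i,
      fun i => (δ i * A i) • t' i - (δ i * C i) • t i), ?_⟩
    refine Prod.ext (funext fun i => ?_) (funext fun i => ?_)
    · change A i • ((δ i * D i) • t i - (δ i * B i) • t' i) +
        B i • ((δ i * A i) • t' i - (δ i * C i) • t i) = t i
      have e : A i • ((δ i * D i) • t i - (δ i * B i) • t' i) +
        B i • ((δ i * A i) • t' i - (δ i * C i) • t i) = (δ i * δ i) • t i := by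
        simp only [δ]; module
      rw [e, hδ, one_smul]
    · change C i • ((δ i * D i) • t i - (δ i * B i) • t' i) +
        D i • ((δ i * A i) • t' i - (δ i * C i) • t i) = t' i
      have e : C i • ((δ i * D i) • t i - (δ i * B i) • t' i) +
        D i • ((δ i * A i) • t' i - (δ i * C i) • t i) = (δ i * δ i) • t' i := by
        simp only [δ]; module
      rw [e, hδ, one_smul]

lemma toTorus_smul (α : ℤ) (s : ι → ℝ) : toTorus ((α : ℝ) • s) = α • toTorus s := by
  ext i
  change (((α : ℝ) * s i : ℝ) : UnitAddCircle) = α • ((s i : ℝ) : UnitAddCircle)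
  rw [← zsmul_eq_mul]; rfl

/-- A pair of parallel forms is jointly equidistributed after a suitable perturbation. -/
lemma lintegral_perCount_mul_perCount_perturbed {X Y : Set (ι → ℝ)} (hX : MeasurableSet X)
    (hY : MeasurableSet Y) (b : ι → κ → ℝ) {α β : ℤ} (hα : α ≠ 0) (hβ : β ≠ 0)
    (hαβ : IsCoprime α β) {w : κ → ℤ} (hw : w ≠ 0) (J : ι → Prop) [DecidablePred J]
    (y y' : ι → ℝ) :
    ∫⁻ x, ∫⁻ ω, perCount X (y + (α : ℝ) • rowMul (fun _ => w) x +
          fun i => if J i then ω i / (β : ℝ) else (0 : ℝ)) *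
        perCount Y (y' + (β : ℝ) • rowMul (fun _ => w) x +
          fun i => if J i then (0 : ℝ) else ω i / (α : ℝ)) ∂boxMeasure 0 ∂boxMeasure₂ b =
      volume X * volume Y := by
  obtain ⟨a, b', hab⟩ := hαβ
  have hab' : (a : ℝ) * α + b' * β = 1 := by exact_mod_cast hab
  have hα' : (α : ℝ) ≠ 0 := Int.cast_ne_zero.2 hα
  have hβ' : (β : ℝ) ≠ 0 := Int.cast_ne_zero.2 hβ
  have hmX := measurable_torusCount hX
  have hmY := measurable_torusCount hY
  let g : (ι → ℝ) → (ι → UnitAddCircle) → ℝ≥0∞ := fun ω t =>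
    torusCount X (toTorus (y + fun i => if J i then ω i / (β : ℝ) else (0 : ℝ)) + α • t) *
    torusCount Y (toTorus (y' + fun i => if J i then (0 : ℝ) else ω i / (α : ℝ)) + β • t)
  -- For fixed ω the Haar integral over t may be translated by u ω. Since a α + b' β = 1, this turns
  -- the fractional shifts ω/β, ω/α into integer multiples: on J the pair becomes (αt + b'ω, βt -
  -- aω), off J it becomes (αt - b'ω, βt + aω). The matrices have determinants -1 and 1.
  let u : (ι → ℝ) → ι → ℝ := fun ω i => if J i then -(a * ω i / β) else -(b' * ω i / α)
  let B : ι → ℤ := fun i => if J i then b' else -b'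
  let D : ι → ℤ := fun i => if J i then -a else a
  have hgm : ∀ ω, Measurable (g ω) := by
    intro ω
    have c1 : ∀ c : ι → UnitAddCircle, ∀ k : ℤ, Measurable fun t : ι → UnitAddCircle =>
      c + k • t := fun c k => by
        have : Continuous fun t : ι → UnitAddCircle => c + k • t :=
          continuous_const.add (continuous_id.zsmul k)
        exact this.measurable
    exact (hmX.comp (c1 _ _)).mul (hmY.comp (c1 _ _))
  have hshift : ∀ ω, ∀ t, g ω (toTorus (u ω) + t) =
      torusCount X (toTorus y + (torusPair (fun _ => α) B (fun _ => β) D (t, toTorus ω)).1) *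
      torusCount Y (toTorus y' + (torusPair (fun _ => α) B (fun _ => β) D (t, toTorus ω)).2) := by
    intro ω t
    have hs := toTorus_torusRep t
    rw [← hs]
    have e1 : (torusPair (fun _ => α) B (fun _ => β) D (toTorus (torusRep t), toTorus ω)).1 =
        toTorus ((α : ℝ) • torusRep t + fun i => (B i : ℝ) * ω i) := by
      rw [toTorus_add, toTorus_smul]
      ext i
      change α • toTorus (torusRep t) i + B i • toTorus ω i = α • toTorus (torusRep t) i +
        (((B i : ℝ) * ω i : ℝ) : UnitAddCircle)
      rw [← zsmul_eq_mul]; rfl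
    have e2 : (torusPair (fun _ => α) B (fun _ => β) D (toTorus (torusRep t), toTorus ω)).2 =
        toTorus ((β : ℝ) • torusRep t + fun i => (D i : ℝ) * ω i) := by
      rw [toTorus_add, toTorus_smul]
      ext i
      change β • toTorus (torusRep t) i + D i • toTorus ω i = β • toTorus (torusRep t) i +
        (((D i : ℝ) * ω i : ℝ) : UnitAddCircle)
      rw [← zsmul_eq_mul]; rfl
    rw [e1, e2]
    simp only [g]
    rw [← toTorus_add (u ω), ← toTorus_smul, ← toTorus_smul, ← toTorus_add, ← toTorus_add,
      ← toTorus_add, ← toTorus_add]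
    congr 3
    · ext i
      by_cases hJ : J i
      · simp only [Pi.add_apply, Pi.smul_apply, smul_eq_mul, u, B, hJ, if_true]
        field_simp
        linear_combination (-ω i) * hab'
      · simp only [Pi.add_apply, Pi.smul_apply, smul_eq_mul, u, B, hJ, if_false]
        push_cast
        field_simp
        ring
    · ext i
      by_cases hJ : J i
      · simp only [Pi.add_apply, Pi.smul_apply, smul_eq_mul, u, D, hJ, if_true]
        push_cast
        field_simp
        ring
      · simp only [Pi.add_apply, Pi.smul_apply, smul_eq_mul, u, D, hJ, if_false]
        field_simp
        linear_combination (-ω i) * hab'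
  have hpt : ∀ x ω, perCount X (y + (α : ℝ) • rowMul (fun _ => w) x +
          fun i => if J i then ω i / (β : ℝ) else (0 : ℝ)) *
        perCount Y (y' + (β : ℝ) • rowMul (fun _ => w) x +
          fun i => if J i then (0 : ℝ) else ω i / (α : ℝ)) =
      g ω (toTorus (rowMul (fun _ : ι => w) x)) := by
    intro x ω
    simp only [g]
    rw [← toTorus_smul, ← toTorus_smul, ← toTorus_add, ← toTorus_add, torusCount_toTorus,
      torusCount_toTorus, add_right_comm, add_right_comm y']
  have hwx : Measurable fun x : ι → κ → ℝ => rowMul (fun _ : ι => w) x := by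
    unfold rowMul; fun_prop
  have hjm : Measurable fun p : (ι → κ → ℝ) × (ι → ℝ) =>
      perCount X (y + (α : ℝ) • rowMul (fun _ => w) p.1 +
          fun i => if J i then p.2 i / (β : ℝ) else (0 : ℝ)) *
        perCount Y (y' + (β : ℝ) • rowMul (fun _ => w) p.1 +
          fun i => if J i then (0 : ℝ) else p.2 i / (α : ℝ)) := by
    refine ((measurable_perCount hX).comp ?_).mul ((measurable_perCount hY).comp ?_)
    · refine measurable_pi_iff.2 fun i => ?_
      by_cases hJ : J i
      · simp only [Pi.add_apply, Pi.smul_apply, hJ, if_true]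
        fun_prop
      · simp only [Pi.add_apply, Pi.smul_apply, hJ, if_false]
        fun_prop
    · refine measurable_pi_iff.2 fun i => ?_
      by_cases hJ : J i
      · simp only [Pi.add_apply, Pi.smul_apply, hJ, if_true]
        fun_prop
      · simp only [Pi.add_apply, Pi.smul_apply, hJ, if_false]
        fun_prop
  rw [lintegral_lintegral_swap hjm.aemeasurable]
  have hwj : ∀ _ : ι, ∃ j, w j ≠ 0 := fun _ => by
    by_contra! h
    exact hw (funext h)
  have h1 : ∀ ω, ∫⁻ x, perCount X (y + (α : ℝ) • rowMul (fun _ => w) x +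
          fun i => if J i then ω i / (β : ℝ) else (0 : ℝ)) *
        perCount Y (y' + (β : ℝ) • rowMul (fun _ => w) x +
          fun i => if J i then (0 : ℝ) else ω i / (α : ℝ)) ∂boxMeasure₂ b =
      ∫⁻ t, g ω (toTorus (u ω) + t) := by
    intro ω
    simp_rw [hpt]
    rw [lintegral_add_left_eq_self (g ω)]
    rw [← ((measurePreserving_torusMul (fun _ : ι => w) hwj).comp
      (measurePreserving_toTorus₂ b)).lintegral_comp (hgm ω)]
    simp only [Function.comp_apply, torusMul_toTorus]
  simp_rw [h1, hshift]
  have hm2 : Measurable fun p : (ι → UnitAddCircle) × (ι → UnitAddCircle) =>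
      torusCount X (toTorus y + (torusPair (fun _ => α) B (fun _ => β) D p).1) *
      torusCount Y (toTorus y' + (torusPair (fun _ => α) B (fun _ => β) D p).2) := by
    have hc := (measurePreserving_torusPair (fun _ => α) B (fun _ => β) D (fun i => by
      by_cases hJ : J i
      · right; simp only [B, D, hJ, if_true]; linarith
      · left; simp only [B, D, hJ, if_false]; linarith)).measurable
    exact (hmX.comp ((measurable_const_add _).comp (measurable_fst.comp hc))).mul
      (hmY.comp ((measurable_const_add _).comp (measurable_snd.comp hc)))
  have hmp := measurePreserving_torusPair (fun _ => α) B (fun _ => β) D (fun i => by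
      by_cases hJ : J i
      · right; simp only [B, D, hJ, if_true]; linarith
      · left; simp only [B, D, hJ, if_false]; linarith)
  have hadd : MeasurePreserving (fun p : (ι → UnitAddCircle) × (ι → UnitAddCircle) =>
      (toTorus y, toTorus y') + p) (volume.prod volume) (volume.prod volume) :=
    measurePreserving_add_left _ _
  have hm : Measurable fun p : (ι → UnitAddCircle) × (ι → UnitAddCircle) =>
      torusCount X p.1 * torusCount Y p.2 :=
    (hmX.comp measurable_fst).mul (hmY.comp measurable_snd)
  have key := (hadd.comp hmp).lintegral_comp hm
  rw [lintegral_prod_mul hmX.aemeasurable hmY.aemeasurable, lintegral_torusCount hX,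
    lintegral_torusCount hY, lintegral_prod_symm' _ (by exact hm.comp (hadd.comp hmp).measurable)]
    at key
  rw [← key, ← (measurePreserving_toTorus (0 : ι → ℝ)).lintegral_comp]
  · rfl
  · exact (hm.comp (hadd.comp hmp).measurable).lintegral_prod_left'

end Parallel

/-! ### Volume and distribution of the norm on one block -/

section Block

variable {s : ℕ} (N : Seminorm ℝ (Fin s → ℝ))

lemma continuous_seminorm : Continuous N :=
  continuousOn_univ.1 (N.convexOn.continuousOn isOpen_univ)

lemma exists_seminorm_le_norm : ∃ C : ℝ, 1 ≤ C ∧ ∀ x, N x ≤ C * ‖x‖ := by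
  obtain ⟨C, hC, h⟩ := Seminorm.bound_of_continuous_normedSpace N (continuous_seminorm N)
  exact ⟨max 1 C, le_max_left _ _, fun x => (h x).trans
    (mul_le_mul_of_nonneg_right (le_max_right _ _) (norm_nonneg _))⟩

variable {N} (hN : ∀ x, N x = 0 → x = 0)
include hN

lemma exists_norm_le_seminorm : ∃ c : ℝ, 1 ≤ c ∧ ∀ x, ‖x‖ ≤ c * N x := by
  rcases (Metric.sphere (0 : Fin s → ℝ) 1).eq_empty_or_nonempty with h | h
  · refine ⟨1, le_rfl, fun x => ?_⟩
    have : x = 0 := by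
      by_contra hx
      have : (‖x‖⁻¹ • x) ∈ Metric.sphere (0 : Fin s → ℝ) 1 := by
        simp [norm_smul, norm_ne_zero_iff.2 hx]
      rw [h] at this; exact this
    simp [this]
  · obtain ⟨x₀, hx₀, hmin⟩ := (isCompact_sphere (0 : Fin s → ℝ) 1).exists_isMinOn h
      (continuous_seminorm N).continuousOn
    have hx₁ : ‖x₀‖ = 1 := by simpa using hx₀
    have hpos : 0 < N x₀ := lt_of_le_of_ne (apply_nonneg N x₀) fun h0 => by
      rw [hN x₀ h0.symm] at hx₁; simp at hx₁
    refine ⟨max 1 (N x₀)⁻¹, le_max_left _ _, fun x => ?_⟩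
    rcases eq_or_ne x 0 with rfl | hx
    · simp
    have hxn : 0 < ‖x‖ := norm_pos_iff.2 hx
    have h1 : N x₀ ≤ N (‖x‖⁻¹ • x) := hmin (by simp [norm_smul, hxn.ne'])
    rw [map_smul_eq_mul, norm_inv, norm_norm] at h1
    have h2 : ‖x‖ * N x₀ ≤ N x := by
      rw [← div_eq_inv_mul, le_div_iff₀ hxn] at h1; linarith
    calc ‖x‖ = (N x₀)⁻¹ * (‖x‖ * N x₀) := by field_simp
      _ ≤ (N x₀)⁻¹ * N x := by gcongr
      _ ≤ max 1 (N x₀)⁻¹ * N x := by gcongr; exact le_max_right _ _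

omit hN

/-- The volume of the unit ball. -/
def ballVol (N : Seminorm ℝ (Fin s → ℝ)) : ℝ≥0∞ := volume {x | N x ≤ 1}

lemma measurable_seminorm : Measurable N := (continuous_seminorm N).measurable

include hN

lemma ballVol_lt_top : ballVol N < ∞ := by
  obtain ⟨c, hc, h⟩ := exists_norm_le_seminorm hN
  refine (measure_mono ?_).trans_lt (measure_closedBall_lt_top (x := (0 : Fin s → ℝ)) (r := c))
  intro x hx
  have hx' : N x ≤ 1 := hx
  rw [mem_closedBall_zero_iff]
  exact (h x).trans (by nlinarith)

open scoped Pointwise in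
-- By homogeneity, for t > 0 the set is the dilate of the unit ball by t^{1/s}, whose volume scales
-- by t. For t ≤ 0 it lies in {0}, a null set because s ≥ 1.
lemma volume_seminorm_pow_le (hs : 1 ≤ s) (t : ℝ) :
    volume {x | N x ^ s ≤ t} = ballVol N * ENNReal.ofReal t := by
  rcases le_or_gt t 0 with ht | ht
  · rw [ENNReal.ofReal_of_nonpos ht, mul_zero]
    have : Nonempty (Fin s) := ⟨⟨0, hs⟩⟩
    refine measure_mono_null (t := {0}) (fun x hx => ?_) (measure_singleton _)
    have h0 : N x ^ s = 0 := le_antisymm (le_trans hx ht) (by positivity)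
    exact hN x (pow_eq_zero_iff (by lia) |>.1 h0)
  · set ρ : ℝ := t ^ (1 / (s : ℝ)) with hρ
    have hρ0 : 0 < ρ := Real.rpow_pos_of_pos ht _
    have hρs : ρ ^ s = t := by
      rw [hρ, ← Real.rpow_natCast, ← Real.rpow_mul ht.le, one_div,
        inv_mul_cancel₀ (by positivity), Real.rpow_one]
    have : {x | N x ^ s ≤ t} = ρ • {x | N x ≤ 1} := by
      ext x
      rw [Set.mem_smul_set_iff_inv_smul_mem₀ hρ0.ne']
      simp only [Set.mem_ofPred_eq]
      rw [map_smul_eq_mul, norm_inv, Real.norm_of_nonneg hρ0.le, ← div_eq_inv_mul,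
        div_le_one hρ0, ← hρs, pow_le_pow_iff_left₀ (apply_nonneg N x) hρ0.le (by lia)]
    rw [this, Measure.addHaar_smul, ballVol, mul_comm]
    simp [hρs, abs_of_pos ht]

/-- The distribution of `N ^ s` under Lebesgue measure. -/
lemma map_seminorm_pow (hs : 1 ≤ s) :
    Measure.map (fun x => N x ^ s) volume = ballVol N • volume.restrict (Set.Ioi 0) := by
  have hm : Measurable fun x => N x ^ s := measurable_seminorm.pow_const s
  have hfin := ballVol_lt_top hN
  have h1 : ∀ t, Measure.map (fun x => N x ^ s) volume (Set.Iic t) =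
      ballVol N * ENNReal.ofReal t := fun t => by
    rw [Measure.map_apply hm measurableSet_Iic]
    exact volume_seminorm_pow_le hN hs t
  have h2 : ∀ t, (ballVol N • (volume : Measure ℝ).restrict (Set.Ioi 0)) (Set.Iic t) =
      ballVol N * ENNReal.ofReal t := fun t => by
    rw [Measure.smul_apply, Measure.restrict_apply measurableSet_Iic, Set.inter_comm,
      Set.Ioi_inter_Iic, Real.volume_Ioc, sub_zero, smul_eq_mul]
  have hlf : IsLocallyFiniteMeasure (Measure.map (fun x => N x ^ s) volume) := by
    refine ⟨fun t => ⟨Set.Iic (t + 1), Iic_mem_nhds (by linarith), ?_⟩⟩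
    rw [h1]; exact ENNReal.mul_lt_top hfin ENNReal.ofReal_lt_top
  refine Measure.ext_of_Ioc _ _ fun a b hab => ?_
  rw [← Set.Iic_sdiff_Iic, measure_sdiff (Set.Iic_subset_Iic.2 hab.le)
    measurableSet_Iic.nullMeasurableSet, measure_sdiff (Set.Iic_subset_Iic.2 hab.le)
    measurableSet_Iic.nullMeasurableSet, h1, h1, h2, h2]
  · rw [h2]; exact (ENNReal.mul_lt_top hfin ENNReal.ofReal_lt_top).ne
  · rw [h1]; exact (ENNReal.mul_lt_top hfin ENNReal.ofReal_lt_top).ne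

end Block

/-! ### Joint distribution of the block norms -/

section Blocks

variable {k : ℕ} {m : Fin k → ℕ}

lemma measurePreserving_curry :
    MeasurePreserving (fun (x : Idx m → ℝ) i => block i x) volume volume := by
  let e := MeasurableEquiv.piCurry (fun (i : Fin k) (_ : Fin (m i)) => ℝ)
  have h : MeasurePreserving e.symm volume volume := by
    refine ⟨e.symm.measurable, ?_⟩
    symm
    refine Measure.pi_eq fun S hS => ?_
    rw [Measure.map_apply e.symm.measurable (MeasurableSet.univ_pi hS)]
    have : e.symm ⁻¹' (Set.univ.pi S) =
        Set.univ.pi fun i => Set.univ.pi fun j => S ⟨i, j⟩ := by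
      ext x
      simp only [Set.mem_preimage, Set.mem_univ_pi]
      exact ⟨fun h i j => h ⟨i, j⟩, fun h p => h p.1 p.2⟩
    rw [this, volume_pi_pi]
    simp_rw [volume_pi_pi]
    rw [← Finset.univ_sigma_univ, Finset.prod_sigma]
  exact h.symm

lemma measurable_block (i : Fin k) : Measurable (block i : (Idx m → ℝ) → _) :=
  measurable_pi_lambda _ fun _ => measurable_pi_apply _

variable {N : ∀ i, Seminorm ℝ (Fin (m i) → ℝ)} (hm : ∀ i, 1 ≤ m i)
  (hN : ∀ i x, N i x = 0 → x = 0)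
include hm hN

/-- Pushing Lebesgue measure forward block by block removes the norms from every later volume
computation: only their ball volumes survive, as a constant factor. -/
lemma map_blocks_pow :
    Measure.map (fun (y : Idx m → ℝ) i => N i (block i y) ^ m i) volume =
      (∏ i, ballVol (N i)) • (volume.restrict (Set.univ.pi fun _ => Set.Ioi 0)) := by
  have h1 : Measure.map (fun (x : ∀ i, Fin (m i) → ℝ) i => N i (x i) ^ m i) volume =
      Measure.pi fun i => ballVol (N i) • volume.restrict (Set.Ioi (0 : ℝ)) := by
    have : ∀ i, SigmaFinite (Measure.map (fun x => N i x ^ m i) volume) := fun i => by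
      rw [map_seminorm_pow (hN i) (hm i)]
      lift ballVol (N i) to NNReal using (ballVol_lt_top (hN i)).ne with c
      exact inferInstanceAs (SigmaFinite (c • volume.restrict (Set.Ioi (0 : ℝ))))
    rw [volume_pi, Measure.pi_map_pi fun i => (measurable_seminorm.pow_const _).aemeasurable]
    congr 1; ext1 i
    exact map_seminorm_pow (hN i) (hm i)
  have h2 : (fun (y : Idx m → ℝ) i => N i (block i y) ^ m i) =
      (fun (x : ∀ i, Fin (m i) → ℝ) i => N i (x i) ^ m i) ∘ fun y i => block i y := rfl
  have hmeas : Measurable (fun (x : ∀ i, Fin (m i) → ℝ) i => N i (x i) ^ m i) :=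
    measurable_pi_lambda _ fun i => (measurable_seminorm.comp (measurable_pi_apply i)).pow_const _
  rw [h2, ← Measure.map_map hmeas measurePreserving_curry.measurable,
    measurePreserving_curry.map_eq, h1]
  have : ∀ i, SigmaFinite (ballVol (N i) • volume.restrict (Set.Ioi (0 : ℝ))) := fun i => by
      lift ballVol (N i) to NNReal using (ballVol_lt_top (hN i)).ne with c
      exact inferInstanceAs (SigmaFinite (c • volume.restrict (Set.Ioi (0 : ℝ))))
  refine Measure.pi_eq fun S hS => ?_
  rw [volume_pi, Measure.restrict_pi_pi, Measure.smul_apply, Measure.pi_pi]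
  simp [Finset.prod_mul_distrib]

omit hm in
lemma volume_blocks_le_one :
    volume {y : Idx m → ℝ | ∀ i, N i (block i y) ≤ 1} = ∏ i, ballVol (N i) := by
  have : {y : Idx m → ℝ | ∀ i, N i (block i y) ≤ 1} = (fun (x : Idx m → ℝ) i => block i x) ⁻¹'
      (Set.univ.pi fun i => {x | N i x ≤ 1}) := by
    ext y; simp
  rw [this, measurePreserving_curry.measure_preimage, volume_pi_pi]
  · rfl
  · exact (MeasurableSet.univ_pi fun i =>
      measurableSet_le measurable_seminorm measurable_const).nullMeasurableSet

end Blocks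

/-! ### Volume under a multiplicative constraint -/

section Hyperbolic

lemma volume_eq_lintegral_cons {n : ℕ} {S : Set (Fin (n + 1) → ℝ)} (hS : MeasurableSet S) :
    volume S = ∫⁻ t, volume {x : Fin n → ℝ | (Fin.cons t x : Fin (n + 1) → ℝ) ∈ S} := by
  have h := (volume_preserving_piFinSuccAbove (fun _ : Fin (n + 1) => ℝ) 0).symm
  rw [← h.measure_preimage hS.nullMeasurableSet]
  change (volume.prod volume) _ = _
  rw [Measure.prod_apply (h.measurable hS)]
  refine lintegral_congr fun t => ?_
  congr 1; ext x
  simp [MeasurableEquiv.piFinSuccAbove, Fin.insertNthEquiv]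

lemma measurableSet_hyperbolic {k : ℕ} (E : Fin k → ℝ) (δ : ℝ) :
    MeasurableSet {t : Fin k → ℝ | (∀ i, 0 < t i ∧ t i ≤ E i) ∧ ∏ i, t i ≤ δ} := by
  have : {t : Fin k → ℝ | (∀ i, 0 < t i ∧ t i ≤ E i) ∧ ∏ i, t i ≤ δ} =
      (Set.univ.pi fun i => Set.Ioc 0 (E i)) ∩ {t | ∏ i, t i ≤ δ} := by
    ext; simp
  rw [this]
  exact (MeasurableSet.univ_pi fun i => measurableSet_Ioc).inter (measurableSet_le
    (Finset.measurable_prod _ fun i _ => measurable_pi_apply i) measurable_const)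

/-- The integrand has antiderivative δ(log(t/δ) + C)^{k+1}/(k+1)!. This is the one-variable
integration in the induction for hyperbolic volumes. -/
lemma lintegral_div_mul_log_pow (k : ℕ) {δ E C : ℝ} (hδ : 0 < δ) (hE : δ ≤ E) (hC : 0 ≤ C) :
    ∫⁻ t in Set.Ioc δ E, ENNReal.ofReal (δ / t * ((Real.log (t / δ) + C) ^ k / k !)) =
      ENNReal.ofReal (δ * ((Real.log (E / δ) + C) ^ (k + 1) / (k + 1)! - C ^ (k + 1) / (k + 1)!)) := by
  have hder : ∀ t ∈ Set.uIcc δ E, HasDerivAt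
      (fun t => δ * ((Real.log (t / δ) + C) ^ (k + 1) / (k + 1)!))
      (δ / t * ((Real.log (t / δ) + C) ^ k / k !)) t := by
    intro t ht
    rw [Set.uIcc_of_le hE] at ht
    have ht0 : 0 < t := hδ.trans_le ht.1
    have h1 : HasDerivAt (fun t => Real.log (t / δ)) ((1 / δ) / (t / δ)) t :=
      ((hasDerivAt_id t).div_const δ).log (by positivity)
    have h2 := ((((h1.add_const C).pow (k + 1)).div_const ((k + 1)! : ℝ)).const_mul δ)
    refine h2.congr_deriv ?_
    rw [Nat.factorial_succ]
    push_cast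
    field_simp
    try simp
  have hcont : ContinuousOn (fun t => δ / t * ((Real.log (t / δ) + C) ^ k / k !))
      (Set.Icc δ E) := by
    intro t ht
    have ht0 : 0 < t := hδ.trans_le ht.1
    have : t / δ ≠ 0 := by positivity
    have h3 : ContinuousAt (fun t => Real.log (t / δ)) t :=
      (continuousAt_id.div_const δ).log this
    exact ((continuousAt_const.div continuousAt_id ht0.ne').mul
      (((h3.add continuousAt_const).pow k).div_const _)).continuousWithinAt
  have hint : IntervalIntegrable (fun t => δ / t * ((Real.log (t / δ) + C) ^ k / k !))
      volume δ E := by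
    refine ContinuousOn.intervalIntegrable ?_
    rwa [Set.uIcc_of_le hE]
  rw [← ofReal_integral_eq_lintegral_ofReal, ← intervalIntegral.integral_of_le hE,
    intervalIntegral.integral_eq_sub_of_hasDerivAt hder hint]
  · congr 1
    rw [div_self hδ.ne', Real.log_one, zero_add]
    ring
  · exact (intervalIntegrable_iff_integrableOn_Ioc_of_le hE).1 hint
  · refine (ae_restrict_iff' measurableSet_Ioc).2 (ae_of_all _ fun t ht => ?_)
    have ht0 : 0 < t := hδ.trans ht.1
    have : 0 ≤ Real.log (t / δ) := Real.log_nonneg ((one_le_div hδ).2 ht.1.le)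
    simp only [Pi.zero_apply]
    positivity

/-- The volume of a box cut off by a hyperbolic condition. -/
lemma exists_volume_hyperbolic_le (k : ℕ) (E : Fin (k + 1) → ℝ) (hE : ∀ i, 0 < E i) :
    ∃ C : ℝ, 0 ≤ C ∧ ∀ δ : ℝ, 0 < δ →
      volume {t : Fin (k + 1) → ℝ | (∀ i, 0 < t i ∧ t i ≤ E i) ∧ ∏ i, t i ≤ δ} ≤
        ENNReal.ofReal (δ * ((Real.posLog δ⁻¹ + C) ^ k / k !)) := by
  induction k with
  | zero =>
    refine ⟨0, le_rfl, fun δ hδ => ?_⟩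
    calc volume {t : Fin 1 → ℝ | (∀ i, 0 < t i ∧ t i ≤ E i) ∧ ∏ i, t i ≤ δ}
        ≤ volume (Set.univ.pi fun _ : Fin 1 => Set.Ioc 0 δ) := by
          refine measure_mono fun t ht => ?_
          have h1 := ht.2
          simp only [Finset.univ_unique, Finset.prod_singleton] at h1
          intro i _
          rw [Subsingleton.elim i default]
          exact ⟨(ht.1 _).1, h1⟩
      _ = _ := by rw [volume_pi_pi]; simp
  | succ k ih =>
    obtain ⟨C, hC, ih⟩ := ih (fun i => E i.succ) fun i => hE _
    set B : ℝ := ∏ i : Fin (k + 1), E i.succ with hB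
    have hB0 : 0 < B := Finset.prod_pos fun i _ => hE _
    -- The last summand absorbs the slab t ≤ δ, which contributes Bδ; the others absorb log E 0 and
    -- the constant of the lower dimension.
    refine ⟨Real.posLog (E 0) + C + (B * (k + 1)! + 1), by
      have := Real.posLog_nonneg (x := E 0); positivity, fun δ hδ => ?_⟩
    rw [volume_eq_lintegral_cons (measurableSet_hyperbolic _ _)]
    have hsec : ∀ t : ℝ, {x : Fin (k + 1) → ℝ | (Fin.cons t x : Fin (k + 2) → ℝ) ∈
        {t : Fin (k + 2) → ℝ | (∀ i, 0 < t i ∧ t i ≤ E i) ∧ ∏ i, t i ≤ δ}} =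
        {x | (0 < t ∧ t ≤ E 0) ∧ (∀ i, 0 < x i ∧ x i ≤ E i.succ) ∧ t * ∏ i, x i ≤ δ} := by
      intro t; ext x
      simp [Fin.forall_fin_succ (n := k + 1), Fin.prod_univ_succ (n := k + 1), and_assoc]
    -- Slice along the first coordinate t. If t ≤ δ the slice is bounded by the whole remaining box,
    -- of volume B; if t > δ the product of the other coordinates is at most δ/t < 1 and the
    -- induction hypothesis applies.
    have hbound : ∀ t : ℝ, volume {x : Fin (k + 1) → ℝ | (0 < t ∧ t ≤ E 0) ∧
        (∀ i, 0 < x i ∧ x i ≤ E i.succ) ∧ t * ∏ i, x i ≤ δ} ≤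
        (Set.Ioc 0 δ).indicator (fun _ => ENNReal.ofReal B) t +
        (Set.Ioc δ (E 0)).indicator
          (fun t => ENNReal.ofReal (δ / t * ((Real.log (t / δ) + C) ^ k / k !))) t := by
      intro t
      by_cases ht : 0 < t ∧ t ≤ E 0
      · rcases le_or_gt t δ with htδ | htδ
        · refine le_add_right ?_
          rw [Set.indicator_of_mem (show t ∈ Set.Ioc 0 δ from ⟨ht.1, htδ⟩)]
          calc _ ≤ volume (Set.univ.pi fun i : Fin (k + 1) => Set.Ioc 0 (E i.succ)) :=
                measure_mono fun x hx i _ => hx.2.1 i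
            _ = ENNReal.ofReal B := by
                rw [volume_pi_pi, hB, ENNReal.ofReal_prod_of_nonneg fun i _ => (hE _).le]
                simp
        · refine le_add_left ?_
          rw [Set.indicator_of_mem (show t ∈ Set.Ioc δ (E 0) from ⟨htδ, ht.2⟩)]
          refine (measure_mono ?_).trans ((ih (δ / t) (div_pos hδ ht.1)).trans ?_)
          · refine fun x hx => ⟨hx.2.1, ?_⟩
            rw [le_div_iff₀ ht.1, mul_comm]; exact hx.2.2
          · rw [inv_div, Real.posLog_eq_log]
            rw [abs_of_pos (by have := ht.1; positivity)]
            exact (one_le_div hδ).2 htδ.le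
      · have : {x : Fin (k + 1) → ℝ | (0 < t ∧ t ≤ E 0) ∧
            (∀ i, 0 < x i ∧ x i ≤ E i.succ) ∧ t * ∏ i, x i ≤ δ} = ∅ := by
          ext x; simp only [Set.mem_ofPred_eq, Set.mem_empty_iff_false, iff_false]
          exact fun h => ht h.1
        rw [this]; simp
    simp_rw [hsec]
    refine (lintegral_mono hbound).trans ?_
    rw [lintegral_add_left (measurable_const.indicator measurableSet_Ioc),
      lintegral_indicator measurableSet_Ioc, lintegral_indicator measurableSet_Ioc,
      setLIntegral_const, Real.volume_Ioc, sub_zero, ← ENNReal.ofReal_mul hB0.le]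
    have hp := Real.posLog_nonneg (x := δ⁻¹)
    have hp0 := Real.posLog_nonneg (x := E 0)
    set Z := Real.posLog δ⁻¹ + (Real.posLog (E 0) + C) with hZ
    have hZ0 : 0 ≤ Z := by positivity
    have hfac : (0 : ℝ) < (k + 1)! := by exact_mod_cast Nat.factorial_pos _
    have hint : ∫⁻ t in Set.Ioc δ (E 0),
        ENNReal.ofReal (δ / t * ((Real.log (t / δ) + C) ^ k / k !)) ≤
        ENNReal.ofReal (δ * (Z ^ (k + 1) / (k + 1)!)) := by
      rcases le_or_gt δ (E 0) with h | h
      · rw [lintegral_div_mul_log_pow k hδ h hC]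
        refine ENNReal.ofReal_le_ofReal (mul_le_mul_of_nonneg_left ?_ hδ.le)
        have h1 : Real.log (E 0 / δ) + C ≤ Z := by
          have h2 : Real.log (E 0 / δ) = Real.log (E 0) + Real.log δ⁻¹ := by
            rw [Real.log_div (hE 0).ne' hδ.ne', Real.log_inv]; ring
          have h3 : Real.log (E 0) ≤ Real.posLog (E 0) := le_max_right _ _
          have h4 : Real.log δ⁻¹ ≤ Real.posLog δ⁻¹ := le_max_right _ _
          rw [h2, hZ]; linarith
        have h0 : 0 ≤ Real.log (E 0 / δ) := Real.log_nonneg ((one_le_div hδ).2 h)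
        have h5 : (Real.log (E 0 / δ) + C) ^ (k + 1) / (k + 1)! ≤ Z ^ (k + 1) / (k + 1)! := by
          gcongr
        have h6 : 0 ≤ C ^ (k + 1) / ((k + 1)! : ℝ) := by positivity
        linarith
      · rw [Set.Ioc_eq_empty (by linarith)]; simp
    refine (add_le_add le_rfl hint).trans ?_
    rw [← ENNReal.ofReal_add (by positivity) (by positivity)]
    refine ENNReal.ofReal_le_ofReal ?_
    -- Superadditivity of the power hides the lower-order term B(k+1)! inside the base, so the
    -- leading coefficient 1/(k+1)! stays exact.
    have h7 : Z ^ (k + 1) + (B * (k + 1)! + 1) ^ (k + 1) ≤ (Z + (B * (k + 1)! + 1)) ^ (k + 1) :=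
      pow_add_pow_le hZ0 (by positivity) (by lia)
    have h8 : B * (k + 1)! ≤ (B * (k + 1)! + 1) ^ (k + 1) := by
      have : B * (k + 1)! + 1 ≤ (B * (k + 1)! + 1) ^ (k + 1) :=
        le_self_pow₀ (by have : 0 < B * (k + 1)! := by positivity
                         linarith) (by lia)
      linarith
    calc B * δ + δ * (Z ^ (k + 1) / (k + 1)!)
        = δ * ((Z ^ (k + 1) + B * (k + 1)!) / (k + 1)!) := by field_simp; ring
      _ ≤ δ * ((Z + (B * (k + 1)! + 1)) ^ (k + 1) / (k + 1)!) := by gcongr; linarith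
      _ = _ := by rw [hZ]; congr 3; ring

end Hyperbolic

/-! ### Sums over a residue class in one block, compared with integrals -/

section BlockSum

variable {s : ℕ}

/-- The weight `max {1, ‖q‖ ^ s}` of an integer vector. -/
def blockWeight (N : Seminorm ℝ (Fin s → ℝ)) (q : Fin s → ℤ) : ℝ :=
  max 1 (N (intToReal q) ^ s)

lemma one_le_blockWeight (N : Seminorm ℝ (Fin s → ℝ)) (q : Fin s → ℤ) : 1 ≤ blockWeight N q :=
  le_max_left _ _

/-- The substitution t = e^x. It makes inverse weights into Lebesgue measure on a logarithmic scale,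
which is where the powers of T come from. -/
lemma lintegral_inv_mul_log {ψ : ℝ → ℝ≥0∞} {L : ℝ} :
    ∫⁻ t in Set.Ioc 1 (Real.exp L), ENNReal.ofReal t⁻¹ * ψ (Real.log t) =
      ∫⁻ x in Set.Ioc 0 L, ψ x := by
  have himg : Real.exp '' Set.Ioc 0 L = Set.Ioc 1 (Real.exp L) := by
    ext t
    constructor
    · rintro ⟨x, hx, rfl⟩
      exact ⟨Real.one_lt_exp_iff.2 hx.1, Real.exp_le_exp.2 hx.2⟩
    · intro ht
      have ht0 : 0 < t := by linarith [ht.1]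
      exact ⟨Real.log t, ⟨Real.log_pos ht.1, (Real.log_le_iff_le_exp ht0).2 ht.2⟩,
        Real.exp_log ht0⟩
  rw [← himg, lintegral_image_eq_lintegral_abs_deriv_mul measurableSet_Ioc
    (fun x _ => (Real.hasDerivAt_exp x).hasDerivWithinAt) Real.exp_injective.injOn]
  refine lintegral_congr fun x => ?_
  rw [Real.log_exp, ← mul_assoc, abs_of_pos (Real.exp_pos x),
    ← ENNReal.ofReal_mul (Real.exp_pos x).le, mul_inv_cancel₀ (Real.exp_pos x).ne',
    ENNReal.ofReal_one, one_mul]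

lemma lintegral_comp_add_smul (F : (Fin s → ℝ) → ℝ≥0∞) (hF : Measurable F) (c : Fin s → ℝ)
    {P : ℝ} (hP : 0 < P) :
    ∫⁻ v, F (c + P • v) = ENNReal.ofReal ((P ^ s)⁻¹) * ∫⁻ y, F y := by
  have h1 := Measure.map_addHaar_smul (volume : Measure (Fin s → ℝ)) hP.ne'
  have h2 : ∫⁻ v, F (c + P • v) = ∫⁻ y, F (c + y) ∂(Measure.map (P • ·) volume) := by
    have hF' : Measurable fun y => F (c + y) := hF.comp (measurable_const_add c)
    rw [lintegral_map hF' (measurable_const_smul P)]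
  rw [h2, h1, lintegral_smul_measure, lintegral_add_left_eq_self F, smul_eq_mul]
  congr 2
  rw [Module.finrank_fin_fun, abs_of_pos (by positivity)]

/-- Here a is the norm at a lattice point and b the norm at a point of the cube attached to it, at
distance at most D. As D ≤ τa, replacing a by b costs at most the factor (1 + τ)^s ≤ 1 + κ in the
inverse weight, and a ≤ 2b costs at most s log 2 in the logarithm. -/
lemma block_term_le (hs : 1 ≤ s) {τ κ D T a b : ℝ} {ψ : ℝ → ℝ≥0∞} (hτ0 : 0 < τ) (hτ1 : τ ≤ 1 / 2)
    (hτ : (1 + τ) ^ s ≤ 1 + κ) (hψ : Monotone ψ) (h1 : b ≤ a + D) (h2 : a ≤ b + D)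
    (hDa : D ≤ τ * a) (hb : 1 < b) (ha : 1 < a) (hT : a ≤ Real.exp T) :
    ENNReal.ofReal (max 1 (a ^ s))⁻¹ * ψ (Real.log (max 1 (a ^ s))) ≤
      ENNReal.ofReal (1 + κ) * (Set.Ioc 1 (Real.exp (s * T + s * Real.log 2))).indicator
        (fun t => ENNReal.ofReal t⁻¹ * ψ (Real.log t + s * Real.log 2)) (b ^ s) := by
  have hexpL : Real.exp (s * T + s * Real.log 2) = (2 * Real.exp T) ^ s := by
    rw [← mul_add, mul_comm, Real.exp_mul, Real.rpow_natCast, Real.exp_add,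
      Real.exp_log two_pos, mul_comm]
  have ha0 : 0 < a := by linarith
  have hb0 : 0 < b := by linarith
  have hκ : 0 ≤ 1 + κ := le_trans (by positivity) hτ
  have hτa : τ * a ≤ 1 / 2 * a := mul_le_mul_of_nonneg_right hτ1 ha0.le
  have ha2 : a ≤ b * 2 := by linarith
  have hya : b ≤ (1 + τ) * a := by linarith
  have hmem : b ^ s ∈ Set.Ioc 1 (Real.exp (s * T + s * Real.log 2)) := by
    refine ⟨one_lt_pow₀ hb (by lia), ?_⟩
    rw [hexpL]
    exact pow_le_pow_left₀ hb0.le (by linarith) s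
  rw [Set.indicator_of_mem hmem, max_eq_right (one_le_pow₀ ha.le), ← mul_assoc,
    ← ENNReal.ofReal_mul hκ]
  refine mul_le_mul' (ENNReal.ofReal_le_ofReal ?_) (hψ ?_)
  · rw [← div_eq_mul_inv, inv_eq_one_div, div_le_div_iff₀ (by positivity) (by positivity), one_mul]
    calc b ^ s ≤ ((1 + τ) * a) ^ s := pow_le_pow_left₀ hb0.le hya s
      _ = (1 + τ) ^ s * a ^ s := mul_pow _ _ _
      _ ≤ (1 + κ) * a ^ s := by gcongr
  · rw [Real.log_pow, Real.log_pow, ← mul_add, ← Real.log_mul hb0.ne' two_ne_zero]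
    gcongr

variable {N : Seminorm ℝ (Fin s → ℝ)} (hN : ∀ x, N x = 0 → x = 0)
include hN

lemma ballVol_pos : 0 < ballVol N := by
  obtain ⟨C, hC, h⟩ := exists_seminorm_le_norm N
  refine (Metric.measure_ball_pos volume (0 : Fin s → ℝ) (r := C⁻¹) (by positivity)).trans_le
    (measure_mono fun x hx => ?_)
  rw [mem_ball_zero_iff] at hx
  calc N x ≤ C * ‖x‖ := h x
    _ ≤ C * C⁻¹ := by gcongr
    _ = 1 := mul_inv_cancel₀ (by positivity)

/-- The sum over a residue class in one block, dominated by an integral. -/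
lemma exists_tsum_block_le (hs : 1 ≤ s) {P : ℕ} (hP : 1 ≤ P) (c : Fin s → ℤ) {κ : ℝ}
    (hκ : 0 < κ) :
    ∃ C : ℝ, 0 ≤ C ∧ ∀ T : ℝ, 0 ≤ T → ∀ ψ : ℝ → ℝ≥0∞, Monotone ψ →
      ∑' u : Fin s → ℤ, (if N (intToReal (c + (P : ℤ) • u)) ≤ Real.exp T then
          ENNReal.ofReal (blockWeight N (c + (P : ℤ) • u))⁻¹ *
            ψ (Real.log (blockWeight N (c + (P : ℤ) • u))) else 0) ≤
        ENNReal.ofReal ((1 + κ) * (ballVol N).toReal / P ^ s) *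
          ∫⁻ x in Set.Ioc 0 (s * T + C), ψ (x + C) := by
  obtain ⟨CN, hCN, hCN'⟩ := exists_seminorm_le_norm N
  obtain ⟨cN, hcN, hcN'⟩ := exists_norm_le_seminorm hN
  have hP0 : (0 : ℝ) < P := by exact_mod_cast hP
  obtain ⟨τ, hτ0, hτ1, hτ⟩ : ∃ τ : ℝ, 0 < τ ∧ τ ≤ 1 / 2 ∧ (1 + τ) ^ s ≤ 1 + κ := by
    have h1 : Tendsto (fun τ : ℝ => (1 + τ) ^ s) (nhdsWithin 0 (Set.Ioi 0)) (nhds 1) := by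
      have : ContinuousAt (fun τ : ℝ => (1 + τ) ^ s) 0 := by fun_prop
      simpa using this.tendsto.mono_left nhdsWithin_le_nhds
    have h2 := h1.eventually (gt_mem_nhds (show (1 : ℝ) < 1 + κ by linarith))
    have h3 : ∀ᶠ τ : ℝ in nhdsWithin 0 (Set.Ioi 0), τ ≤ 1 / 2 :=
      mem_nhdsWithin_of_mem_nhds (Iic_mem_nhds (by norm_num))
    obtain ⟨τ, hτ, h4, h5⟩ := (h2.and (h3.and self_mem_nhdsWithin)).exists
    exact ⟨τ, h5, h4, hτ.le⟩
  set b : ℝ := (ballVol N).toReal with hb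
  have hbV : ballVol N = ENNReal.ofReal b := (ENNReal.ofReal_toReal (ballVol_lt_top hN).ne).symm
  have hb0 : 0 < b := ENNReal.toReal_pos (ballVol_pos hN).ne' (ballVol_lt_top hN).ne
  set D : ℝ := P * CN with hD
  have hD0 : 0 < D := by positivity
  -- Beyond norm K a displacement of size D is a τ-small relative change, and the displaced point
  -- still has norm greater than 1.
  set K : ℝ := D / τ + D + 2 with hK
  have hK2 : 2 ≤ K := by have : 0 < D / τ := by positivity
                         linarith
  have hDK : D ≤ τ * K := by
    have : τ * (D / τ) = D := by field_simp
    rw [hK, mul_add, mul_add, this]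
    have : 0 ≤ τ * D := by positivity
    linarith
  set nK : ℝ := (2 * (cN * K / P) + 1) ^ Fintype.card (Fin s) with hnK
  have hnK0 : 0 ≤ nK := by positivity
  set C₁ : ℝ := s * Real.log 2 with hC₁
  have hC₁0 : 0 ≤ C₁ := by have := Real.log_nonneg (one_le_two (α := ℝ)); positivity
  set C₂ : ℝ := s * Real.log K with hC₂
  have hC₂0 : 0 ≤ C₂ := by have := Real.log_nonneg (show 1 ≤ K by linarith); positivity
  set A : ℝ := nK * P ^ s / b with hA
  have hA0 : 0 ≤ A := by positivity
  refine ⟨C₁ + C₂ + A, by positivity, fun T hT ψ hψ => ?_⟩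
  set L : ℝ := s * T + C₁ with hL
  have hL0 : 0 ≤ L := by positivity
  let q : (Fin s → ℤ) → Fin s → ℤ := fun u => c + (P : ℤ) • u
  let g : ℝ → ℝ≥0∞ := (Set.Ioc 1 (Real.exp L)).indicator
    fun t => ENNReal.ofReal t⁻¹ * ψ (Real.log t + C₁)
  have hψm : Measurable ψ := hψ.measurable
  have hgm : Measurable g := by
    refine Measurable.indicator ?_ measurableSet_Ioc
    exact (measurable_inv.ennreal_ofReal).mul
      (hψm.comp (Real.measurable_log.add_const _))
  let G : (Fin s → ℝ) → ℝ≥0∞ := fun y => g (N y ^ s)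
  have hGm : Measurable G := hgm.comp (measurable_seminorm.pow_const s)
  have hqv : ∀ u x, intToReal c + (P : ℝ) • (intToReal u + x) = intToReal (q u) + (P : ℝ) • x := by
    intro u x; ext i; simp [q, intToReal]; ring
  -- pointwise bound
  have hpt : ∀ u, (if N (intToReal (q u)) ≤ Real.exp T then
        ENNReal.ofReal (blockWeight N (q u))⁻¹ * ψ (Real.log (blockWeight N (q u))) else 0) ≤
      {x | N ((P : ℝ) • x) ≤ K}.indicator 1 (intToReal u + (P : ℝ)⁻¹ • intToReal c) * ψ C₂ +
      ENNReal.ofReal (1 + κ) *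
        ∫⁻ x, G (intToReal c + (P : ℝ) • (intToReal u + x)) ∂boxMeasure 0 := by
    intro u
    split_ifs with hu
    swap
    · exact zero_le
    rcases le_or_gt (N (intToReal (q u))) K with h | h
    · refine le_add_right ?_
      have : intToReal u + (P : ℝ)⁻¹ • intToReal c ∈ {x | N ((P : ℝ) • x) ≤ K} := by
        have e : (P : ℝ) • (intToReal u + (P : ℝ)⁻¹ • intToReal c) = intToReal (q u) := by
          ext i; simp [q, intToReal]; field_simp; ring
        change N ((P : ℝ) • (intToReal u + (P : ℝ)⁻¹ • intToReal c)) ≤ K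
        rwa [e]
      rw [Set.indicator_of_mem this, Pi.one_apply]
      refine mul_le_mul' ?_ (hψ ?_)
      · rw [← ENNReal.ofReal_one]
        exact ENNReal.ofReal_le_ofReal (inv_le_one_of_one_le₀ (one_le_blockWeight _ _))
      · rw [hC₂, ← Real.log_pow]
        refine Real.log_le_log (by linarith [one_le_blockWeight N (q u)]) (max_le ?_ ?_)
        · exact one_le_pow₀ (by linarith)
        · exact pow_le_pow_left₀ (apply_nonneg _ _) h s
    · refine le_add_left ?_
      set a := N (intToReal (q u)) with ha
      have hconst : ENNReal.ofReal (blockWeight N (q u))⁻¹ *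
          ψ (Real.log (blockWeight N (q u))) =
          ∫⁻ _, ENNReal.ofReal (blockWeight N (q u))⁻¹ *
          ψ (Real.log (blockWeight N (q u))) ∂(boxMeasure (0 : Fin s → ℝ)) := by
        rw [lintegral_const, measure_univ, mul_one]
      rw [hconst, ← lintegral_const_mul' _ _ ENNReal.ofReal_ne_top, boxMeasure_eq]
      refine setLIntegral_mono' (MeasurableSet.univ_pi fun i => measurableSet_Ioc) fun x hx => ?_
      rw [hqv]
      have hx1 : ‖x‖ ≤ 1 := by
        refine (pi_norm_le_iff_of_nonneg zero_le_one).2 fun i => ?_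
        have := hx i trivial
        simp only [Pi.zero_apply, zero_add, Set.mem_Ioc] at this
        rw [Real.norm_of_nonneg this.1.le]; exact this.2
      have hNx : N ((P : ℝ) • x) ≤ D := by
        rw [map_smul_eq_mul, Real.norm_of_nonneg hP0.le, hD]
        gcongr
        exact (hCN' x).trans (by nlinarith)
      set y := intToReal (q u) + (P : ℝ) • x with hy
      have h1 : N y ≤ a + D := (map_add_le_add N _ _).trans (by linarith)
      have h2 : a ≤ N y + D := by
        have e : intToReal (q u) = y - (P : ℝ) • x := by rw [hy]; abel
        rw [ha, e]
        exact (map_sub_le_add N _ _).trans (by linarith)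
      have hDa : D ≤ τ * a := hDK.trans (mul_le_mul_of_nonneg_left h.le hτ0.le)
      have hy1 : 1 < N y := by
        have : 0 < D / τ := by positivity
        linarith
      exact block_term_le hs hτ0 hτ1 hτ hψ h1 h2 hDa hy1 (by linarith) hu
  refine (ENNReal.tsum_le_tsum hpt).trans ?_
  rw [ENNReal.tsum_add, ENNReal.tsum_mul_right, ENNReal.tsum_mul_left,
    tsum_lintegral_boxMeasure (fun v => G (intToReal c + (P : ℝ) • v)),
    lintegral_comp_add_smul G hGm _ hP0]
  have hG : ∫⁻ y, G y = ENNReal.ofReal b * ∫⁻ x in Set.Ioc 0 L, ψ (x + C₁) := by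
    rw [← lintegral_inv_mul_log (ψ := fun x => ψ (x + C₁)), ← hbV]
    have h1 : ∫⁻ y, G y = ∫⁻ t, g t ∂(Measure.map (fun x => N x ^ s) volume) :=
      (lintegral_map hgm (measurable_seminorm.pow_const s)).symm
    rw [h1, map_seminorm_pow hN hs, lintegral_smul_measure, smul_eq_mul,
      setLIntegral_indicator measurableSet_Ioc]
    congr 3
    exact Set.inter_eq_left.2 fun t ht => lt_trans zero_lt_one ht.1
  have hsmall : ∑' u : Fin s → ℤ, {x | N ((P : ℝ) • x) ≤ K}.indicator (1 : (Fin s → ℝ) → ℝ≥0∞)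
      (intToReal u + (P : ℝ)⁻¹ • intToReal c) ≤ ENNReal.ofReal nK := by
    refine perCount_le (by positivity) (fun x hx i => ?_) _
    have h1 : N ((P : ℝ) • x) ≤ K := hx
    rw [map_smul_eq_mul, Real.norm_of_nonneg hP0.le] at h1
    have h2 := (norm_le_pi_norm x i).trans (hcN' x)
    rw [Real.norm_eq_abs] at h2
    refine h2.trans ?_
    rw [le_div_iff₀ hP0]
    nlinarith
  -- The boundedly many small vectors are paid for by lengthening the integration interval by A, as
  -- ψ is monotone. The bound thus remains a single integral of ψ with the sharp constant in front,
  -- the form that can be iterated over blocks.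
  have htail : ENNReal.ofReal nK * ψ C₂ ≤ ENNReal.ofReal ((1 + κ) * b / P ^ s) *
      ∫⁻ x in Set.Ioc L (L + A), ψ (x + (C₁ + C₂ + A)) := by
    calc ENNReal.ofReal nK * ψ C₂ ≤
        ENNReal.ofReal ((1 + κ) * b / P ^ s) * (ψ C₂ * ENNReal.ofReal A) := by
          rw [mul_comm (ψ C₂), ← mul_assoc, ← ENNReal.ofReal_mul (by positivity)]
          refine mul_le_mul' (ENNReal.ofReal_le_ofReal ?_) le_rfl
          have : (1 + κ) * b / P ^ s * A = (1 + κ) * nK := by rw [hA]; field_simp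
          rw [this]; nlinarith
      _ ≤ _ := by
          gcongr
          calc ψ C₂ * ENNReal.ofReal A = ∫⁻ _ in Set.Ioc L (L + A), ψ C₂ := by
                rw [setLIntegral_const, Real.volume_Ioc]; congr 2; ring
            _ ≤ _ := setLIntegral_mono' measurableSet_Ioc fun x hx => hψ (by
                have := hx.1; linarith)
  have hmain : ENNReal.ofReal (1 + κ) * (ENNReal.ofReal (((P : ℝ) ^ s)⁻¹) * ∫⁻ y, G y) ≤
      ENNReal.ofReal ((1 + κ) * b / P ^ s) * ∫⁻ x in Set.Ioc 0 L, ψ (x + (C₁ + C₂ + A)) := by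
    rw [hG, ← mul_assoc, ← mul_assoc, ← ENNReal.ofReal_mul (by positivity),
      ← ENNReal.ofReal_mul (by positivity)]
    refine mul_le_mul' (le_of_eq (congrArg _ (by ring))) (lintegral_mono fun x => hψ ?_)
    linarith
  calc _ ≤ ENNReal.ofReal nK * ψ C₂ + ENNReal.ofReal (1 + κ) *
          (ENNReal.ofReal (((P : ℝ) ^ s)⁻¹) * ∫⁻ y, G y) := by
        gcongr
    _ ≤ _ := add_le_add htail hmain
    _ = ENNReal.ofReal ((1 + κ) * b / P ^ s) *
        ∫⁻ x in Set.Ioc 0 (L + A), ψ (x + (C₁ + C₂ + A)) := by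
        rw [← mul_add, add_comm (∫⁻ _ in _, _), ← lintegral_union measurableSet_Ioc
          (Set.Ioc_disjoint_Ioc_of_le le_rfl), Set.Ioc_union_Ioc_eq_Ioc hL0 (by linarith)]
    _ ≤ _ := by
        refine mul_le_mul_right (lintegral_mono_set (Set.Ioc_subset_Ioc_right ?_)) _
        rw [hL]; linarith

end BlockSum

/-! ### Iterated integrals and the alternating coefficient -/

section IteratedIntegral

/-- The integral of `ψ (x + t_1 + ⋯ + t_r)` over the box `∏ (0, X_j]`. -/
def iterInt (ψ : ℝ → ℝ≥0∞) : (r : ℕ) → (Fin r → ℝ) → ℝ → ℝ≥0∞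
  | 0, _, x => ψ x
  | r + 1, X, x => ∫⁻ t in Set.Ioc 0 (X 0), iterInt ψ r (fun j => X j.succ) (x + t)

lemma iterInt_mono {ψ : ℝ → ℝ≥0∞} (hψ : Monotone ψ) {r : ℕ} {X Y : Fin r → ℝ} (hXY : X ≤ Y)
    {x y : ℝ} (hxy : x ≤ y) : iterInt ψ r X x ≤ iterInt ψ r Y y := by
  induction r generalizing x y with
  | zero => exact hψ hxy
  | succ r ih =>
    exact (lintegral_mono fun t => ih (fun j => hXY j.succ) (by gcongr)).trans
      (lintegral_mono_set (Set.Ioc_subset_Ioc_right (hXY 0)))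

lemma iterInt_le {ψ : ℝ → ℝ≥0∞} (hψ : Monotone ψ) {r : ℕ} {X : Fin r → ℝ} (x : ℝ) :
    iterInt ψ r X x ≤ (∏ j, ENNReal.ofReal (X j)) * ψ (x + ∑ j, X j) := by
  induction r generalizing x with
  | zero => simp [iterInt]
  | succ r ih =>
    calc iterInt ψ (r + 1) X x
        ≤ ∫⁻ _ in Set.Ioc 0 (X 0), (∏ j : Fin r, ENNReal.ofReal (X j.succ)) *
          ψ (x + ∑ j, X j) := by
          refine setLIntegral_mono' measurableSet_Ioc fun t ht => (ih _).trans ?_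
          gcongr
          refine hψ ?_
          rw [Fin.sum_univ_succ]; linarith [ht.2]
      _ = _ := by
          rw [setLIntegral_const, Real.volume_Ioc, sub_zero, Fin.prod_univ_succ]; ring

/-- The alternating sum computing the iterated integral of `x ^ l / l!`. -/
def altSum (l : ℕ) {r : ℕ} (X : Fin r → ℝ) (y : ℝ) : ℝ :=
  ∑ x : Fin r → Fin 2, (-1 : ℝ) ^ (r + ∑ j, (x j : ℕ)) *
    ((y + ∑ j, X j * ((x j : ℕ) : ℝ)) ^ (l + r) / (l + r)!)

lemma continuous_altSum (l : ℕ) {r : ℕ} (X : Fin r → ℝ) : Continuous (altSum l X) := by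
  unfold altSum; fun_prop

/-- The fundamental theorem of calculus in the first variable: the endpoint X 0 gives the terms with
x 0 = 1, the endpoint 0 those with x 0 = 0 and the opposite sign. -/
lemma altSum_succ (l : ℕ) {r : ℕ} (X : Fin (r + 1) → ℝ) (y : ℝ) :
    altSum l X y = ∫ t in (0)..(X 0), altSum l (fun j => X j.succ) (y + t) := by
  have hder : ∀ t ∈ Set.uIcc 0 (X 0), HasDerivAt (fun t => ∑ x : Fin r → Fin 2,
      (-1 : ℝ) ^ (r + ∑ j, (x j : ℕ)) * ((y + t + ∑ j : Fin r, X j.succ * ((x j : ℕ) : ℝ)) ^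
        (l + r + 1) / (l + r + 1)!)) (altSum l (fun j => X j.succ) (y + t)) t := by
    intro t _
    refine HasDerivAt.fun_sum fun x _ => ?_
    have h1 : HasDerivAt (fun t => y + t + ∑ j : Fin r, X j.succ * ((x j : ℕ) : ℝ)) 1 t :=
      ((hasDerivAt_id t).const_add y).add_const _
    refine (((h1.pow (l + r + 1)).div_const ((l + r + 1)! : ℝ)).const_mul _).congr_deriv ?_
    rw [Nat.factorial_succ]
    push_cast
    field_simp
  rw [intervalIntegral.integral_eq_sub_of_hasDerivAt hder
    (((continuous_altSum l _).comp (continuous_const_add y)).intervalIntegrable _ _)]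
  unfold altSum
  rw [← (Fin.consEquiv fun _ : Fin (r + 1) => Fin 2).sum_comp, Fintype.sum_prod_type]
  simp only [Fin.sum_univ_two, Fin.consEquiv_apply]
  rw [add_comm, sub_eq_add_neg, ← Finset.sum_neg_distrib]
  congr 1
  · refine Finset.sum_congr rfl fun x _ => ?_
    simp only [Fin.sum_univ_succ (n := r), Fin.cons_zero, Fin.cons_succ]
    have e1 : r + 1 + (((1 : Fin 2) : ℕ) + ∑ j, (x j : ℕ)) = r + ∑ j, (x j : ℕ) + 2 := by
      simp; ring
    rw [e1, pow_add]
    simp [add_assoc]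
  · refine Finset.sum_congr rfl fun x _ => ?_
    simp only [Fin.sum_univ_succ (n := r), Fin.cons_zero, Fin.cons_succ]
    have e1 : r + 1 + (((0 : Fin 2) : ℕ) + ∑ j, (x j : ℕ)) = r + ∑ j, (x j : ℕ) + 1 := by
      simp; ring
    rw [e1, pow_succ]
    simp [add_assoc]

lemma altSum_nonneg (l : ℕ) {r : ℕ} {X : Fin r → ℝ} (hX : ∀ j, 0 ≤ X j) {y : ℝ} (hy : 0 ≤ y) :
    0 ≤ altSum l X y := by
  induction r generalizing y with
  | zero => simp only [altSum]; simp; positivity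
  | succ r ih =>
    rw [altSum_succ]
    exact intervalIntegral.integral_nonneg (hX 0) fun t ht =>
      ih (fun j => hX _) (add_nonneg hy ht.1)

/-- The function `x ^ l / l!`, extended by zero to the left. -/
def powFact (l : ℕ) (x : ℝ) : ℝ≥0∞ := ENNReal.ofReal (max 0 x ^ l / l !)

lemma powFact_mono (l : ℕ) : Monotone (powFact l) := fun x y hxy => by
  unfold powFact
  gcongr

lemma iterInt_powFact (l : ℕ) {r : ℕ} {X : Fin r → ℝ} (hX : ∀ j, 0 ≤ X j) {y : ℝ} (hy : 0 ≤ y) :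
    iterInt (powFact l) r X y = ENNReal.ofReal (altSum l X y) := by
  induction r generalizing y with
  | zero => simp [iterInt, powFact, altSum, hy]
  | succ r ih =>
    rw [altSum_succ, intervalIntegral.integral_of_le (hX 0), ofReal_integral_eq_lintegral_ofReal]
    · exact setLIntegral_congr_fun measurableSet_Ioc fun t ht =>
        ih (fun j => hX _) (add_nonneg hy ht.1.le)
    · exact (intervalIntegrable_iff_integrableOn_Ioc_of_le (hX 0)).1
        (((continuous_altSum l _).comp (continuous_const_add y)).intervalIntegrable _ _)
    · refine (ae_restrict_iff' measurableSet_Ioc).2 (ae_of_all _ fun t ht => ?_)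
      exact altSum_nonneg l (fun j => hX _) (add_nonneg hy ht.1.le)

/-- Dividing by T inside the power removes the bounded shifts C and D in the limit, so all additive
errors in the logarithms are harmless for the leading constant. -/
lemma tendsto_altSum (l : ℕ) {r : ℕ} (n : Fin r → ℕ) (C D : ℝ) :
    Tendsto (fun T : ℝ => altSum l (fun j => n j * T + C) D / T ^ (l + r)) atTop
      (nhds ((cCoeff (l + r) n : ℝ) / (l + r)!)) := by
  have hlim : (cCoeff (l + r) n : ℝ) / (l + r)! = ∑ x : Fin r → Fin 2,
      (-1 : ℝ) ^ (r + ∑ j, (x j : ℕ)) *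
        ((∑ j, (n j : ℝ) * ((x j : ℕ) : ℝ)) ^ (l + r) / (l + r)!) := by
    unfold cCoeff
    push_cast
    rw [Finset.sum_div]
    refine Finset.sum_congr rfl fun x _ => ?_
    have h1 : ∑ j, (x j : ℕ) ≤ r := by
      calc ∑ j, (x j : ℕ) ≤ ∑ _j : Fin r, 1 := Finset.sum_le_sum fun j _ => by lia
        _ = r := by simp
    -- The bound `h1` makes the natural-number subtraction genuine, and the two exponents have the
    -- same parity.
    have h2 : r + ∑ j, (x j : ℕ) = (r - ∑ j, (x j : ℕ)) + 2 * ∑ j, (x j : ℕ) := by lia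
    have h3 : (-1 : ℝ) ^ (r + ∑ j, (x j : ℕ)) = (-1) ^ (r - ∑ j, (x j : ℕ)) := by
      rw [h2, pow_add, pow_mul]; simp
    rw [h3, mul_div_assoc]
  rw [hlim]
  have h3 : ∀ T : ℝ, altSum l (fun j => n j * T + C) D / T ^ (l + r) =
      ∑ x : Fin r → Fin 2, (-1 : ℝ) ^ (r + ∑ j, (x j : ℕ)) *
        (((D + ∑ j, (n j * T + C) * ((x j : ℕ) : ℝ)) / T) ^ (l + r) / (l + r)!) := by
    intro T
    unfold altSum
    rw [Finset.sum_div]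
    refine Finset.sum_congr rfl fun x _ => ?_
    rw [div_pow]; ring
  simp_rw [h3]
  refine tendsto_finsetSum _ fun x _ => ((Tendsto.pow ?_ _).div_const _).const_mul _
  have h4 : Tendsto (fun T : ℝ => ∑ j, (n j : ℝ) * ((x j : ℕ) : ℝ) +
      (D + ∑ j, C * ((x j : ℕ) : ℝ)) / T) atTop
      (nhds (∑ j, (n j : ℝ) * ((x j : ℕ) : ℝ) + 0)) :=
    tendsto_const_nhds.add (tendsto_const_nhds.div_atTop tendsto_id)
  rw [add_zero] at h4
  refine h4.congr' ?_
  filter_upwards [eventually_gt_atTop 0] with T hT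
  field_simp
  rw [Finset.sum_mul]
  simp only [add_mul, Finset.sum_add_distrib]
  have : ∑ j, (n j : ℝ) * ((x j : ℕ) : ℝ) * T = ∑ j, T * (n j : ℝ) * ((x j : ℕ) : ℝ) :=
    Finset.sum_congr rfl fun j _ => by ring
  rw [this]; ring

end IteratedIntegral

/-! ### Sums over all blocks by induction on their number -/

section Sums

/-- The weight `∏ max {1, ‖q_j‖ ^ n_j}` of an integer vector. -/
def weight {r : ℕ} {n : Fin r → ℕ} (N' : ∀ j, Seminorm ℝ (Fin (n j) → ℝ)) (q : Idx n → ℤ) : ℝ :=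
  ∏ j, max 1 (N' j (block j (intToReal q)) ^ n j)

lemma one_le_weight {r : ℕ} {n : Fin r → ℕ} (N' : ∀ j, Seminorm ℝ (Fin (n j) → ℝ))
    (q : Idx n → ℤ) : 1 ≤ weight N' q := by
  have : ∏ _j : Fin r, (1 : ℝ) ≤ weight N' q :=
    Finset.prod_le_prod (fun _ _ => zero_le_one) fun _ _ => le_max_left _ _
  simpa using this

lemma weight_pos {r : ℕ} {n : Fin r → ℕ} (N' : ∀ j, Seminorm ℝ (Fin (n j) → ℝ))
    (q : Idx n → ℤ) : 0 < weight N' q := zero_lt_one.trans_le (one_le_weight N' q)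

/-- The logarithm of the weight is additive over blocks. Summing out all blocks but the first leaves
an iterated integral that is monotone in the logarithm of the first weight, hence an admissible ψ
for `exists_tsum_block_le`. -/
lemma exists_tsum_pi_le {P : ℕ} (hP : 1 ≤ P) {κ : ℝ} (hκ : 0 < κ) {r : ℕ} {n : Fin r → ℕ}
    (hn : ∀ j, 1 ≤ n j) {N' : ∀ j, Seminorm ℝ (Fin (n j) → ℝ)}
    (hN' : ∀ j y, N' j y = 0 → y = 0) (c : ∀ j, Fin (n j) → ℤ) :
    ∃ C : ℝ, 0 ≤ C ∧ ∀ T : ℝ, 0 ≤ T → ∀ ψ : ℝ → ℝ≥0∞, Monotone ψ → ∀ y : ℝ,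
      ∑' u : ∀ j, Fin (n j) → ℤ,
        (if ∀ j, N' j (intToReal (c j + (P : ℤ) • u j)) ≤ Real.exp T then
          ENNReal.ofReal (∏ j, blockWeight (N' j) (c j + (P : ℤ) • u j))⁻¹ *
            ψ (y + Real.log (∏ j, blockWeight (N' j) (c j + (P : ℤ) • u j))) else 0) ≤
        ENNReal.ofReal (∏ j, ((1 + κ) * (ballVol (N' j)).toReal / P ^ n j)) *
          iterInt ψ r (fun j => n j * T + C) (y + C) := by
  induction r with
  | zero =>
    refine ⟨0, le_rfl, fun T hT ψ hψ y => ?_⟩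
    rw [tsum_eq_single default (fun u hu => absurd (Subsingleton.elim u default) hu)]
    simp [iterInt]
  | succ r ih =>
    obtain ⟨C, hC, ih⟩ := ih (fun j => hn j.succ) (fun j => hN' j.succ) (fun j => c j.succ)
    obtain ⟨C₀, hC₀, h₀⟩ := exists_tsum_block_le (hN' 0) (hn 0) hP (c 0) hκ
    refine ⟨C + C₀, by positivity, fun T hT ψ hψ y => ?_⟩
    set B : ℝ := ∏ j : Fin r, ((1 + κ) * (ballVol (N' j.succ)).toReal / P ^ n j.succ) with hB
    have hB0 : 0 ≤ B := Finset.prod_nonneg fun j _ => by positivity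
    let w : (Fin (n 0) → ℤ) → ℝ := fun u => blockWeight (N' 0) (c 0 + (P : ℤ) • u)
    let W : (∀ j : Fin r, Fin (n j.succ) → ℤ) → ℝ :=
      fun u => ∏ j, blockWeight (N' j.succ) (c j.succ + (P : ℤ) • u j)
    have hw : ∀ u, 0 < w u := fun u => zero_lt_one.trans_le (one_le_blockWeight _ _)
    have hW : ∀ u, 0 < W u := fun u =>
      Finset.prod_pos fun j _ => zero_lt_one.trans_le (one_le_blockWeight _ _)
    let ψ' : ℝ → ℝ≥0∞ := fun x => iterInt ψ r (fun j => n j.succ * T + C) (y + x + C)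
    have hψ' : Monotone ψ' := fun x x' h => iterInt_mono hψ le_rfl (by linarith)
    let F : (∀ j, Fin (n j) → ℤ) → ℝ≥0∞ := fun u =>
      if ∀ j, N' j (intToReal (c j + (P : ℤ) • u j)) ≤ Real.exp T then
        ENNReal.ofReal (∏ j, blockWeight (N' j) (c j + (P : ℤ) • u j))⁻¹ *
          ψ (y + Real.log (∏ j, blockWeight (N' j) (c j + (P : ℤ) • u j))) else 0
    have hF : ∑' u, F u = ∑' u₀ : Fin (n 0) → ℤ, ∑' u : ∀ j : Fin r, Fin (n j.succ) → ℤ,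
        F (Fin.cons u₀ u) := by
      rw [← (Fin.consEquiv fun j : Fin (r + 1) => (Fin (n j) → ℤ)).tsum_eq]
      exact ENNReal.tsum_prod (f := fun u₀ u => F (Fin.cons u₀ u))
    change ∑' u, F u ≤ _
    rw [hF]
    have hin : ∀ u₀ : Fin (n 0) → ℤ, ∑' u : ∀ j : Fin r, Fin (n j.succ) → ℤ, F (Fin.cons u₀ u) ≤
        ENNReal.ofReal B * (if N' 0 (intToReal (c 0 + (P : ℤ) • u₀)) ≤ Real.exp T then
          ENNReal.ofReal (w u₀)⁻¹ * ψ' (Real.log (w u₀)) else 0) := by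
      intro u₀
      simp only [F, Fin.forall_fin_succ (n := r), Fin.prod_univ_succ (n := r),
        Fin.cons_zero, Fin.cons_succ]
      by_cases h : N' 0 (intToReal (c 0 + (P : ℤ) • u₀)) ≤ Real.exp T
      swap
      · simp only [h, false_and, if_false, tsum_zero, mul_zero, le_refl]
      simp only [h, true_and, if_true]
      have key := ih T hT ψ hψ (y + Real.log (w u₀))
      calc _ = ∑' u : ∀ j : Fin r, Fin (n j.succ) → ℤ, ENNReal.ofReal (w u₀)⁻¹ *
            (if ∀ j : Fin r, N' j.succ (intToReal (c j.succ + (P : ℤ) • u j)) ≤ Real.exp T then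
              ENNReal.ofReal (W u)⁻¹ * ψ (y + Real.log (w u₀) + Real.log (W u)) else 0) := by
            refine tsum_congr fun u => ?_
            rw [mul_ite, mul_zero]
            refine if_congr Iff.rfl ?_ rfl
            change ENNReal.ofReal (w u₀ * W u)⁻¹ * ψ (y + Real.log (w u₀ * W u)) = _
            rw [mul_inv, ENNReal.ofReal_mul (inv_nonneg.2 (hw u₀).le),
              Real.log_mul (hw u₀).ne' (hW u).ne', mul_assoc, add_assoc]
        _ ≤ ENNReal.ofReal (w u₀)⁻¹ * (ENNReal.ofReal B * iterInt ψ r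
              (fun j => n j.succ * T + C) (y + Real.log (w u₀) + C)) := by
            rw [ENNReal.tsum_mul_left]
            gcongr
        _ = _ := by simp only [ψ']; ring
    refine (ENNReal.tsum_le_tsum hin).trans ?_
    rw [ENNReal.tsum_mul_left, Fin.prod_univ_succ, mul_comm ((1 + κ) * _ / _),
      ENNReal.ofReal_mul hB0, mul_assoc]
    refine mul_le_mul' le_rfl ((h₀ T hT ψ' hψ').trans (mul_le_mul' le_rfl ?_))
    simp only [ψ', iterInt]
    refine (lintegral_mono fun t => ?_).trans
      (lintegral_mono_set (Set.Ioc_subset_Ioc_right ?_))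
    · exact iterInt_mono hψ (fun j => by simp only; linarith) (by linarith)
    · linarith

variable {r : ℕ} {n : Fin r → ℕ} {N' : ∀ j, Seminorm ℝ (Fin (n j) → ℝ)}

lemma exists_tsum_blocks_le (hn : ∀ j, 1 ≤ n j) (hN' : ∀ j y, N' j y = 0 → y = 0)
    {P : ℕ} (hP : 1 ≤ P) (c : Idx n → ℤ) {κ : ℝ} (hκ : 0 < κ) :
    ∃ C : ℝ, 0 ≤ C ∧ ∀ T : ℝ, 0 ≤ T → ∀ ψ : ℝ → ℝ≥0∞, Monotone ψ → ∀ y : ℝ,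
      ∑' u : Idx n → ℤ,
        (if ∀ j, N' j (block j (intToReal (c + (P : ℤ) • u))) ≤ Real.exp T then
          ENNReal.ofReal (weight N' (c + (P : ℤ) • u))⁻¹ *
            ψ (y + Real.log (weight N' (c + (P : ℤ) • u))) else 0) ≤
        ENNReal.ofReal (∏ j, ((1 + κ) * (ballVol (N' j)).toReal / P ^ n j)) *
          iterInt ψ r (fun j => n j * T + C) (y + C) := by
  obtain ⟨C, hC, h⟩ := exists_tsum_pi_le hP hκ hn hN' fun j a => c ⟨j, a⟩
  refine ⟨C, hC, fun T hT ψ hψ y => ?_⟩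
  rw [← (Equiv.piCurry fun (j : Fin r) (_ : Fin (n j)) => ℤ).symm.tsum_eq]
  exact h T hT ψ hψ y

end Sums

/-! ### Volumes of the regions -/

section Region

variable {k : ℕ} {m : Fin k → ℕ}

/-- The region cut out by the conditions `‖y_i‖ ≤ η_i` and `(∏ ‖y_i‖ ^ m_i) w ≤ ε`. -/
def region (N : ∀ i, Seminorm ℝ (Fin (m i) → ℝ)) (η : Fin k → ℝ) (ε w : ℝ) : Set (Idx m → ℝ) :=
  {y | (∀ i, N i (block i y) ≤ η i) ∧ (∏ i, N i (block i y) ^ m i) * w ≤ ε}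

variable {N : ∀ i, Seminorm ℝ (Fin (m i) → ℝ)} {η : Fin k → ℝ} {ε : ℝ}

lemma measurable_seminorm_block (i : Fin k) : Measurable fun y : Idx m → ℝ => N i (block i y) :=
  measurable_seminorm.comp (measurable_block i)

lemma measurableSet_region (w : ℝ) : MeasurableSet (region N η ε w) := by
  have : region N η ε w = (⋂ i, {y | N i (block i y) ≤ η i}) ∩
      {y | (∏ i, N i (block i y) ^ m i) * w ≤ ε} := by
    ext; simp [region]
  rw [this]
  refine (MeasurableSet.iInter fun i =>
    measurableSet_le (measurable_seminorm_block i) measurable_const).inter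
    (measurableSet_le ?_ measurable_const)
  exact (Finset.measurable_prod _ fun i _ => (measurable_seminorm_block i).pow_const _).mul_const _

variable (hm : ∀ i, 1 ≤ m i) (hN : ∀ i x, N i x = 0 → x = 0)

include hN in
-- The bounds η_i alone confine the region to a box independent of w; this yields a uniform bound on
-- the number of translates, used for the vector q = 0 and for near pairs.
lemma exists_region_bound : ∃ R : ℝ, 0 ≤ R ∧ ∀ w, ∀ y ∈ region N η ε w, ∀ a, |y a| ≤ R := by
  choose c hc hcN using fun i => exists_norm_le_seminorm (hN i)
  refine ⟨∑ i, c i * |η i|, Finset.sum_nonneg fun i _ => by have := hc i; positivity,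
    fun w y hy a => ?_⟩
  calc |y a| ≤ ‖block a.1 y‖ := norm_le_pi_norm (block a.1 y) a.2
    _ ≤ c a.1 * N a.1 (block a.1 y) := hcN _ _
    _ ≤ c a.1 * |η a.1| := by
        have := hc a.1
        gcongr
        exact (hy.1 a.1).trans (le_abs_self _)
    _ ≤ _ := Finset.single_le_sum (f := fun i => c i * |η i|)
        (fun i _ => by have := hc i; positivity) (Finset.mem_univ a.1)

include hm hN

/-- The map y ↦ (N_i(y_i)^{m_i}) reduces this to the hyperbolic volume with δ = ε/w, and log⁺(w/ε) ≤
log⁺ ε⁻¹ + log w. The bound is monotone in log w, as the block sums require. -/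
lemma exists_volume_region_le (hk : 1 ≤ k) (hη : ∀ i, 0 < η i) (hε : 0 < ε) :
    ∃ C : ℝ, 0 ≤ C ∧ ∀ w : ℝ, 1 ≤ w →
      volume (region N η ε w) ≤ ENNReal.ofReal ((∏ i, (ballVol (N i)).toReal) * ε) *
        (ENNReal.ofReal w⁻¹ * powFact (k - 1) (C + Real.log w)) := by
  obtain ⟨l, rfl⟩ : ∃ l, k = l + 1 := ⟨k - 1, by lia⟩
  obtain ⟨C, hC, h⟩ := exists_volume_hyperbolic_le l (fun i => η i ^ m i)
    fun i => pow_pos (hη i) _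
  refine ⟨C + Real.posLog ε⁻¹, by have := Real.posLog_nonneg (x := ε⁻¹); positivity,
    fun w hw => ?_⟩
  have hw0 : 0 < w := by linarith
  set S : Set (Fin (l + 1) → ℝ) := {t | (∀ i, t i ≤ η i ^ m i) ∧ ∏ i, t i ≤ ε / w} with hS
  have hSm : MeasurableSet S := by
    have : S = (Set.univ.pi fun i => Set.Iic (η i ^ m i)) ∩ {t | ∏ i, t i ≤ ε / w} := by
      ext
      simp only [hS, Set.mem_inter_iff, Set.mem_univ_pi, Set.mem_Iic, Set.mem_ofPred_eq]
    rw [this]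
    exact (MeasurableSet.univ_pi fun i => measurableSet_Iic).inter (measurableSet_le
      (Finset.measurable_prod _ fun i _ => measurable_pi_apply i) measurable_const)
  have hmeas : Measurable fun (y : Idx m → ℝ) i => N i (block i y) ^ m i :=
    measurable_pi_lambda _ fun i => (measurable_seminorm_block i).pow_const _
  have hB : ∏ i, ballVol (N i) = ENNReal.ofReal (∏ i, (ballVol (N i)).toReal) := by
    rw [ENNReal.ofReal_prod_of_nonneg fun i _ => ENNReal.toReal_nonneg]
    exact Finset.prod_congr rfl fun i _ => (ENNReal.ofReal_toReal (ballVol_lt_top (hN i)).ne).symm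
  calc volume (region N η ε w)
      ≤ volume ((fun (y : Idx m → ℝ) i => N i (block i y) ^ m i) ⁻¹' S) := by
        refine measure_mono fun y hy => ⟨fun i => ?_, ?_⟩
        · exact pow_le_pow_left₀ (apply_nonneg _ _) (hy.1 i) _
        · rw [le_div_iff₀ hw0]; exact hy.2
    _ = (∏ i, ballVol (N i)) * volume (S ∩ Set.univ.pi fun _ => Set.Ioi 0) := by
        rw [← Measure.map_apply hmeas hSm, map_blocks_pow hm hN, Measure.smul_apply,
          Measure.restrict_apply hSm, smul_eq_mul]
    _ ≤ (∏ i, ballVol (N i)) * ENNReal.ofReal (ε / w *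
          ((Real.posLog (ε / w)⁻¹ + C) ^ l / l !)) := by
        gcongr
        refine (measure_mono ?_).trans (h (ε / w) (div_pos hε hw0))
        rintro t ⟨ht, ht'⟩
        exact ⟨fun i => ⟨ht' i trivial, ht.1 i⟩, ht.2⟩
    _ ≤ _ := by
        rw [hB, ENNReal.ofReal_mul (Finset.prod_nonneg fun i _ => ENNReal.toReal_nonneg), mul_assoc]
        gcongr
        rw [powFact, ← ENNReal.ofReal_mul (by positivity), ← ENNReal.ofReal_mul hε.le]
        refine ENNReal.ofReal_le_ofReal ?_
        rw [div_eq_mul_inv ε w, mul_assoc, Nat.add_sub_cancel]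
        have h1 : Real.posLog (ε * w⁻¹)⁻¹ ≤ Real.posLog ε⁻¹ + Real.log w := by
          rw [mul_inv, inv_inv]
          refine Real.posLog_mul.trans ?_
          rw [Real.posLog_eq_log (x := w) (by rwa [abs_of_pos hw0])]
        have h2 := Real.posLog_nonneg (x := (ε * w⁻¹)⁻¹)
        gcongr
        refine le_max_of_le_right ?_
        linarith

/-- The part of a region where one of the norms is small. -/
lemma exists_volume_small_le :
    ∃ C : ℝ, 0 ≤ C ∧ ∀ i, ∀ δ : ℝ, 0 < δ → δ ≤ 1 → ∀ w,
      volume {y ∈ region N η ε w | N i (block i y) ≤ δ} ≤ ENNReal.ofReal (C * δ) := by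
  set b : Fin k → ℝ := fun i => (ballVol (N i)).toReal
  set E : Fin k → ℝ := fun i => max 1 (|η i| ^ m i)
  refine ⟨∏ i, b i * E i, Finset.prod_nonneg fun i _ => by positivity, fun i δ hδ hδ1 w => ?_⟩
  classical
  calc volume {y ∈ region N η ε w | N i (block i y) ≤ δ}
      ≤ volume ((fun (x : Idx m → ℝ) i => block i x) ⁻¹' (Set.univ.pi fun j =>
          {x | N j x ^ m j ≤ if j = i then δ else |η j| ^ m j})) := by
        refine measure_mono fun y hy j _ => ?_
        change N j (block j y) ^ m j ≤ _
        split_ifs with hj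
        · subst hj
          exact (pow_le_pow_left₀ (apply_nonneg _ _) hy.2 _).trans
            (pow_le_of_le_one hδ.le hδ1 (by have := hm j; lia))
        · exact pow_le_pow_left₀ (apply_nonneg _ _) ((hy.1.1 j).trans (le_abs_self _)) _
    _ = ∏ j, ENNReal.ofReal (b j * if j = i then δ else |η j| ^ m j) := by
        rw [measurePreserving_curry.measure_preimage, volume_pi_pi]
        · refine Finset.prod_congr rfl fun j _ => ?_
          rw [volume_seminorm_pow_le (hN j) (hm j), ENNReal.ofReal_mul ENNReal.toReal_nonneg,
            ENNReal.ofReal_toReal (ballVol_lt_top (hN j)).ne]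
        · exact (MeasurableSet.univ_pi fun i => measurableSet_le
            (measurable_seminorm.pow_const _) measurable_const).nullMeasurableSet
    _ = ENNReal.ofReal (∏ j, b j * if j = i then δ else |η j| ^ m j) := by
        rw [ENNReal.ofReal_prod_of_nonneg]
        intro j _
        split_ifs <;> positivity
    _ ≤ _ := by
        refine ENNReal.ofReal_le_ofReal ?_
        have hδ' : δ = ∏ j : Fin k, if j = i then δ else 1 := by simp
        conv_rhs => rw [hδ']
        rw [← Finset.prod_mul_distrib]
        refine Finset.prod_le_prod (fun j _ => by split_ifs <;> positivity) fun j _ => ?_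
        split_ifs
        · have : 1 ≤ E j := le_max_left _ _
          have hb : 0 ≤ b j := ENNReal.toReal_nonneg
          calc b j * δ = b j * 1 * δ := by ring
            _ ≤ b j * E j * δ := by gcongr
        · rw [mul_one]
          gcongr
          exact le_max_right _ _

end Region

/-! ### Growth of the weight and sums of inverse weights -/

section Weight

variable {r : ℕ} {n : Fin r → ℕ} {N' : ∀ j, Seminorm ℝ (Fin (n j) → ℝ)}

lemma log_weight_le {q : Idx n → ℤ} {T : ℝ} (hT : 0 ≤ T)
    (hq : ∀ j, N' j (block j (intToReal q)) ≤ Real.exp T) :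
    Real.log (weight N' q) ≤ (∑ j, (n j : ℝ)) * T := by
  rw [Real.log_le_iff_le_exp (weight_pos N' q), Finset.sum_mul, Real.exp_sum]
  refine Finset.prod_le_prod (fun j _ => by positivity) fun j _ => max_le ?_ ?_
  · exact Real.one_le_exp (by positivity)
  · rw [Real.exp_nat_mul]
    exact pow_le_pow_left₀ (apply_nonneg _ _) (hq j) _

lemma block_intToReal_smul (e : ℤ) (q : Idx n → ℤ) (j : Fin r) :
    block j (intToReal (e • q)) = (e : ℝ) • block j (intToReal q) := by
  ext a; simp [block, intToReal]

variable (hN' : ∀ j y, N' j y = 0 → y = 0)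
include hN'

lemma exists_le_seminorm_int :
    ∃ c : ℝ, 0 < c ∧ c ≤ 1 ∧ ∀ j, ∀ v : Fin (n j) → ℤ, v ≠ 0 → c ≤ N' j (intToReal v) := by
  choose c hc hcN using fun j => exists_norm_le_seminorm (hN' j)
  have hS : ∀ j, c j ≤ 1 + ∑ j, c j := fun j => by
    have := Finset.single_le_sum (f := c) (fun i _ => by linarith [hc i]) (Finset.mem_univ j)
    linarith
  have hS0 : 0 ≤ ∑ j, c j := Finset.sum_nonneg fun i _ => by linarith [hc i]
  refine ⟨(1 + ∑ j, c j)⁻¹, by positivity, inv_le_one_of_one_le₀ (by linarith),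
    fun j v hv => ?_⟩
  obtain ⟨a, ha⟩ : ∃ a, v a ≠ 0 := by
    by_contra! h
    exact hv (funext h)
  have h1 : (1 : ℝ) ≤ ‖intToReal v‖ := by
    refine le_trans ?_ (norm_le_pi_norm (intToReal v) a)
    simp only [intToReal, Real.norm_eq_abs]
    exact_mod_cast Int.one_le_abs ha
  have h2 := hcN j (intToReal v)
  rw [inv_le_iff_one_le_mul₀ (by positivity)]
  calc 1 ≤ c j * N' j (intToReal v) := h1.trans h2
    _ ≤ (1 + ∑ j, c j) * N' j (intToReal v) := by gcongr; exact hS j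
    _ = _ := mul_comm _ _

/-- Under q ↦ eq no block factor decreases, and the factor of a nonzero block j grows by |e|^{n j}.
The constant covers a block j of norm below 1, where the maximum with 1 hides part of the growth;
integrality bounds that norm below. -/
lemma exists_weight_smul_ge :
    ∃ c : ℝ, 0 < c ∧ c ≤ 1 ∧ ∀ (e : ℤ) (q : Idx n → ℤ) (j : Fin r), e ≠ 0 →
      (∃ a, q ⟨j, a⟩ ≠ 0) → c * |(e : ℝ)| ^ n j * weight N' q ≤ weight N' (e • q) := by
  obtain ⟨c₀, hc₀, hc₁, h⟩ := exists_le_seminorm_int hN'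
  refine ⟨∏ j, c₀ ^ n j, Finset.prod_pos fun j _ => by positivity,
    Finset.prod_le_one (fun j _ => by positivity) fun j _ => pow_le_one₀ hc₀.le hc₁,
    fun e q j he hq => ?_⟩
  have he1 : 1 ≤ |(e : ℝ)| := by exact_mod_cast Int.one_le_abs he
  have hle : ∏ j, c₀ ^ n j ≤ c₀ ^ n j := by
    rw [← Finset.mul_prod_erase _ _ (Finset.mem_univ j)]
    exact mul_le_of_le_one_right (by positivity)
      (Finset.prod_le_one (fun j _ => by positivity) fun j _ => pow_le_one₀ hc₀.le hc₁)
  classical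
  calc (∏ j, c₀ ^ n j) * |(e : ℝ)| ^ n j * weight N' q
      ≤ c₀ ^ n j * |(e : ℝ)| ^ n j * weight N' q := by
        have := (weight_pos N' q).le
        gcongr
    _ = ∏ l, (if l = j then c₀ ^ n j * |(e : ℝ)| ^ n j else 1) *
          max 1 (N' l (block l (intToReal q)) ^ n l) := by
        rw [Finset.prod_mul_distrib]; simp [weight]
    _ ≤ weight N' (e • q) := by
        refine Finset.prod_le_prod (fun l _ => by split_ifs <;> positivity) fun l _ => ?_
        rw [block_intToReal_smul, map_smul_eq_mul, Real.norm_eq_abs, mul_pow]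
        have hx : 0 ≤ N' l (block l (intToReal q)) := apply_nonneg _ _
        have he2 : 1 ≤ |(e : ℝ)| ^ n l := one_le_pow₀ he1
        split_ifs with hl
        · subst hl
          obtain ⟨a, ha⟩ := hq
          have h3 : c₀ ≤ N' l (block l (intToReal q)) :=
            h l (fun a => q ⟨l, a⟩) fun h0 => ha (congrFun h0 a)
          have h4 : c₀ ^ n l ≤ N' l (block l (intToReal q)) ^ n l := by gcongr
          have h5 : c₀ ^ n l ≤ 1 := pow_le_one₀ hc₀.le hc₁
          refine le_trans ?_ (le_max_right _ _)
          rw [mul_comm (c₀ ^ n l), mul_assoc]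
          refine mul_le_mul_of_nonneg_left ?_ (by positivity)
          rw [mul_max_of_nonneg _ _ (by positivity), mul_one]
          exact max_le h4 (mul_le_of_le_one_left (by positivity) h5)
        · rw [one_mul]
          exact max_le_max le_rfl (le_mul_of_one_le_left (by positivity) he2)

omit hN' in
lemma sum_nat_nonneg (n : Fin r → ℕ) : 0 ≤ ∑ j, (n j : ℝ) :=
  Finset.sum_nonneg fun _ _ => Nat.cast_nonneg _

lemma exists_tsum_inv_weight_le (hn : ∀ j, 1 ≤ n j) :
    ∃ C : ℝ, 0 ≤ C ∧ ∀ T : ℝ, 1 ≤ T →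
      ∑' q : Idx n → ℤ, (if ∀ j, N' j (block j (intToReal q)) ≤ Real.exp T then
        ENNReal.ofReal (weight N' q)⁻¹ else 0) ≤ ENNReal.ofReal (C * T ^ r) := by
  obtain ⟨C, hC, h⟩ := exists_tsum_blocks_le hn hN' le_rfl 0 one_pos
  set B : ℝ := ∏ j, ((1 + 1) * (ballVol (N' j)).toReal / ((1 : ℕ) : ℝ) ^ n j) with hB
  have hB0 : 0 ≤ B := Finset.prod_nonneg fun j _ => by positivity
  set A : ℝ := ∑ j, (n j : ℝ) + C with hA
  have hA0 : 0 ≤ A := add_nonneg (sum_nat_nonneg n) hC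
  refine ⟨B * A ^ r, by positivity, fun T hT => ?_⟩
  have h1 := h T (by linarith) (fun _ => 1) monotone_const 0
  simp only [Nat.cast_one, one_smul, zero_add, mul_one] at h1
  refine (h1.trans (mul_le_mul' le_rfl (iterInt_le monotone_const _))).trans ?_
  rw [mul_one]
  have hj : ∀ j, n j * T + C ≤ A * T := fun j => by
    have h2 : (n j : ℝ) ≤ ∑ j, (n j : ℝ) :=
      Finset.single_le_sum (f := fun j => (n j : ℝ)) (fun _ _ => Nat.cast_nonneg _)
        (Finset.mem_univ j)
    rw [hA]; nlinarith
  calc _ ≤ ENNReal.ofReal B * ∏ _j : Fin r, ENNReal.ofReal (A * T) := by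
        simp only [Nat.cast_one] at hB
        rw [hB]
        gcongr with j
        exact hj j
    _ = _ := by
        rw [Finset.prod_const, Finset.card_univ, Fintype.card_fin,
          ← ENNReal.ofReal_pow (by positivity), ← ENNReal.ofReal_mul hB0]
        congr 1; ring_nf

end Weight

/-! ### First moment of the counting function -/

section RegionWeight

variable {k r : ℕ} {m : Fin k → ℕ} {n : Fin r → ℕ} {N : ∀ i, Seminorm ℝ (Fin (m i) → ℝ)}
  {N' : ∀ j, Seminorm ℝ (Fin (n j) → ℝ)} {η : Fin k → ℝ} {ε : ℝ}
  (hk : 1 ≤ k) (hm : ∀ i, 1 ≤ m i) (hN : ∀ i x, N i x = 0 → x = 0)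
  (hη : ∀ i, 0 < η i) (hε : 0 < ε)
include hk hm hN hη hε

lemma exists_volume_region_weight_le :
    ∃ C : ℝ, 0 ≤ C ∧ ∀ T : ℝ, 1 ≤ T → ∀ q : Idx n → ℤ,
      (∀ j, N' j (block j (intToReal q)) ≤ Real.exp T) →
      volume (region N η ε (weight N' q)) ≤ ENNReal.ofReal (C * T ^ (k - 1) * (weight N' q)⁻¹) := by
  obtain ⟨C, hC, h⟩ := exists_volume_region_le hm hN hk hη hε
  set B : ℝ := (∏ i, (ballVol (N i)).toReal) * ε
  have hB0 : 0 ≤ B := mul_nonneg (Finset.prod_nonneg fun i _ => ENNReal.toReal_nonneg) hε.le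
  set A : ℝ := C + ∑ j, (n j : ℝ)
  have hA0 : 0 ≤ A := add_nonneg hC (sum_nat_nonneg n)
  refine ⟨B * A ^ (k - 1), by positivity, fun T hT q hq => (h _ (one_le_weight N' q)).trans ?_⟩
  have hw := weight_pos N' q
  rw [powFact, ← ENNReal.ofReal_mul (by positivity), ← ENNReal.ofReal_mul hB0]
  refine ENNReal.ofReal_le_ofReal ?_
  have h1 := log_weight_le (by linarith) hq
  have h2 : max 0 (C + Real.log (weight N' q)) ≤ A * T := by
    refine max_le (by positivity) ?_
    have : C ≤ C * T := le_mul_of_one_le_right hC hT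
    simp only [A]; rw [add_mul]; linarith
  have h3 : (1 : ℝ) ≤ (k - 1)! := by exact_mod_cast Nat.factorial_pos _
  calc B * ((weight N' q)⁻¹ * (max 0 (C + Real.log (weight N' q)) ^ (k - 1) / (k - 1)!))
      ≤ B * ((weight N' q)⁻¹ * ((A * T) ^ (k - 1) / 1)) := by gcongr
    _ = _ := by rw [mul_pow]; ring

/-- The first moment of the counting function. -/
lemma exists_tsum_volume_region_le (hn : ∀ j, 1 ≤ n j) (hN' : ∀ j y, N' j y = 0 → y = 0)
    {P : ℕ} (hP : 1 ≤ P) (c : Idx n → ℤ) {κ : ℝ} (hκ : 0 < κ) :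
    ∃ C : ℝ, 0 ≤ C ∧ ∀ T : ℝ, 0 ≤ T →
      ∑' u : Idx n → ℤ,
        (if ∀ j, N' j (block j (intToReal (c + (P : ℤ) • u))) ≤ Real.exp T then
          volume (region N η ε (weight N' (c + (P : ℤ) • u))) else 0) ≤
        ENNReal.ofReal ((∏ i, (ballVol (N i)).toReal) * ε *
          (∏ j, ((1 + κ) * (ballVol (N' j)).toReal / P ^ n j)) *
          altSum (k - 1) (fun j => n j * T + C) C) := by
  obtain ⟨C₁, hC₁, h₁⟩ := exists_volume_region_le hm hN hk hη hε
  obtain ⟨C₂, hC₂, h₂⟩ := exists_tsum_blocks_le hn hN' hP c hκ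
  have hB0 : 0 ≤ (∏ i, (ballVol (N i)).toReal) * ε :=
    mul_nonneg (Finset.prod_nonneg fun i _ => ENNReal.toReal_nonneg) hε.le
  have hB1 : 0 ≤ ∏ j, ((1 + κ) * (ballVol (N' j)).toReal / P ^ n j) :=
    Finset.prod_nonneg fun j _ => by positivity
  refine ⟨C₁ + C₂, by positivity, fun T hT => ?_⟩
  have hX : ∀ j, 0 ≤ n j * T + (C₁ + C₂) := fun j => by positivity
  calc _ ≤ ∑' u : Idx n → ℤ, ENNReal.ofReal ((∏ i, (ballVol (N i)).toReal) * ε) *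
        (if ∀ j, N' j (block j (intToReal (c + (P : ℤ) • u))) ≤ Real.exp T then
          ENNReal.ofReal (weight N' (c + (P : ℤ) • u))⁻¹ *
            powFact (k - 1) (C₁ + Real.log (weight N' (c + (P : ℤ) • u))) else 0) := by
        refine ENNReal.tsum_le_tsum fun u => ?_
        split_ifs
        · exact h₁ _ (one_le_weight _ _)
        · exact zero_le
    _ ≤ ENNReal.ofReal ((∏ i, (ballVol (N i)).toReal) * ε) *
          (ENNReal.ofReal (∏ j, ((1 + κ) * (ballVol (N' j)).toReal / P ^ n j)) *
          iterInt (powFact (k - 1)) r (fun j => n j * T + C₂) (C₁ + C₂)) := by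
        rw [ENNReal.tsum_mul_left]
        gcongr
        exact h₂ T hT _ (powFact_mono _) _
    _ ≤ ENNReal.ofReal ((∏ i, (ballVol (N i)).toReal) * ε) *
          (ENNReal.ofReal (∏ j, ((1 + κ) * (ballVol (N' j)).toReal / P ^ n j)) *
          iterInt (powFact (k - 1)) r (fun j => n j * T + (C₁ + C₂)) (C₁ + C₂)) := by
        gcongr
        exact iterInt_mono (powFact_mono _) (fun j => by simp only; linarith) le_rfl
    _ = _ := by
        rw [iterInt_powFact _ hX (by positivity), ← ENNReal.ofReal_mul hB1,
          ← ENNReal.ofReal_mul hB0]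
        simp only [mul_assoc]

end RegionWeight

/-! ### Translates with a divisible block -/

section Divisors

variable {ι κ : Type} [Fintype ι] [Fintype κ]

lemma measurable_rowMul (c : ι → κ → ℤ) : Measurable (rowMul c) := by
  unfold rowMul
  fun_prop

lemma measurable_perCount_rowMul {X : Set (ι → ℝ)} (hX : MeasurableSet X) (y : ι → ℝ)
    (c : ι → κ → ℤ) : Measurable fun x => perCount X (y + rowMul c x) :=
  (measurable_perCount hX).comp (measurable_const.add (measurable_rowMul c))

omit [Fintype ι] in
lemma indicator_preimage_one (g : (ι → ℝ) → ι → ℝ) (X : Set (ι → ℝ)) (y : ι → ℝ) :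
    (g ⁻¹' X).indicator (1 : (ι → ℝ) → ℝ≥0∞) y = X.indicator 1 (g y) := rfl

lemma volume_mul_preimage_le (s : ι → ℝ) (hs : ∏ b, s b ≠ 0) (X : Set (ι → ℝ))
    (hX : MeasurableSet X) :
    ENNReal.ofReal |∏ b, s b| * volume ((fun (x : ι → ℝ) b => s b * x b) ⁻¹' X) = volume X := by
  classical
  have hm : Measurable fun (x : ι → ℝ) b => s b * x b := by fun_prop
  have h := Real.smul_map_diagonal_volume_pi (D := s) (by rwa [Matrix.det_diagonal])
  rw [Matrix.det_diagonal] at h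
  have h2 : ⇑(Matrix.toLin' (Matrix.diagonal s)) = fun (x : ι → ℝ) b => s b * x b := by
    ext x b; simp [Matrix.mulVec_diagonal]
  rw [h2] at h
  conv_rhs => rw [← h]
  rw [Measure.smul_apply, Measure.map_apply hm hX, smul_eq_mul]

end Divisors

section DivCount

variable {k : ℕ} {m : Fin k → ℕ} {κ : Type} [Fintype κ]

open Classical in
/-- The number of translates `z + y` in `X` for which `e` divides the `i`-th block of `c + P z`. -/
def divCount (X : Set (Idx m → ℝ)) (P : ℕ) (c : Idx m → ℤ) (e : ℕ) (i : Fin k)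
    (y : Idx m → ℝ) : ℝ≥0∞ :=
  ∑' z : Idx m → ℤ, if ∀ t, (e : ℤ) ∣ c ⟨i, t⟩ + P * z ⟨i, t⟩ then
    X.indicator 1 (intToReal z + y) else 0

/-- On block i write c + Pz = ev; then z + a + e(qx) = (e/P)(v + P(qx)). Thus the divisible
translates inject into all translates for a rescaled set, while the linear form keeps integer
coefficients. -/
lemma divCount_le (X : Set (Idx m → ℝ)) {P e : ℕ} (hP : 1 ≤ P) (he : 1 ≤ e) {a : Idx m → ℝ}
    {c : Idx m → ℤ} (ha : (P : ℝ) • a = intToReal c) (i : Fin k) (q : κ → ℤ)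
    (x : Idx m → κ → ℝ) :
    divCount X P c e i (a + rowMul (fun _ => (e : ℤ) • q) x) ≤
      perCount ((fun y b => (if b.1 = i then (e : ℝ) / P else 1) * y b) ⁻¹' X)
        ((fun b => if b.1 = i then 0 else a b) +
          rowMul (fun b => (if b.1 = i then (P : ℤ) else e) • q) x) := by
  classical
  set S : Set (Idx m → ℤ) := {z | ∀ t, (e : ℤ) ∣ c ⟨i, t⟩ + P * z ⟨i, t⟩}
  let f : S → Idx m → ℤ := fun z b => if b.1 = i then (c b + P * z.1 b) / e else z.1 b
  have hP0 : (P : ℝ) ≠ 0 := by positivity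
  have he0 : (e : ℝ) ≠ 0 := by positivity
  have hdvd : ∀ z : S, ∀ b : Idx m, b.1 = i → (e : ℤ) ∣ c b + P * z.1 b := by
    rintro z ⟨l, t⟩ rfl
    exact z.2 t
  have hf : Function.Injective f := by
    intro z z' h
    ext b
    have hb := congrFun h b
    by_cases hi : b.1 = i
    · simp only [f, hi, if_true] at hb
      have h1 := Int.ediv_left_inj (hdvd z b hi) (hdvd z' b hi) |>.1 hb
      have h2 : (P : ℤ) ≠ 0 := by positivity
      exact mul_left_cancel₀ h2 (add_left_cancel h1)
    · simpa [f, hi] using hb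
  unfold divCount perCount
  calc _ = ∑' z : Idx m → ℤ, S.indicator (fun z : Idx m → ℤ => X.indicator
        (1 : (Idx m → ℝ) → ℝ≥0∞) (intToReal z + (a + rowMul (fun _ => (e : ℤ) • q) x))) z := by
        refine tsum_congr fun z => ?_
        simp [Set.indicator_apply, S]
    _ = ∑' z : S, X.indicator (1 : (Idx m → ℝ) → ℝ≥0∞)
          (intToReal z.1 + (a + rowMul (fun _ => (e : ℤ) • q) x)) := (tsum_subtype _ _).symm
    _ = ∑' z : S, ((fun y b => (if b.1 = i then (e : ℝ) / P else 1) * y b) ⁻¹' X).indicator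
          (1 : (Idx m → ℝ) → ℝ≥0∞) (intToReal (f z) + ((fun b => if b.1 = i then 0 else a b) +
          rowMul (fun b => (if b.1 = i then (P : ℤ) else e) • q) x)) := by
        refine tsum_congr fun z => ?_
        rw [indicator_preimage_one]
        refine congrArg (X.indicator 1) (funext fun b => ?_)
        have hab : (P : ℝ) * a b = c b := congrFun ha b
        by_cases hi : b.1 = i
        · obtain ⟨v, hv⟩ := hdvd z b hi
          have hv' : (c b : ℝ) + P * z.1 b = e * v := by exact_mod_cast hv
          have hfz : f z b = v := by
            simp only [f, hi, if_true, hv]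
            exact Int.mul_ediv_cancel_left _ (by positivity)
          simp only [Pi.add_apply, intToReal, hfz, hi, if_true, rowMul, Pi.smul_apply,
            smul_eq_mul, Int.cast_mul, Int.cast_natCast, zero_add, mul_assoc, ← Finset.mul_sum]
          field_simp
          linarith
        · simp [intToReal, f, hi, rowMul]
    _ ≤ _ := ENNReal.tsum_comp_le_tsum_of_injective hf _

/-- The rescaling of `divCount_le` changes the volume by (P/e)^{m i}, and m i ≥ 1 gives the saving
1/e over the total mean. -/
lemma lintegral_divCount_le {X : Set (Idx m → ℝ)} (hX : MeasurableSet X) (hm : ∀ i, 1 ≤ m i)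
    {P e : ℕ} (hP : 1 ≤ P) (he : 1 ≤ e) {a : Idx m → ℝ}
    {c : Idx m → ℤ} (ha : (P : ℝ) • a = intToReal c) (i : Fin k) {q : κ → ℤ} (hq : q ≠ 0)
    (b : Idx m → κ → ℝ) :
    ∫⁻ x, divCount X P c e i (a + rowMul (fun _ => (e : ℤ) • q) x) ∂boxMeasure₂ b ≤
      ENNReal.ofReal (P ^ (∑ i, m i) / e) * volume X := by
  have hP0 : (0 : ℝ) < P := by positivity
  have he0 : (0 : ℝ) < e := by positivity
  have hs : Measurable fun (y : Idx m → ℝ) (b : Idx m) =>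
      (if b.1 = i then (e : ℝ) / P else 1) * y b := by fun_prop
  obtain ⟨t, ht⟩ : ∃ t, q t ≠ 0 := by
    by_contra! h
    exact hq (funext h)
  refine (lintegral_mono fun x => divCount_le X hP he ha i q x).trans ?_
  rw [lintegral_perCount (hs hX) b _ (fun l => ⟨t, by
    simp only [Pi.smul_apply, smul_eq_mul]
    refine mul_ne_zero ?_ ht
    split_ifs <;> positivity⟩)]
  have hprod : ∏ b : Idx m, (if b.1 = i then (e : ℝ) / P else 1) = ((e : ℝ) / P) ^ m i := by
    rw [← Finset.univ_sigma_univ, Finset.prod_sigma]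
    rw [Finset.prod_eq_single i] <;> simp +contextual [div_pow]
  have h := volume_mul_preimage_le (fun b : Idx m => if b.1 = i then (e : ℝ) / P else 1)
    (by rw [hprod]; positivity) X hX
  rw [hprod, abs_of_pos (by positivity)] at h
  rw [← h, ← mul_assoc, ← ENNReal.ofReal_mul (by positivity)]
  refine le_mul_of_one_le_left' ?_
  rw [ENNReal.one_le_ofReal, div_pow, div_mul_div_comm, one_le_div (by positivity)]
  have h1 : m i ≤ ∑ i, m i := Finset.single_le_sum (fun _ _ => Nat.zero_le _) (Finset.mem_univ i)
  have h2 : (e : ℝ) ≤ (e : ℝ) ^ m i :=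
    le_self_pow₀ (by exact_mod_cast he) (by have := hm i; lia)
  have h3 : (P : ℝ) ^ m i ≤ (P : ℝ) ^ ∑ i, m i := pow_le_pow_right₀ (by exact_mod_cast hP) h1
  calc (e : ℝ) * P ^ m i ≤ e ^ m i * P ^ ∑ i, m i := by gcongr
    _ = _ := by ring

end DivCount

/-! ### Truncation into good and bad translates -/

section Truncation

variable {k r : ℕ} {m : Fin k → ℕ} {n : Fin r → ℕ}

/-- The points of a region at which no norm is very small. -/
def goodRegion (N : ∀ i, Seminorm ℝ (Fin (m i) → ℝ)) (η : Fin k → ℝ) (ε L w : ℝ) :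
    Set (Idx m → ℝ) :=
  {y | y ∈ region N η ε w ∧ ∀ i, 1 ≤ N i (block i y) * (L * w)}

/-- No integer larger than `L` divides `q` together with a block of `c + P z`. -/
def IsGood (P : ℕ) (c : Idx m → ℤ) (L : ℝ) (q : Idx n → ℤ) (z : Idx m → ℤ) : Prop :=
  ∀ i, ∀ e : ℕ, L < e → (∀ t, (e : ℤ) ∣ q t) → ¬ ∀ t, (e : ℤ) ∣ c ⟨i, t⟩ + P * z ⟨i, t⟩

open Classical in
/-- The number of good translates in the good part of a region. -/
def goodCount (N : ∀ i, Seminorm ℝ (Fin (m i) → ℝ)) (N' : ∀ j, Seminorm ℝ (Fin (n j) → ℝ))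
    (η : Fin k → ℝ) (ε : ℝ) (P : ℕ) (c : Idx m → ℤ) (L : ℝ) (q : Idx n → ℤ)
    (y : Idx m → ℝ) : ℝ≥0∞ :=
  ∑' z : Idx m → ℤ, if IsGood P c L q z then
    (goodRegion N η ε L (weight N' q)).indicator 1 (intToReal z + y) else 0

variable {N : ∀ i, Seminorm ℝ (Fin (m i) → ℝ)} {N' : ∀ j, Seminorm ℝ (Fin (n j) → ℝ)}
  {η : Fin k → ℝ} {ε : ℝ}

lemma measurableSet_goodRegion (L w : ℝ) : MeasurableSet (goodRegion N η ε L w) := by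
  have : goodRegion N η ε L w =
      region N η ε w ∩ ⋂ i, {y | 1 ≤ N i (block i y) * (L * w)} := by
    ext; simp [goodRegion]
  rw [this]
  exact (measurableSet_region w).inter (MeasurableSet.iInter fun i =>
    measurableSet_le measurable_const ((measurable_seminorm_block i).mul_const _))

lemma measurable_goodCount (P : ℕ) (c : Idx m → ℤ) (L : ℝ) (q : Idx n → ℤ) :
    Measurable (goodCount N N' η ε P c L q) := by
  refine Measurable.tsum fun z => ?_
  split_ifs
  · exact (measurable_one.indicator (measurableSet_goodRegion _ _)).comp
      (measurable_const.add measurable_id)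
  · exact measurable_const

lemma goodCount_le_perCount (P : ℕ) (c : Idx m → ℤ) (L : ℝ) (q : Idx n → ℤ) (y : Idx m → ℝ) :
    goodCount N N' η ε P c L q y ≤ perCount (region N η ε (weight N' q)) y := by
  refine ENNReal.tsum_le_tsum fun z => ?_
  split_ifs
  · exact Set.indicator_le_indicator_of_subset (fun y hy => hy.1) (fun _ => zero_le) _
  · exact zero_le

open Classical in
/-- The number of translates lost in the truncation. -/
def badCount (N : ∀ i, Seminorm ℝ (Fin (m i) → ℝ)) (N' : ∀ j, Seminorm ℝ (Fin (n j) → ℝ))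
    (η : Fin k → ℝ) (ε : ℝ) (P : ℕ) (c : Idx m → ℤ) (L : ℝ) (q : Idx n → ℤ)
    (y : Idx m → ℝ) : ℝ≥0∞ :=
  (∑ i, perCount {y | y ∈ region N η ε (weight N' q) ∧
      N i (block i y) ≤ (L * weight N' q)⁻¹} y) +
    ∑ i, ∑' e : ℕ, if L < e ∧ ∀ t, (e : ℤ) ∣ q t then
      divCount (region N η ε (weight N' q)) P c e i y else 0

lemma perCount_region_le_add {L : ℝ} (hL : 0 < L) (P : ℕ) (c : Idx m → ℤ) (q : Idx n → ℤ)
    (y : Idx m → ℝ) :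
    perCount (region N η ε (weight N' q)) y ≤
      goodCount N N' η ε P c L q y + badCount N N' η ε P c L q y := by
  classical
  have hw := weight_pos N' q
  have key : ∀ z : Idx m → ℤ, (region N η ε (weight N' q)).indicator
        (1 : (Idx m → ℝ) → ℝ≥0∞) (intToReal z + y) ≤
      (if IsGood P c L q z then
        (goodRegion N η ε L (weight N' q)).indicator 1 (intToReal z + y) else 0) +
      ((∑ i, {y | y ∈ region N η ε (weight N' q) ∧
        N i (block i y) ≤ (L * weight N' q)⁻¹}.indicator 1 (intToReal z + y)) +
      ∑ i, ∑' e : ℕ, if L < e ∧ ∀ t, (e : ℤ) ∣ q t then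
        (if ∀ t, (e : ℤ) ∣ c ⟨i, t⟩ + P * z ⟨i, t⟩ then
          (region N η ε (weight N' q)).indicator 1 (intToReal z + y) else 0) else 0) := by
    intro z
    by_cases hz : intToReal z + y ∈ region N η ε (weight N' q)
    swap
    · rw [Set.indicator_of_notMem hz]; exact zero_le
    rw [Set.indicator_of_mem hz]
    by_cases hg : IsGood P c L q z
    · by_cases hr : ∀ i, 1 ≤ N i (block i (intToReal z + y)) * (L * weight N' q)
      · have hzr : intToReal z + y ∈ goodRegion N η ε L (weight N' q) := ⟨hz, hr⟩
        rw [if_pos hg, Set.indicator_of_mem hzr]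
        exact le_self_add
      · push Not at hr
        obtain ⟨i, hi⟩ := hr
        refine le_add_left (le_add_right ?_)
        refine le_trans ?_ (Finset.single_le_sum (fun _ _ => zero_le) (Finset.mem_univ i))
        rw [Set.indicator_of_mem]
        refine ⟨hz, ?_⟩
        rw [← one_div, le_div_iff₀ (by positivity)]
        exact hi.le
    · unfold IsGood at hg
      push Not at hg
      obtain ⟨i, e, he, hq, hc⟩ := hg
      refine le_add_left (le_add_left ?_)
      refine le_trans ?_ (Finset.single_le_sum (fun _ _ => zero_le) (Finset.mem_univ i))
      refine le_trans ?_ (ENNReal.le_tsum e)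
      rw [if_pos ⟨he, hq⟩, if_pos hc]
  unfold perCount goodCount badCount
  refine (ENNReal.tsum_le_tsum key).trans_eq ?_
  rw [ENNReal.tsum_add, ENNReal.tsum_add]
  congr 2
  · rw [Summable.tsum_finsetSum fun _ _ => ENNReal.summable]
    rfl
  · rw [Summable.tsum_finsetSum fun _ _ => ENNReal.summable]
    refine Finset.sum_congr rfl fun i _ => ?_
    rw [ENNReal.tsum_comm]
    refine tsum_congr fun e => ?_
    split_ifs
    · rfl
    · simp

end Truncation

/-! ### Expected loss of the truncation -/

section BadCount

/-- `∑_{e > L} e⁻²` is small. -/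
lemma exists_tsum_inv_sq_le :
    ∃ C : ℝ, 0 ≤ C ∧ ∀ L : ℝ, 1 ≤ L → ∑' e : ℕ, (if L < e then
      ENNReal.ofReal ((e : ℝ) ^ 2)⁻¹ else 0) ≤ ENNReal.ofReal (C * L ^ (-(1 / 2) : ℝ)) := by
  have hs : Summable fun e : ℕ => ((e : ℝ) ^ (3 / 2 : ℝ))⁻¹ :=
    Real.summable_nat_rpow_inv.2 (by norm_num)
  refine ⟨∑' e : ℕ, ((e : ℝ) ^ (3 / 2 : ℝ))⁻¹, tsum_nonneg fun e => by positivity, fun L hL => ?_⟩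
  rw [ENNReal.ofReal_mul (tsum_nonneg fun e => by positivity),
    ENNReal.ofReal_tsum_of_nonneg (fun e => by positivity) hs, ← ENNReal.tsum_mul_right]
  refine ENNReal.tsum_le_tsum fun e => ?_
  split_ifs with he
  · have he0 : (0 : ℝ) < e := by linarith
    rw [← ENNReal.ofReal_mul (by positivity)]
    refine ENNReal.ofReal_le_ofReal ?_
    calc ((e : ℝ) ^ 2)⁻¹ = ((e : ℝ) ^ (3 / 2 : ℝ))⁻¹ * (e : ℝ) ^ (-(1 / 2) : ℝ) := by
          rw [← Real.rpow_natCast, ← Real.rpow_neg he0.le, ← Real.rpow_neg he0.le,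
            ← Real.rpow_add he0]
          norm_num
      _ ≤ _ := by
          refine mul_le_mul_of_nonneg_left ?_ (by positivity)
          exact Real.rpow_le_rpow_of_nonpos (by linarith) he.le (by norm_num)
  · exact zero_le

variable {k r : ℕ} {m : Fin k → ℕ} {n : Fin r → ℕ} {N : ∀ i, Seminorm ℝ (Fin (m i) → ℝ)}
  {N' : ∀ j, Seminorm ℝ (Fin (n j) → ℝ)} {η : Fin k → ℝ} {ε : ℝ}

/-- A finite set of nonzero integer vectors of norm at most `e ^ T`. -/
def IsBoundedBy (N' : ∀ j, Seminorm ℝ (Fin (n j) → ℝ)) (T : ℝ) (Q : Finset (Idx n → ℤ)) : Prop :=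
  ∀ q ∈ Q, q ≠ 0 ∧ ∀ j, N' j (block j (intToReal q)) ≤ Real.exp T

lemma exists_sum_inv_weight_le (hn : ∀ j, 1 ≤ n j) (hN' : ∀ j y, N' j y = 0 → y = 0) :
    ∃ C : ℝ, 0 ≤ C ∧ ∀ T : ℝ, 1 ≤ T → ∀ Q, IsBoundedBy N' T Q →
      ∑ q ∈ Q, ENNReal.ofReal (weight N' q)⁻¹ ≤ ENNReal.ofReal (C * T ^ r) := by
  obtain ⟨C, hC, h⟩ := exists_tsum_inv_weight_le hN' hn
  refine ⟨C, hC, fun T hT Q hQ => le_trans ?_ (h T hT)⟩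
  refine le_trans (Finset.sum_le_sum fun q hq => ?_) (ENNReal.sum_le_tsum Q)
  rw [if_pos (hQ q hq).2]

lemma exists_ne_zero_of_ne_zero {ι : Type} {q : ι → ℤ} (hq : q ≠ 0) : ∃ t, q t ≠ 0 := by
  by_contra! h
  exact hq (funext h)

variable (hk : 1 ≤ k) (hr : 1 ≤ r) (hm : ∀ i, 1 ≤ m i) (hn : ∀ j, 1 ≤ n j)
  (hN : ∀ i x, N i x = 0 → x = 0) (hN' : ∀ j y, N' j y = 0 → y = 0)
  (hη : ∀ i, 0 < η i) (hε : 0 < ε)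

include hm hn hN hN' in
-- The threshold (L w(q))⁻¹ is chosen so that the lost volume is O(1/(L w(q))); summing inverse
-- weights over q costs only T^r.
lemma exists_lintegral_small_le :
    ∃ C : ℝ, 0 ≤ C ∧ ∀ T : ℝ, 1 ≤ T → ∀ L : ℝ, 1 ≤ L → ∀ Q, IsBoundedBy N' T Q →
      ∀ (a : Idx m → ℝ) (b : Idx m → Idx n → ℝ),
      ∑ q ∈ Q, ∑ i, ∫⁻ x, perCount {y | y ∈ region N η ε (weight N' q) ∧
        N i (block i y) ≤ (L * weight N' q)⁻¹} (a + rowMul (fun _ => q) x) ∂boxMeasure₂ b ≤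
        ENNReal.ofReal (C * T ^ r * L⁻¹) := by
  obtain ⟨C₁, hC₁, h₁⟩ := exists_volume_small_le (η := η) (ε := ε) hm hN
  obtain ⟨C₂, hC₂, h₂⟩ := exists_sum_inv_weight_le hn hN'
  refine ⟨k * C₁ * C₂, by positivity, fun T hT L hL Q hQ a b => ?_⟩
  calc _ ≤ ∑ q ∈ Q, ENNReal.ofReal (k * C₁ * L⁻¹) * ENNReal.ofReal (weight N' q)⁻¹ := by
        refine Finset.sum_le_sum fun q hq => ?_
        have hw := one_le_weight N' q
        obtain ⟨t, ht⟩ := exists_ne_zero_of_ne_zero (hQ q hq).1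
        calc _ ≤ ∑ i : Fin k, ENNReal.ofReal (C₁ * (L * weight N' q)⁻¹) := by
              refine Finset.sum_le_sum fun i _ => ?_
              rw [lintegral_perCount _ b _ fun _ => ⟨t, ht⟩]
              · refine h₁ i _ (by positivity) ?_ _
                exact inv_le_one_of_one_le₀ (by nlinarith)
              · exact (measurableSet_region _).inter
                  (measurableSet_le (measurable_seminorm_block i) measurable_const)
          _ = _ := by
              rw [Finset.sum_const, Finset.card_univ, Fintype.card_fin, nsmul_eq_mul,
                ← ENNReal.ofReal_natCast, ← ENNReal.ofReal_mul (by positivity),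
                ← ENNReal.ofReal_mul (by positivity), mul_inv]
              congr 1; ring
    _ ≤ ENNReal.ofReal (k * C₁ * L⁻¹) * ENNReal.ofReal (C₂ * T ^ r) := by
        rw [← Finset.mul_sum]
        gcongr
        exact h₂ T hT Q hQ
    _ = _ := by
        rw [← ENNReal.ofReal_mul (by positivity)]
        congr 1; ring

lemma measurable_divCount {X : Set (Idx m → ℝ)} (hX : MeasurableSet X) (P : ℕ) (c : Idx m → ℤ)
    (e : ℕ) (i : Fin k) : Measurable (divCount X P c e i) := by
  refine Measurable.tsum fun z => ?_
  split_ifs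
  · exact (measurable_one.indicator hX).comp (measurable_const.add measurable_id)
  · exact measurable_const

include hk hm hn hN hN' hη hε

open Classical in
-- Two independent savings of 1/e: one from the divisibility of a block of c + Pz, one from w(q) ≥
-- c₀ e w(q/e). Together they make the sum over e > L convergent and small.
lemma exists_sum_lintegral_divCount_le {P : ℕ} (hP : 1 ≤ P) :
    ∃ C : ℝ, 0 ≤ C ∧ ∀ T : ℝ, 1 ≤ T → ∀ Q, IsBoundedBy N' T Q →
      ∀ (a : Idx m → ℝ) (c : Idx m → ℤ), (P : ℝ) • a = intToReal c →
      ∀ (b : Idx m → Idx n → ℝ) (i : Fin k) (e : ℕ), 1 ≤ e →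
      ∑ q ∈ Q, (if ∀ t, (e : ℤ) ∣ q t then ∫⁻ x, divCount (region N η ε (weight N' q)) P c e i
        (a + rowMul (fun _ => q) x) ∂boxMeasure₂ b else 0) ≤
        ENNReal.ofReal (C * T ^ (k - 1) * T ^ r) * ENNReal.ofReal ((e : ℝ) ^ 2)⁻¹ := by
  obtain ⟨C₁, hC₁, h₁⟩ := exists_volume_region_weight_le (N' := N') hk hm hN hη hε
  obtain ⟨C₂, hC₂, h₂⟩ := exists_sum_inv_weight_le hn hN'
  obtain ⟨c₀, hc₀, hc₁, h₀⟩ := exists_weight_smul_ge hN'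
  set M : ℝ := (P : ℝ) ^ ∑ i, m i
  refine ⟨M * C₁ * c₀⁻¹ * C₂, by positivity, fun T hT Q hQ a c ha b i e he => ?_⟩
  have he1 : (1 : ℝ) ≤ e := by exact_mod_cast he
  have he0 : (e : ℤ) ≠ 0 := by positivity
  set A : ℝ := M * C₁ * c₀⁻¹ * T ^ (k - 1) * ((e : ℝ) ^ 2)⁻¹ with hA
  have hA0 : 0 ≤ A := by positivity
  let D : Finset (Idx n → ℤ) := Q.filter fun q => ∀ t, (e : ℤ) ∣ q t
  let f : (Idx n → ℤ) → Idx n → ℤ := fun q t => q t / e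
  have hf : ∀ q ∈ D, q = (e : ℤ) • f q := fun q hq => by
    ext t
    exact (Int.mul_ediv_cancel' ((Finset.mem_filter.1 hq).2 t)).symm
  have hinj : Set.InjOn f D := fun q hq q' hq' h => by
    rw [hf q hq, hf q' hq', h]
  have hf0 : ∀ q ∈ D, f q ≠ 0 := fun q hq h => by
    refine (hQ q (Finset.mem_filter.1 hq).1).1 ?_
    rw [hf q hq, h, smul_zero]
  have hD : IsBoundedBy N' T (D.image f) := by
    intro q' hq'
    obtain ⟨q, hq, rfl⟩ := Finset.mem_image.1 hq'
    refine ⟨hf0 q hq, fun j => le_trans ?_ ((hQ q (Finset.mem_filter.1 hq).1).2 j)⟩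
    conv_rhs => rw [hf q hq, block_intToReal_smul, map_smul_eq_mul]
    refine le_mul_of_one_le_left (apply_nonneg _ _) ?_
    simpa using he1
  calc _ = ∑ q ∈ D, ∫⁻ x, divCount (region N η ε (weight N' q)) P c e i
        (a + rowMul (fun _ => q) x) ∂boxMeasure₂ b := (Finset.sum_filter _ _).symm
    _ ≤ ∑ q ∈ D, ENNReal.ofReal A * ENNReal.ofReal (weight N' (f q))⁻¹ := by
        refine Finset.sum_le_sum fun q hq => ?_
        have hqQ := hQ q (Finset.mem_filter.1 hq).1
        have hw := weight_pos N' (f q)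
        have hw' := weight_pos N' q
        obtain ⟨⟨j, t⟩, ht⟩ := exists_ne_zero_of_ne_zero (hf0 q hq)
        have h3 : c₀ * e * weight N' (f q) ≤ weight N' q := by
          have h4 := h₀ e (f q) j he0 ⟨t, ht⟩
          rw [← hf q hq] at h4
          refine le_trans ?_ h4
          have : (e : ℝ) ≤ |((e : ℤ) : ℝ)| ^ n j := by
            simpa using le_self_pow₀ he1 (by have := hn j; lia)
          gcongr
        have h5 := lintegral_divCount_le (measurableSet_region (N := N) (η := η) (ε := ε)
          (weight N' q)) hm hP he ha i (hf0 q hq) b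
        rw [← hf q hq] at h5
        refine (h5.trans (mul_le_mul' le_rfl (h₁ T hT q hqQ.2))).trans ?_
        rw [← ENNReal.ofReal_mul (by positivity), ← ENNReal.ofReal_mul hA0]
        refine ENNReal.ofReal_le_ofReal ?_
        have h6 : (weight N' q)⁻¹ ≤ (c₀ * e * weight N' (f q))⁻¹ :=
          inv_anti₀ (by positivity) h3
        calc M / e * (C₁ * T ^ (k - 1) * (weight N' q)⁻¹)
            ≤ M / e * (C₁ * T ^ (k - 1) * (c₀ * e * weight N' (f q))⁻¹) := by gcongr
          _ = _ := by rw [hA]; field_simp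
    _ = ENNReal.ofReal A * ∑ q ∈ D.image f, ENNReal.ofReal (weight N' q)⁻¹ := by
        rw [Finset.sum_image hinj, Finset.mul_sum]
    _ ≤ ENNReal.ofReal A * ENNReal.ofReal (C₂ * T ^ r) := by
        gcongr
        exact h₂ T hT _ hD
    _ = _ := by
        rw [← ENNReal.ofReal_mul hA0, ← ENNReal.ofReal_mul (by positivity), hA]
        congr 1; ring

include hr in
/-- The expected loss in the truncation. -/
lemma exists_lintegral_badCount_le {P : ℕ} (hP : 1 ≤ P) :
    ∃ C : ℝ, 0 ≤ C ∧ ∀ T : ℝ, 1 ≤ T → ∀ L : ℝ, 1 ≤ L → ∀ Q, IsBoundedBy N' T Q →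
      ∀ (a : Idx m → ℝ) (c : Idx m → ℤ), (P : ℝ) • a = intToReal c →
      ∀ (b : Idx m → Idx n → ℝ),
      ∫⁻ x, ∑ q ∈ Q, badCount N N' η ε P c L q (a + rowMul (fun _ => q) x) ∂boxMeasure₂ b ≤
        ENNReal.ofReal (C * T ^ (k + r - 1) * L ^ (-(1 / 2) : ℝ)) := by
  classical
  obtain ⟨C₁, hC₁, h₁⟩ := exists_lintegral_small_le (η := η) (ε := ε) hm hn hN hN'
  obtain ⟨C₂, hC₂, h₂⟩ := exists_sum_lintegral_divCount_le hk hm hn hN hN' hη hε hP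
  obtain ⟨C₃, hC₃, h₃⟩ := exists_tsum_inv_sq_le
  refine ⟨C₁ + k * C₂ * C₃, by positivity, fun T hT L hL Q hQ a c ha b => ?_⟩
  have hmeas : ∀ q : Idx n → ℤ, Measurable fun x : Idx m → Idx n → ℝ =>
      a + rowMul (fun _ => q) x := fun q => measurable_const.add (measurable_rowMul _)
  have hsm : ∀ q i, Measurable fun x : Idx m → Idx n → ℝ =>
      perCount {y | y ∈ region N η ε (weight N' q) ∧
        N i (block i y) ≤ (L * weight N' q)⁻¹} (a + rowMul (fun _ => q) x) := fun q i =>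
    measurable_perCount_rowMul ((measurableSet_region _).inter
      (measurableSet_le (measurable_seminorm_block i) measurable_const)) _ _
  have hdm : ∀ q i e, Measurable fun x : Idx m → Idx n → ℝ =>
      if L < (e : ℕ) ∧ ∀ t, (e : ℤ) ∣ q t then
      divCount (region N η ε (weight N' q)) P c e i (a + rowMul (fun _ => q) x) else 0 := by
    intro q i e
    split_ifs
    · exact (measurable_divCount (measurableSet_region _) P c e i).comp (hmeas q)
    · exact measurable_const
  have hL2 : L⁻¹ ≤ L ^ (-(1 / 2) : ℝ) := by
    rw [← Real.rpow_neg_one]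
    exact Real.rpow_le_rpow_of_exponent_le hL (by norm_num)
  have hTr : T ^ r ≤ T ^ (k + r - 1) := pow_le_pow_right₀ hT (by lia)
  have hTk : T ^ (k - 1) * T ^ r = T ^ (k + r - 1) := by rw [← pow_add]; congr 1; lia
  calc _ = ∑ q ∈ Q, ((∑ i, ∫⁻ x, perCount {y | y ∈ region N η ε (weight N' q) ∧
          N i (block i y) ≤ (L * weight N' q)⁻¹} (a + rowMul (fun _ => q) x) ∂boxMeasure₂ b) +
        ∑ i, ∑' e : ℕ, ∫⁻ x, (if L < e ∧ ∀ t, (e : ℤ) ∣ q t then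
          divCount (region N η ε (weight N' q)) P c e i (a + rowMul (fun _ => q) x) else 0)
          ∂boxMeasure₂ b) := by
        unfold badCount
        have hM : ∀ q ∈ Q, Measurable fun x : Idx m → Idx n → ℝ =>
            (∑ i, perCount {y | y ∈ region N η ε (weight N' q) ∧
              N i (block i y) ≤ (L * weight N' q)⁻¹} (a + rowMul (fun _ => q) x)) +
            ∑ i, ∑' e : ℕ, if L < e ∧ ∀ t, (e : ℤ) ∣ q t then
              divCount (region N η ε (weight N' q)) P c e i (a + rowMul (fun _ => q) x) else 0 :=
          fun q _ => (Finset.measurable_sum _ fun i _ => hsm q i).add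
            (Finset.measurable_sum _ fun i _ => Measurable.tsum fun e => hdm q i e)
        rw [lintegral_finsetSum _ hM]
        refine Finset.sum_congr rfl fun q _ => ?_
        rw [lintegral_add_left (Finset.measurable_sum _ fun i _ => hsm q i),
          lintegral_finsetSum _ fun i _ => hsm q i,
          lintegral_finsetSum _ fun i _ => Measurable.tsum fun e => hdm q i e]
        congr 1
        exact Finset.sum_congr rfl fun i _ => lintegral_tsum fun e => (hdm q i e).aemeasurable
    _ = (∑ q ∈ Q, ∑ i, ∫⁻ x, perCount {y | y ∈ region N η ε (weight N' q) ∧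
          N i (block i y) ≤ (L * weight N' q)⁻¹} (a + rowMul (fun _ => q) x) ∂boxMeasure₂ b) +
        ∑ i, ∑' e : ℕ, (if L < e then ∑ q ∈ Q, (if ∀ t, (e : ℤ) ∣ q t then
          ∫⁻ x, divCount (region N η ε (weight N' q)) P c e i (a + rowMul (fun _ => q) x)
          ∂boxMeasure₂ b else 0) else 0) := by
        rw [Finset.sum_add_distrib, Finset.sum_comm (s := Q) (f := fun q i => ∑' e : ℕ, _)]
        congr 1
        refine Finset.sum_congr rfl fun i _ => ?_
        rw [← Summable.tsum_finsetSum fun _ _ => ENNReal.summable]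
        refine tsum_congr fun e => ?_
        by_cases he : L < e <;> simp only [he, true_and, false_and, if_true, if_false,
          lintegral_zero, Finset.sum_const_zero]
        refine Finset.sum_congr rfl fun q _ => ?_
        split_ifs <;> simp
    _ ≤ ENNReal.ofReal (C₁ * T ^ r * L⁻¹) + ∑ i : Fin k,
          ENNReal.ofReal (C₂ * T ^ (k - 1) * T ^ r) * ENNReal.ofReal (C₃ * L ^ (-(1 / 2) : ℝ)) := by
        gcongr with i
        · exact h₁ T hT L hL Q hQ a b
        · refine le_trans ?_ (mul_le_mul' le_rfl (h₃ L hL))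
          rw [← ENNReal.tsum_mul_left]
          refine ENNReal.tsum_le_tsum fun e => ?_
          split_ifs with he
          · have : (1 : ℝ) ≤ e := by linarith
            exact h₂ T hT Q hQ a c ha b i e (by exact_mod_cast this)
          · exact zero_le
    _ ≤ _ := by
        rw [Finset.sum_const, Finset.card_univ, Fintype.card_fin, nsmul_eq_mul,
          ← ENNReal.ofReal_natCast, ← ENNReal.ofReal_mul (by positivity),
          ← ENNReal.ofReal_mul (by positivity),
          ← ENNReal.ofReal_add (by positivity) (by positivity)]
        refine ENNReal.ofReal_le_ofReal ?_
        rw [mul_assoc C₂, hTk]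
        calc _ ≤ C₁ * T ^ (k + r - 1) * L ^ (-(1 / 2) : ℝ) +
              k * (C₂ * T ^ (k + r - 1) * (C₃ * L ^ (-(1 / 2) : ℝ))) := by gcongr
          _ = _ := by ring

end BadCount

/-! ### Correlations of truncated counts for a pair of vectors -/

section Correlation

variable {k r : ℕ} {m : Fin k → ℕ} {n : Fin r → ℕ} {N : ∀ i, Seminorm ℝ (Fin (m i) → ℝ)}
  {N' : ∀ j, Seminorm ℝ (Fin (n j) → ℝ)} {η : Fin k → ℝ} {ε : ℝ}

lemma volume_preimage_inv_smul {ι : Type} [Fintype ι] {l : ℝ} (hl : 1 ≤ l) (X : Set (ι → ℝ)) :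
    volume ((fun y : ι → ℝ => l⁻¹ • y) ⁻¹' X) =
      ENNReal.ofReal (l ^ Fintype.card ι) * volume X := by
  have hl0 : 0 < l := by linarith
  rw [Measure.addHaar_preimage_smul _ (by positivity), Module.finrank_fintype_fun_eq_card,
    inv_pow, inv_inv, abs_of_pos (by positivity)]

/-- The part of a region where the norms of the blocks in `J` are not small. -/
def partRegion (N : ∀ i, Seminorm ℝ (Fin (m i) → ℝ)) (η : Fin k → ℝ) (ε w K : ℝ)
    (J : Fin k → Prop) (β : ℤ) : Set (Idx m → ℝ) :=
  {y | y ∈ region N η ε w ∧ ∀ i, J i → K ≤ |(β : ℝ)| * N i (block i y)}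

/-- In a block of J the perturbation ω/β has norm at most C/|β|, which is at most C/K times the norm
of that block. So the perturbed point stays in the region dilated by 1 + C/K, as the region is
stable under shrinking block norms. -/
lemma perCount_partRegion_le {K C : ℝ} (hK : 0 < K) (hC : 0 ≤ C) {w : ℝ} (hw : 0 ≤ w)
    (J : Fin k → Prop) [DecidablePred J] {β : ℤ} (hβ : β ≠ 0) {ω : Idx m → ℝ}
    (hω : ∀ i, N i (block i ω) ≤ C) (y : Idx m → ℝ) :
    perCount (partRegion N η ε w K J β) y ≤
      perCount ((fun y : Idx m → ℝ => (1 + C / K)⁻¹ • y) ⁻¹' region N η ε w)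
        (y + fun b => if J b.1 then ω b / (β : ℝ) else 0) := by
  have hl : 0 < 1 + C / K := by positivity
  have hβ0 : 0 < |(β : ℝ)| := by positivity
  refine ENNReal.tsum_le_tsum fun z => Set.indicator_apply_le' (fun hx => ?_) fun _ => zero_le
  refine Set.le_indicator_apply (fun _ => le_rfl) fun h => (h ?_).elim
  set x : Idx m → ℝ := intToReal z + y with hxdef
  set x' : Idx m → ℝ := intToReal z + (y + fun b => if J b.1 then ω b / (β : ℝ) else 0) with hx'
  have key : ∀ i, N i (block i x') ≤ (1 + C / K) * N i (block i x) := by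
    intro i
    have hNx : 0 ≤ N i (block i x) := apply_nonneg _ _
    by_cases hi : J i
    · have h1 : block i x' = block i x + (β : ℝ)⁻¹ • block i ω := by
        ext t
        simp only [hx', hxdef, block, Pi.add_apply, hi, if_true, Pi.smul_apply, smul_eq_mul]
        ring
      have h2 := hx.2 i hi
      calc N i (block i x') ≤ N i (block i x) + |(β : ℝ)|⁻¹ * N i (block i ω) := by
            rw [h1]
            refine (map_add_le_add _ _ _).trans_eq ?_
            rw [map_smul_eq_mul, norm_inv, Real.norm_eq_abs]
        _ ≤ N i (block i x) + |(β : ℝ)|⁻¹ * C := by gcongr; exact hω i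
        _ ≤ N i (block i x) + |(β : ℝ)|⁻¹ * (C * (|(β : ℝ)| * N i (block i x) / K)) := by
            gcongr
            refine le_mul_of_one_le_right hC ?_
            rwa [one_le_div hK]
        _ = _ := by field_simp
    · have h1 : block i x' = block i x := by
        ext t
        simp [hx', hxdef, block, hi]
      rw [h1]
      refine le_mul_of_one_le_left hNx ?_
      have : 0 ≤ C / K := by positivity
      linarith
  have key' : ∀ i, N i (block i ((1 + C / K)⁻¹ • x')) ≤ N i (block i x) := by
    intro i
    have h1 : block i ((1 + C / K)⁻¹ • x') = (1 + C / K)⁻¹ • block i x' := rfl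
    rw [h1, map_smul_eq_mul, Real.norm_eq_abs, abs_of_pos (by positivity), inv_mul_le_iff₀ hl]
    exact key i
  refine ⟨fun i => (key' i).trans (hx.1.1 i), le_trans ?_ hx.1.2⟩
  refine mul_le_mul_of_nonneg_right ?_ hw
  exact Finset.prod_le_prod (fun i _ => pow_nonneg (apply_nonneg _ _) _) fun i _ =>
    pow_le_pow_left₀ (apply_nonneg _ _) (key' i) _

lemma exists_seminorm_block_le (N : ∀ i, Seminorm ℝ (Fin (m i) → ℝ)) :
    ∃ C : ℝ, 0 ≤ C ∧ ∀ ω : Idx m → ℝ, (∀ b, |ω b| ≤ 1) → ∀ i, N i (block i ω) ≤ C := by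
  choose C hC h using fun i => exists_seminorm_le_norm (N i)
  refine ⟨∑ i, C i, Finset.sum_nonneg fun i _ => by linarith [hC i], fun ω hω i => ?_⟩
  calc N i (block i ω) ≤ C i * ‖block i ω‖ := h i _
    _ ≤ C i * 1 := by
        have := hC i
        gcongr
        exact (pi_norm_le_iff_of_nonneg zero_le_one).2 fun t => hω _
    _ ≤ _ := by
        rw [mul_one]
        exact Finset.single_le_sum (f := C) (fun i _ => by linarith [hC i]) (Finset.mem_univ i)

lemma measurableSet_partRegion (w K : ℝ) (J : Fin k → Prop) (β : ℤ) :
    MeasurableSet (partRegion N η ε w K J β) := by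
  have : partRegion N η ε w K J β =
      region N η ε w ∩ ⋂ i, ⋂ _ : J i, {y | K ≤ |(β : ℝ)| * N i (block i y)} := by
    ext; simp [partRegion]
  rw [this]
  exact (measurableSet_region w).inter (MeasurableSet.iInter fun i => MeasurableSet.iInter fun _ =>
    measurableSet_le measurable_const ((measurable_seminorm_block i).const_mul _))

lemma rowMul_smul {ι κ : Type} [Fintype κ] (α : ℤ) (w : κ → ℤ) (x : ι → κ → ℝ) :
    rowMul (fun _ => α • w) x = (α : ℝ) • rowMul (fun _ => w) x := by
  ext i
  simp [rowMul, Finset.mul_sum, mul_assoc]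

/-- Averaging the pointwise comparison over ω makes the two counts exactly independent. Dilating
both regions by 1 + C/K multiplies the product of volumes by its power 2∑ m_i. The first argument is
perturbed on J and the second off J, so each block need only be large on one side. -/
lemma exists_lintegral_partRegion_mul_le (N : ∀ i, Seminorm ℝ (Fin (m i) → ℝ)) :
    ∃ C : ℝ, 0 ≤ C ∧ ∀ K : ℝ, 0 < K → ∀ (w₁ w₂ : ℝ), 0 ≤ w₁ → 0 ≤ w₂ → ∀ (J : Fin k → Prop)
      (α β : ℤ), α ≠ 0 → β ≠ 0 → IsCoprime α β → ∀ w : Idx n → ℤ, w ≠ 0 →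
      ∀ (a : Idx m → ℝ) (b : Idx m → Idx n → ℝ),
      ∫⁻ x, perCount (partRegion N η ε w₁ K J β) (a + rowMul (fun _ => α • w) x) *
        perCount (partRegion N η ε w₂ K (fun i => ¬ J i) α) (a + rowMul (fun _ => β • w) x)
        ∂boxMeasure₂ b ≤
      ENNReal.ofReal ((1 + C / K) ^ (2 * ∑ i, m i)) *
        (volume (region N η ε w₁) * volume (region N η ε w₂)) := by
  classical
  obtain ⟨C, hC, h⟩ := exists_seminorm_block_le N
  refine ⟨C, hC, fun K hK w₁ w₂ hw₁ hw₂ J α β hα hβ hαβ w hw a b => ?_⟩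
  set l : ℝ := 1 + C / K with hl
  have hl1 : 1 ≤ l := le_add_of_nonneg_right (by positivity)
  have hsm : Measurable fun y : Idx m → ℝ => l⁻¹ • y := measurable_const_smul _
  have hX := hsm (measurableSet_region (N := N) (η := η) (ε := ε) w₁)
  have hY := hsm (measurableSet_region (N := N) (η := η) (ε := ε) w₂)
  have hcard : Fintype.card (Idx m) = ∑ i, m i := by simp [Idx]
  calc _ ≤ ∫⁻ x, ∫⁻ ω, perCount ((fun y : Idx m → ℝ => l⁻¹ • y) ⁻¹' region N η ε w₁)
          (a + (α : ℝ) • rowMul (fun _ => w) x +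
            fun i => if J i.1 then ω i / (β : ℝ) else (0 : ℝ)) *
        perCount ((fun y : Idx m → ℝ => l⁻¹ • y) ⁻¹' region N η ε w₂)
          (a + (β : ℝ) • rowMul (fun _ => w) x +
            fun i => if J i.1 then (0 : ℝ) else ω i / (α : ℝ)) ∂boxMeasure 0 ∂boxMeasure₂ b := by
        refine lintegral_mono fun x => ?_
        rw [rowMul_smul, rowMul_smul]
        set A := perCount (partRegion N η ε w₁ K J β) (a + (α : ℝ) • rowMul (fun _ => w) x) *
          perCount (partRegion N η ε w₂ K (fun i => ¬ J i) α)
            (a + (β : ℝ) • rowMul (fun _ => w) x)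
        have h1 : A = ∫⁻ _ω, A ∂boxMeasure (0 : Idx m → ℝ) := by
          rw [lintegral_const, measure_univ, mul_one]
        rw [h1, boxMeasure_eq]
        refine setLIntegral_mono' (MeasurableSet.univ_pi fun _ => measurableSet_Ioc)
          fun ω hω => ?_
        have hω1 : ∀ b, |ω b| ≤ 1 := fun b => by
          have h2 := hω b trivial
          simp only [Pi.zero_apply, Set.mem_Ioc, zero_add] at h2
          rw [abs_of_pos h2.1]; exact h2.2
        refine mul_le_mul' (perCount_partRegion_le hK hC hw₁ J hβ (h ω hω1) _) ?_
        refine (perCount_partRegion_le hK hC hw₂ (fun i => ¬ J i) hα (h ω hω1) _).trans_eq ?_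
        simp only [ite_not]
        rfl
    _ = _ := by
        rw [lintegral_perCount_mul_perCount_perturbed hX hY b hα hβ hαβ hw (fun i => J i.1),
          volume_preimage_inv_smul hl1, volume_preimage_inv_smul hl1, hcard,
          mul_mul_mul_comm, ← ENNReal.ofReal_mul (by positivity), ← pow_add, two_mul]

/-- On the good region every block norm is at least 1/(L w(q)), so |β| ≥ K L w(q) forces the lower
bound K in all blocks at once. -/
lemma goodCount_le_perCount_partRegion {P : ℕ} {c : Idx m → ℤ} {L K : ℝ}
    {q : Idx n → ℤ} {β : ℤ} (hβ : K * L * weight N' q ≤ |(β : ℝ)|) (J : Fin k → Prop)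
    (y : Idx m → ℝ) :
    goodCount N N' η ε P c L q y ≤ perCount (partRegion N η ε (weight N' q) K J β) y := by
  refine ENNReal.tsum_le_tsum fun z => ?_
  split_ifs
  · refine Set.indicator_le_indicator_of_subset (t := partRegion N η ε (weight N' q) K J β) ?_
      (fun _ => zero_le) _
    refine fun x hx => ⟨hx.1, fun i _ => ?_⟩
    have h1 := hx.2 i
    have h2 : 0 ≤ N i (block i x) := apply_nonneg _ _
    have hw := weight_pos N' q
    rcases le_total K 0 with hK | hK
    · exact hK.trans (by positivity)
    calc K = K * 1 := (mul_one K).symm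
      _ ≤ K * (N i (block i x) * (L * weight N' q)) := by gcongr
      _ = K * L * weight N' q * N i (block i x) := by ring
      _ ≤ _ := by gcongr
  · exact zero_le

lemma partRegion_eq (w K : ℝ) (β : ℤ) {J : Fin k → Prop} (hJ : ∀ i, ¬ J i) :
    partRegion N η ε w K J β = region N η ε w := by
  ext; simp [partRegion, hJ]

/-- Correlation of two parallel vectors with very different multiples. -/
lemma exists_lintegral_goodCount_mul_sharp (N : ∀ i, Seminorm ℝ (Fin (m i) → ℝ)) :
    ∃ C : ℝ, 0 ≤ C ∧ ∀ (P : ℕ) (c : Idx m → ℤ) (L K : ℝ), 0 < K →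
      ∀ (α β : ℤ), α ≠ 0 → β ≠ 0 → IsCoprime α β → ∀ w : Idx n → ℤ, w ≠ 0 →
      (K * L * weight N' (α • w) ≤ |(β : ℝ)| ∨ K * L * weight N' (β • w) ≤ |(α : ℝ)|) →
      ∀ (a : Idx m → ℝ) (b : Idx m → Idx n → ℝ),
      ∫⁻ x, goodCount N N' η ε P c L (α • w) (a + rowMul (fun _ => α • w) x) *
        goodCount N N' η ε P c L (β • w) (a + rowMul (fun _ => β • w) x) ∂boxMeasure₂ b ≤
      ENNReal.ofReal ((1 + C / K) ^ (2 * ∑ i, m i)) *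
        (volume (region N η ε (weight N' (α • w))) *
          volume (region N η ε (weight N' (β • w)))) := by
  obtain ⟨C, hC, h⟩ := exists_lintegral_partRegion_mul_le (n := n) (η := η) (ε := ε) N
  refine ⟨C, hC, fun P c L K hK α β hα hβ hαβ w hw hh a b => ?_⟩
  rcases hh with hh | hh
  -- Only the first argument is perturbed, in all blocks; the second region then carries no lower
  -- bound.
  · refine le_trans (lintegral_mono fun x => ?_) (h K hK _ _ (weight_pos N' _).le
      (weight_pos N' _).le (fun _ => True) α β hα hβ hαβ w hw a b)
    refine mul_le_mul' (goodCount_le_perCount_partRegion hh _ _) ?_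
    rw [partRegion_eq _ _ _ (by simp)]
    exact goodCount_le_perCount _ _ _ _ _
  · refine le_trans (lintegral_mono fun x => ?_) (h K hK _ _ (weight_pos N' _).le
      (weight_pos N' _).le (fun _ => False) α β hα hβ hαβ w hw a b)
    refine mul_le_mul' ?_ (goodCount_le_perCount_partRegion hh _ _)
    rw [partRegion_eq _ _ _ (by simp)]
    exact goodCount_le_perCount _ _ _ _ _

/-- The equation and coprimality force α to divide the whole block of c + Pz; α also divides αw and
exceeds L, which goodness forbids. -/
lemma not_isGood_of_block_eq {P : ℕ} {c : Idx m → ℤ} {L : ℝ} {α β : ℤ}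
    (hαβ : IsCoprime α β) (hL : L < |(α : ℝ)|) (w : Idx n → ℤ) {z z' : Idx m → ℤ} {i : Fin k}
    (h : ∀ t, β * (c ⟨i, t⟩ + P * z ⟨i, t⟩) = α * (c ⟨i, t⟩ + P * z' ⟨i, t⟩)) :
    ¬ IsGood P c L (α • w) z := by
  intro hg
  refine hg i α.natAbs ?_ (fun t => ?_) fun t => ?_
  · rwa [Nat.cast_natAbs, Int.cast_abs]
  · rw [Int.natAbs_dvd]; exact Dvd.intro _ rfl
  · rw [Int.natAbs_dvd]
    exact hαβ.dvd_of_dvd_mul_left (Dvd.intro _ (h t).symm)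

/-- Correlation of two parallel vectors that are not small multiples of a third one. -/
lemma exists_lintegral_goodCount_mul_crude (hN : ∀ i x, N i x = 0 → x = 0) {P : ℕ} (hP : 1 ≤ P) :
    ∃ C : ℝ, 0 ≤ C ∧ ∀ (c : Idx m → ℤ) (L : ℝ),
      ∀ (α β : ℤ), α ≠ 0 → β ≠ 0 → IsCoprime α β → ∀ w : Idx n → ℤ, w ≠ 0 →
      (L < |(α : ℝ)| ∨ L < |(β : ℝ)|) →
      ∀ (a : Idx m → ℝ) (b : Idx m → Idx n → ℝ), (P : ℝ) • a = intToReal c →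
      ∫⁻ x, goodCount N N' η ε P c L (α • w) (a + rowMul (fun _ => α • w) x) *
        goodCount N N' η ε P c L (β • w) (a + rowMul (fun _ => β • w) x) ∂boxMeasure₂ b ≤
      ENNReal.ofReal C *
        (volume (region N η ε (weight N' (α • w))) *
          volume (region N η ε (weight N' (β • w)))) := by
  classical
  obtain ⟨C, hC, h⟩ := exists_lintegral_partRegion_mul_le (n := n) (η := η) (ε := ε) N
  obtain ⟨c₁, hc₁, -, hc₁'⟩ := exists_le_seminorm_int hN
  have hP0 : (0 : ℝ) < P := by positivity
  -- Half of c₁/P, where c₁ bounds the norms of nonzero integer blocks from below: if two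
  -- nonnegative terms sum to at least c₁/P, one of them is at least K.
  set K : ℝ := c₁ / (2 * P) with hK
  have hK0 : 0 < K := by positivity
  refine ⟨Fintype.card (Finset (Fin k)) * (1 + C / K) ^ (2 * ∑ i, m i), by positivity,
    fun c L α β hα hβ hαβ w hw hL a b ha => ?_⟩
  set w₁ := weight N' (α • w)
  set w₂ := weight N' (β • w)
  have key : ∀ x : Idx m → Idx n → ℝ, goodCount N N' η ε P c L (α • w)
        (a + rowMul (fun _ => α • w) x) *
      goodCount N N' η ε P c L (β • w) (a + rowMul (fun _ => β • w) x) ≤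
      ∑ J : Finset (Fin k), perCount (partRegion N η ε w₁ K (· ∈ J) β)
          (a + rowMul (fun _ => α • w) x) *
        perCount (partRegion N η ε w₂ K (fun i => ¬ i ∈ J) α)
          (a + rowMul (fun _ => β • w) x) := by
    intro x
    set y := a + rowMul (fun _ => α • w) x with hy
    set y' := a + rowMul (fun _ => β • w) x with hy'
    simp only [goodCount, perCount, ← ENNReal.tsum_mul_right, ← ENNReal.tsum_mul_left]
    rw [← Summable.tsum_finsetSum fun _ _ => ENNReal.summable]
    refine ENNReal.tsum_le_tsum fun z' => ?_
    rw [← Summable.tsum_finsetSum fun _ _ => ENNReal.summable]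
    refine ENNReal.tsum_le_tsum fun z => ?_
    by_cases hz : IsGood P c L (α • w) z ∧ intToReal z + y ∈ goodRegion N η ε L w₁
    swap
    · rw [not_and_or] at hz
      rcases hz with hz | hz
      · rw [if_neg hz, zero_mul]; exact zero_le
      · rw [Set.indicator_of_notMem hz, ite_self, zero_mul]; exact zero_le
    by_cases hz' : IsGood P c L (β • w) z' ∧ intToReal z' + y' ∈ goodRegion N η ε L w₂
    swap
    · rw [not_and_or] at hz'
      rcases hz' with hz' | hz'
      · rw [if_neg hz', mul_zero]; exact zero_le
      · rw [Set.indicator_of_notMem hz', ite_self, mul_zero]; exact zero_le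
    -- J collects the blocks to be perturbed on the first side. It depends on the pair of
    -- translates, so the bound sums over all subsets.
    set J : Finset (Fin k) := Finset.univ.filter fun i =>
      K ≤ |(β : ℝ)| * N i (block i (intToReal z + y)) with hJ
    refine le_trans ?_ (Finset.single_le_sum (fun _ _ => zero_le) (Finset.mem_univ J))
    have hm₁ : intToReal z + y ∈ partRegion N η ε w₁ K (· ∈ J) β :=
      ⟨hz.2.1, fun i hi => (Finset.mem_filter.1 hi).2⟩
    have hm₂ : intToReal z' + y' ∈ partRegion N η ε w₂ K (fun i => ¬ i ∈ J) α := by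
      refine ⟨hz'.2.1, fun i hi => ?_⟩
      have hi' : |(β : ℝ)| * N i (block i (intToReal z + y)) < K := by
        by_contra! h0
        exact hi (Finset.mem_filter.2 ⟨Finset.mem_univ i, h0⟩)
      set u : Fin (m i) → ℤ := fun t =>
        β * (c ⟨i, t⟩ + P * z ⟨i, t⟩) - α * (c ⟨i, t⟩ + P * z' ⟨i, t⟩) with hu
      -- This is the use of the divisibility truncation: if u vanished, the larger of α, β would be
      -- a forbidden common divisor.
      have hu0 : u ≠ 0 := by
        intro hu0
        have hb : ∀ t, β * (c ⟨i, t⟩ + P * z ⟨i, t⟩) = α * (c ⟨i, t⟩ + P * z' ⟨i, t⟩) :=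
          fun t => sub_eq_zero.1 (congrFun hu0 t)
        rcases hL with hL | hL
        · exact not_isGood_of_block_eq hαβ hL w hb hz.1
        · exact not_isGood_of_block_eq hαβ.symm hL w (fun t => (hb t).symm) hz'.1
      have h1 := hc₁' i u hu0
      have h2 : (P : ℝ)⁻¹ • intToReal u = (β : ℝ) • block i (intToReal z + y) -
          (α : ℝ) • block i (intToReal z' + y') := by
        ext t
        have hat : (P : ℝ) * a ⟨i, t⟩ = c ⟨i, t⟩ := congrFun ha ⟨i, t⟩
        rw [hy, hy', rowMul_smul, rowMul_smul]
        simp only [hu, intToReal, block, Pi.smul_apply, Pi.add_apply, Pi.sub_apply, smul_eq_mul,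
          Int.cast_sub, Int.cast_mul, Int.cast_add, Int.cast_natCast, ← hat]
        field_simp
        ring
      have h3 : c₁ / P ≤ |(β : ℝ)| * N i (block i (intToReal z + y)) +
          |(α : ℝ)| * N i (block i (intToReal z' + y')) := by
        calc c₁ / P ≤ (P : ℝ)⁻¹ * N i (intToReal u) := by
              rw [div_eq_inv_mul]; gcongr
          _ = N i ((P : ℝ)⁻¹ • intToReal u) := by
              rw [map_smul_eq_mul, Real.norm_eq_abs, abs_of_pos (by positivity)]
          _ ≤ _ := by
              rw [h2]
              refine (map_sub_le_add _ _ _).trans_eq ?_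
              rw [map_smul_eq_mul, map_smul_eq_mul, Real.norm_eq_abs, Real.norm_eq_abs]
      have h4 : c₁ / P = K + K := by rw [hK]; field_simp; norm_num
      linarith
    rw [Set.indicator_of_mem hm₁, Set.indicator_of_mem hm₂, if_pos hz.1, if_pos hz'.1]
    exact mul_le_mul' (Set.indicator_apply_le' (fun _ => le_rfl) fun _ => zero_le)
      (Set.indicator_apply_le' (fun _ => le_rfl) fun _ => zero_le)
  refine (lintegral_mono key).trans ?_
  have hM : ∀ J ∈ (Finset.univ : Finset (Finset (Fin k))), Measurable fun x : Idx m → Idx n → ℝ =>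
      perCount (partRegion N η ε w₁ K (· ∈ J) β) (a + rowMul (fun _ => α • w) x) *
        perCount (partRegion N η ε w₂ K (fun i => ¬ i ∈ J) α) (a + rowMul (fun _ => β • w) x) :=
    fun J _ => (measurable_perCount_rowMul (measurableSet_partRegion _ _ _ _) _ _).mul
      (measurable_perCount_rowMul (measurableSet_partRegion _ _ _ _) _ _)
  rw [lintegral_finsetSum _ hM]
  refine (Finset.sum_le_sum fun J _ => h K hK0 w₁ w₂ (weight_pos N' _).le (weight_pos N' _).le
    (· ∈ J) α β hα hβ hαβ w hw a b).trans_eq ?_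
  rw [Finset.sum_const, Finset.card_univ, nsmul_eq_mul, ENNReal.ofReal_mul (by positivity),
    ENNReal.ofReal_natCast, mul_assoc]

lemma lintegral_goodCount_mul_le {P : ℕ} {c : Idx m → ℤ} {L : ℝ} {q q' : Idx n → ℤ}
    (h : ∃ j l, q j * q' l - q l * q' j ≠ 0) (a : Idx m → ℝ) (b : Idx m → Idx n → ℝ) :
    ∫⁻ x, goodCount N N' η ε P c L q (a + rowMul (fun _ => q) x) *
        goodCount N N' η ε P c L q' (a + rowMul (fun _ => q') x) ∂boxMeasure₂ b ≤
      volume (region N η ε (weight N' q)) * volume (region N η ε (weight N' q')) := by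
  refine (lintegral_mono fun x => mul_le_mul' (goodCount_le_perCount _ _ _ _ _)
    (goodCount_le_perCount _ _ _ _ _)).trans_eq ?_
  exact lintegral_perCount_mul_perCount (measurableSet_region _) (measurableSet_region _) b
    (fun _ => q) (fun _ => q') (fun _ => h) a a

/-- For small multiples of a common vector no decorrelation is attempted: the second count is
uniformly bounded, and the first has mean at most the volume of its region. -/
lemma exists_lintegral_goodCount_mul_near (hN : ∀ i x, N i x = 0 → x = 0) :
    ∃ C : ℝ, 0 ≤ C ∧ ∀ (P : ℕ) (c : Idx m → ℤ) (L : ℝ) (q q' : Idx n → ℤ), q ≠ 0 →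
      ∀ (a : Idx m → ℝ) (b : Idx m → Idx n → ℝ),
      ∫⁻ x, goodCount N N' η ε P c L q (a + rowMul (fun _ => q) x) *
        goodCount N N' η ε P c L q' (a + rowMul (fun _ => q') x) ∂boxMeasure₂ b ≤
      ENNReal.ofReal C * volume (region N η ε (weight N' q)) := by
  obtain ⟨R, hR, h⟩ := exists_region_bound (η := η) (ε := ε) hN
  refine ⟨(2 * R + 1) ^ Fintype.card (Idx m), by positivity, fun P c L q q' hq a b => ?_⟩
  refine (lintegral_mono fun x => mul_le_mul' (goodCount_le_perCount _ _ _ _ _)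
    ((goodCount_le_perCount _ _ _ _ _).trans (perCount_le hR (h _) _))).trans_eq ?_
  obtain ⟨t, ht⟩ := exists_ne_zero_of_ne_zero hq
  rw [lintegral_mul_const _ (measurable_perCount_rowMul (measurableSet_region _) _ _),
    lintegral_perCount (measurableSet_region _) b _ fun _ => ⟨t, ht⟩, mul_comm]

end Correlation

/-! ### Elementary sums over integers -/

section ArithmeticSums

lemma tsum_int_natAbs_le (f : ℕ → ℝ≥0∞) : ∑' α : ℤ, f α.natAbs ≤ 2 * ∑' a, f a := by
  have h : HasSum (fun α : ℤ => f α.natAbs)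
      ((∑' a : ℕ, f (a : ℤ).natAbs) + ∑' a : ℕ, f (-((a : ℤ) + 1)).natAbs) :=
    HasSum.of_nat_of_neg_add_one (f := fun α : ℤ => f α.natAbs) ENNReal.summable.hasSum
      ENNReal.summable.hasSum
  rw [h.tsum_eq, two_mul]
  refine add_le_add (by simp) ?_
  have h1 : ∀ a : ℕ, (-((a : ℤ) + 1)).natAbs = a + 1 := fun a => by lia
  simp only [h1]
  exact ENNReal.tsum_comp_le_tsum_of_injective (add_left_injective 1) f

/-- `a` is a positive integer of size at most `A e ^ T`. -/
def InRange (A T : ℝ) (a : ℕ) : Prop := 1 ≤ a ∧ (a : ℝ) ≤ A * Real.exp T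

open Classical in
lemma exists_tsum_inv_le (A : ℝ) : ∃ C : ℝ, 0 ≤ C ∧ ∀ T : ℝ, 1 ≤ T →
    ∑' a : ℕ, (if InRange A T a then ENNReal.ofReal (a : ℝ)⁻¹ else 0) ≤
      ENNReal.ofReal (C * T) := by
  set B := max 1 A
  refine ⟨2 + Real.log B, by have := Real.log_nonneg (le_max_left 1 A); positivity,
    fun T hT => ?_⟩
  have hB : 1 ≤ B := le_max_left _ _
  have hBT : 1 ≤ B * Real.exp T := one_le_mul_of_one_le_of_one_le hB (Real.one_le_exp (by linarith))
  set M := ⌊B * Real.exp T⌋₊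
  calc _ ≤ ∑' a : ℕ, (if a ∈ Finset.Icc 1 M then ENNReal.ofReal (a : ℝ)⁻¹ else 0) := by
        refine ENNReal.tsum_le_tsum fun a => ?_
        split_ifs with h1 h2
        · exact le_rfl
        · refine (h2 (Finset.mem_Icc.2 ⟨h1.1, Nat.le_floor (h1.2.trans ?_)⟩)).elim
          gcongr; exact le_max_right _ _
        · exact zero_le
        · exact zero_le
    _ = ENNReal.ofReal (∑ a ∈ Finset.Icc 1 M, (a : ℝ)⁻¹) := by
        rw [tsum_eq_sum (s := Finset.Icc 1 M) fun a ha => if_neg ha,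
          ENNReal.ofReal_sum_of_nonneg fun a _ => by positivity]
        exact Finset.sum_congr rfl fun a ha => if_pos ha
    _ ≤ _ := by
        refine ENNReal.ofReal_le_ofReal ?_
        have h := harmonic_floor_le_one_add_log (B * Real.exp T) hBT
        rw [harmonic_eq_sum_Icc] at h
        push_cast at h
        refine h.trans ?_
        rw [Real.log_mul (by positivity) (by positivity), Real.log_exp]
        have := Real.log_nonneg hB
        nlinarith

lemma sum_Icc_rpow_neg_half_le (a : ℕ) :
    ∑ b ∈ Finset.Icc 1 a, (b : ℝ) ^ (-(1 / 2) : ℝ) ≤ 2 * (a : ℝ) ^ (1 / 2 : ℝ) := by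
  induction a with
  | zero => simp
  | succ a ih =>
    rw [Finset.sum_Icc_succ_top (by lia)]
    refine (add_le_add_left ih _).trans ?_
    have h1 : ((a + 1 : ℕ) : ℝ) = a + 1 := by push_cast; ring
    rw [h1, Real.rpow_neg (by positivity), ← Real.sqrt_eq_rpow, ← Real.sqrt_eq_rpow]
    have h2 : 0 < Real.sqrt (a + 1) := Real.sqrt_pos.2 (by positivity)
    have h3 := Real.sq_sqrt (show (0 : ℝ) ≤ a by positivity)
    have h4 := Real.sq_sqrt (show (0 : ℝ) ≤ a + 1 by positivity)
    have h5 := Real.sqrt_nonneg (a : ℝ)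
    rw [← sub_nonneg]
    have : 2 * Real.sqrt (a + 1) - (2 * Real.sqrt a + (Real.sqrt (a + 1))⁻¹) =
        (Real.sqrt (a + 1) - Real.sqrt a) ^ 2 / Real.sqrt (a + 1) := by
      field_simp
      nlinarith
    rw [this]; positivity

open Classical in
-- The inner sum over b ≤ a is at most 2√a, leaving 2/a, so the double sum grows like T, whereas
-- that of 1/(ab) would grow like T².
lemma exists_tsum_skew_le (A : ℝ) : ∃ C : ℝ, 0 ≤ C ∧ ∀ T : ℝ, 1 ≤ T →
    ∑' a : ℕ, ∑' b : ℕ, (if InRange A T a ∧ InRange A T b ∧ b ≤ a then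
      ENNReal.ofReal ((a : ℝ) ^ (-(3 / 2) : ℝ) * (b : ℝ) ^ (-(1 / 2) : ℝ)) else 0) ≤
      ENNReal.ofReal (C * T) := by
  obtain ⟨C, hC, h⟩ := exists_tsum_inv_le A
  refine ⟨2 * C, by positivity, fun T hT => ?_⟩
  calc _ ≤ ∑' a : ℕ, ENNReal.ofReal 2 *
        (if InRange A T a then ENNReal.ofReal (a : ℝ)⁻¹ else 0) := by
        refine ENNReal.tsum_le_tsum fun a => ?_
        by_cases ha : InRange A T a
        swap
        · simp [ha]
        have ha0 : (0 : ℝ) < a := by exact_mod_cast ha.1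
        calc _ ≤ ∑' b : ℕ, (if b ∈ Finset.Icc 1 a then
              ENNReal.ofReal ((a : ℝ) ^ (-(3 / 2) : ℝ) * (b : ℝ) ^ (-(1 / 2) : ℝ)) else 0) := by
              refine ENNReal.tsum_le_tsum fun b => ?_
              split_ifs with h1 h2
              · exact le_rfl
              · exact (h2 (Finset.mem_Icc.2 ⟨h1.2.1.1, h1.2.2⟩)).elim
              · exact zero_le
              · exact zero_le
          _ = ENNReal.ofReal ((a : ℝ) ^ (-(3 / 2) : ℝ) *
                ∑ b ∈ Finset.Icc 1 a, (b : ℝ) ^ (-(1 / 2) : ℝ)) := by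
              rw [tsum_eq_sum (s := Finset.Icc 1 a) fun b hb => if_neg hb, Finset.mul_sum,
                ENNReal.ofReal_sum_of_nonneg fun b _ => by positivity]
              exact Finset.sum_congr rfl fun b hb => if_pos hb
          _ ≤ ENNReal.ofReal (2 * (a : ℝ)⁻¹) := by
              refine ENNReal.ofReal_le_ofReal ?_
              refine (mul_le_mul_of_nonneg_left (sum_Icc_rpow_neg_half_le a)
                (by positivity)).trans_eq ?_
              rw [mul_left_comm, ← Real.rpow_add ha0, ← Real.rpow_neg_one]
              norm_num
          _ = _ := by rw [if_pos ha, ENNReal.ofReal_mul (by norm_num)]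
    _ ≤ _ := by
        rw [ENNReal.tsum_mul_left, mul_assoc 2 C, ENNReal.ofReal_mul (by norm_num)]
        gcongr
        exact h T hT

lemma tsum_ite_and_mul (p : ℕ → Prop) [DecidablePred p] (f : ℕ → ℝ≥0∞) :
    ∑' a : ℕ, ∑' b : ℕ, (if p a ∧ p b then f a * f b else 0) =
      (∑' a : ℕ, if p a then f a else 0) ^ 2 := by
  rw [pow_two, ← ENNReal.tsum_mul_right]
  refine tsum_congr fun a => ?_
  rw [← ENNReal.tsum_mul_left]
  refine tsum_congr fun b => ?_
  by_cases ha : p a <;> by_cases hb : p b <;> simp [ha, hb]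

end ArithmeticSums

/-! ### Convergence of the sum of weights to the power -3/2 -/

section WeightSums

variable {r : ℕ} {n : Fin r → ℕ} {N' : ∀ j, Seminorm ℝ (Fin (n j) → ℝ)}

lemma pow_le_weight (q : Idx n → ℤ) (j : Fin r) :
    N' j (block j (intToReal q)) ^ n j ≤ weight N' q := by
  refine (le_max_right 1 _).trans ?_
  calc max 1 (N' j (block j (intToReal q)) ^ n j)
      = ∏ l, if l = j then max 1 (N' j (block j (intToReal q)) ^ n j) else 1 := by simp
    _ ≤ weight N' q := by
        refine Finset.prod_le_prod (fun l _ => by split_ifs <;> positivity) fun l _ => ?_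
        split_ifs with h
        · rw [h]
        · exact le_max_left _ _

/-- Slice by the least t with all block norms at most e^{t+1}. There w ≥ e^t, so w^{-3/2} ≤ e^{-t/2}
w⁻¹, and the exponential beats the polynomial growth of the sum of w⁻¹. -/
lemma exists_tsum_weight_rpow_le (hn : ∀ j, 1 ≤ n j) (hN' : ∀ j y, N' j y = 0 → y = 0) :
    ∃ C : ℝ, 0 ≤ C ∧
      ∑' q : Idx n → ℤ, ENNReal.ofReal (weight N' q ^ (-(3 / 2) : ℝ)) ≤ ENNReal.ofReal C := by
  classical
  obtain ⟨C, hC, h⟩ := exists_tsum_inv_weight_le hN' hn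
  let u : ℕ → ℝ := fun t => C * ((t : ℝ) + 1) ^ r * Real.exp (-t / 2)
  have hu0 : ∀ t, 0 ≤ u t := fun t => by positivity
  have hu : Summable u := by
    have h1 := (Real.summable_pow_mul_exp_neg_nat_mul r (show (0 : ℝ) < 1 / 2 by norm_num))
    have h2 := ((summable_nat_add_iff 1).2 h1).mul_left (C * Real.exp (1 / 2))
    refine h2.congr fun t => ?_
    simp only [u]
    push_cast
    have h3 : Real.exp (-(t : ℝ) / 2) =
        Real.exp (1 / 2) * Real.exp (-(1 / 2) * ((t : ℝ) + 1)) := by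
      rw [← Real.exp_add]; congr 1; ring
    rw [h3]; ring
  refine ⟨∑' t, u t, tsum_nonneg hu0, ?_⟩
  calc _ ≤ ∑' q : Idx n → ℤ, ∑' t : ℕ, ENNReal.ofReal (Real.exp (-t / 2)) *
        (if ∀ j, N' j (block j (intToReal q)) ≤ Real.exp ((t : ℝ) + 1) then
          ENNReal.ofReal (weight N' q)⁻¹ else 0) := by
        refine ENNReal.tsum_le_tsum fun q => ?_
        have hw := weight_pos N' q
        have hex : ∃ t : ℕ, ∀ j, N' j (block j (intToReal q)) ≤ Real.exp ((t : ℝ) + 1) := by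
          obtain ⟨t, ht⟩ := exists_nat_ge (∑ j, N' j (block j (intToReal q)))
          refine ⟨t, fun j => ?_⟩
          have h1 : N' j (block j (intToReal q)) ≤ ∑ j, N' j (block j (intToReal q)) :=
            Finset.single_le_sum (f := fun j => N' j (block j (intToReal q)))
              (fun _ _ => apply_nonneg _ _) (Finset.mem_univ j)
          have h2 := Real.add_one_le_exp ((t : ℝ) + 1)
          linarith
        have hfind := Nat.find_spec hex
        set t := Nat.find hex with ht
        refine le_trans ?_ (ENNReal.le_tsum t)
        rw [if_pos hfind, ← ENNReal.ofReal_mul (by positivity)]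
        refine ENNReal.ofReal_le_ofReal ?_
        have hwt : Real.exp t ≤ weight N' q := by
          rcases Nat.eq_zero_or_pos t with h0 | h0
          · rw [h0]; simpa using one_le_weight N' q
          -- Minimality of t produces a block of norm greater than e^t, and n j ≥ 1 transfers this
          -- to the weight.
          · have h1 := Nat.find_min hex (m := t - 1) (by lia)
            push Not at h1
            obtain ⟨j, hj⟩ := h1
            have h2 : ((t - 1 : ℕ) : ℝ) + 1 = t := by
              rw [Nat.cast_sub h0]; simp
            rw [h2] at hj
            have h3 : 1 ≤ N' j (block j (intToReal q)) :=
              (Real.one_le_exp (by positivity)).trans hj.le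
            exact hj.le.trans ((le_self_pow₀ h3 (by have := hn j; lia)).trans (pow_le_weight q j))
        have h4 : weight N' q ^ (-(1 / 2) : ℝ) ≤ Real.exp (-t / 2) := by
          calc weight N' q ^ (-(1 / 2) : ℝ) ≤ (Real.exp t) ^ (-(1 / 2) : ℝ) :=
                Real.rpow_le_rpow_of_nonpos (Real.exp_pos _) hwt (by norm_num)
            _ = _ := by rw [← Real.exp_mul]; congr 1; ring
        calc weight N' q ^ (-(3 / 2) : ℝ) = weight N' q ^ (-(1 / 2) : ℝ) * (weight N' q)⁻¹ := by
              rw [← Real.rpow_neg_one, ← Real.rpow_add hw]; norm_num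
          _ ≤ _ := by gcongr
    _ = ∑' t : ℕ, ENNReal.ofReal (Real.exp (-t / 2)) * ∑' q : Idx n → ℤ,
        (if ∀ j, N' j (block j (intToReal q)) ≤ Real.exp ((t : ℝ) + 1) then
          ENNReal.ofReal (weight N' q)⁻¹ else 0) := by
        rw [ENNReal.tsum_comm]
        exact tsum_congr fun t => ENNReal.tsum_mul_left
    _ ≤ ∑' t : ℕ, ENNReal.ofReal (u t) := by
        refine ENNReal.tsum_le_tsum fun t => ?_
        refine (mul_le_mul' le_rfl (h ((t : ℝ) + 1) (by simp))).trans_eq ?_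
        rw [← ENNReal.ofReal_mul (by positivity)]
        congr 1
        simp only [u]; ring
    _ = _ := (ENNReal.ofReal_tsum_of_nonneg hu0 hu).symm

end WeightSums

/-! ### Sums over comparable parallel pairs -/

section PairSums

variable {r : ℕ} {n : Fin r → ℕ} {N' : ∀ j, Seminorm ℝ (Fin (n j) → ℝ)}

lemma inv_mul_inv_rpow_le {x : ℝ} (hx : 1 ≤ x) : x⁻¹ * x⁻¹ ≤ x ^ (-(3 / 2) : ℝ) := by
  have hx0 : 0 < x := by linarith
  rw [← Real.rpow_neg_one, ← Real.rpow_add hx0]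
  exact Real.rpow_le_rpow_of_exponent_le hx (by norm_num)

lemma inv_mul_inv_le_skew {a b Y : ℝ} (ha : 0 < a) (hb : 0 < b) (hY : 0 < Y) (h : a ≤ Y * b) :
    a⁻¹ * b⁻¹ ≤ Y ^ (1 / 2 : ℝ) * (a ^ (-(3 / 2) : ℝ) * b ^ (-(1 / 2) : ℝ)) := by
  have h1 : a ^ (1 / 2 : ℝ) ≤ Y ^ (1 / 2 : ℝ) * b ^ (1 / 2 : ℝ) := by
    rw [← Real.mul_rpow hY.le hb.le]
    exact Real.rpow_le_rpow ha.le h (by norm_num)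
  have ea : a⁻¹ = a ^ (1 / 2 : ℝ) * a ^ (-(3 / 2) : ℝ) := by
    rw [← Real.rpow_add ha, ← Real.rpow_neg_one]; norm_num
  have eb : b ^ (1 / 2 : ℝ) * b⁻¹ = b ^ (-(1 / 2) : ℝ) := by
    rw [← Real.rpow_neg_one, ← Real.rpow_add hb]; norm_num
  calc a⁻¹ * b⁻¹ = a ^ (1 / 2 : ℝ) * (a ^ (-(3 / 2) : ℝ) * b⁻¹) := by rw [ea]; ring
    _ ≤ Y ^ (1 / 2 : ℝ) * b ^ (1 / 2 : ℝ) * (a ^ (-(3 / 2) : ℝ) * b⁻¹) := by gcongr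
    _ = Y ^ (1 / 2 : ℝ) * (a ^ (-(3 / 2) : ℝ) * (b ^ (1 / 2 : ℝ) * b⁻¹)) := by ring
    _ = _ := by rw [eb]

/-- A summable majorant for the products of the inverse weights of pairs of parallel vectors. -/
def IsPairKernel (N' : ∀ j, Seminorm ℝ (Fin (n j) → ℝ)) (G : ℕ → ℕ → ℝ≥0∞) (C : ℝ) : Prop :=
  ∀ (X : ℝ) (α β : ℤ) (w : Idx n → ℤ), 1 ≤ X → α ≠ 0 → β ≠ 0 → w ≠ 0 →
    |(β : ℝ)| < X * weight N' (α • w) → |(α : ℝ)| < X * weight N' (β • w) →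
    ENNReal.ofReal ((weight N' (α • w))⁻¹ * (weight N' (β • w))⁻¹) ≤
      ENNReal.ofReal (C * (X ^ (1 / 2 : ℝ) * weight N' w ^ (-(3 / 2) : ℝ))) *
        G α.natAbs β.natAbs

lemma cast_natAbs_pos {α : ℤ} (hα : α ≠ 0) : (1 : ℝ) ≤ (α.natAbs : ℝ) := by
  exact_mod_cast Int.natAbs_pos.2 hα

lemma abs_eq_natAbs (α : ℤ) : |(α : ℝ)| = (α.natAbs : ℝ) := by
  rw [Nat.cast_natAbs, Int.cast_abs]

/-- A nonzero block j of w supplies the decay in α and β; the exponent s ≤ n j is left free so that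
one choice can serve every j. -/
lemma exists_inv_weight_smul_mul_le (hN' : ∀ j y, N' j y = 0 → y = 0) :
    ∃ C : ℝ, 0 < C ∧ ∀ (α β : ℤ) (w : Idx n → ℤ), α ≠ 0 → β ≠ 0 → w ≠ 0 → ∃ j : Fin r,
      ∀ s ≤ n j, (weight N' (α • w))⁻¹ * (weight N' (β • w))⁻¹ ≤
        C * ((weight N' w)⁻¹ * (weight N' w)⁻¹) *
          (((α.natAbs : ℝ) ^ s)⁻¹ * ((β.natAbs : ℝ) ^ s)⁻¹) := by
  obtain ⟨c, hc, -, h⟩ := exists_weight_smul_ge hN'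
  refine ⟨c⁻¹ * c⁻¹, by positivity, fun α β w hα hβ hw => ?_⟩
  obtain ⟨⟨j, t⟩, ht⟩ := exists_ne_zero_of_ne_zero hw
  refine ⟨j, fun s hs => ?_⟩
  have key : ∀ α : ℤ, α ≠ 0 → (weight N' (α • w))⁻¹ ≤
      c⁻¹ * (weight N' w)⁻¹ * ((α.natAbs : ℝ) ^ s)⁻¹ := by
    intro α hα
    have hα1 := cast_natAbs_pos hα
    have hw0 := weight_pos N' w
    have h1 := h α w j hα ⟨t, ht⟩
    rw [abs_eq_natAbs] at h1
    rw [← mul_inv, ← mul_inv]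
    refine inv_anti₀ (by positivity) (le_trans ?_ h1)
    have : (α.natAbs : ℝ) ^ s ≤ (α.natAbs : ℝ) ^ n j := pow_le_pow_right₀ hα1 hs
    calc c * weight N' w * (α.natAbs : ℝ) ^ s ≤ c * weight N' w * (α.natAbs : ℝ) ^ n j := by gcongr
      _ = _ := by ring
  have h0 := weight_pos N' (β • w)
  calc _ ≤ (c⁻¹ * (weight N' w)⁻¹ * ((α.natAbs : ℝ) ^ s)⁻¹) *
        (c⁻¹ * (weight N' w)⁻¹ * ((β.natAbs : ℝ) ^ s)⁻¹) := by
        have hw0 := weight_pos N' w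
        exact mul_le_mul (key α hα) (key β hβ) (by positivity) (by positivity)
    _ = _ := by ring

lemma exists_isPairKernel_pow (hN' : ∀ j y, N' j y = 0 → y = 0) (s : ℕ) (hs : ∀ j, s ≤ n j) :
    ∃ C : ℝ, 0 ≤ C ∧ IsPairKernel N' (fun a b => ENNReal.ofReal ((a : ℝ) ^ s)⁻¹ *
      ENNReal.ofReal ((b : ℝ) ^ s)⁻¹) C := by
  obtain ⟨C, hC, h⟩ := exists_inv_weight_smul_mul_le hN'
  refine ⟨C, hC.le, fun X α β w hX hα hβ hw _ _ => ?_⟩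
  obtain ⟨j, hj⟩ := h α β w hα hβ hw
  have hw1 := one_le_weight N' w
  beta_reduce
  rw [← ENNReal.ofReal_mul (by positivity), ← ENNReal.ofReal_mul (by positivity)]
  refine ENNReal.ofReal_le_ofReal ((hj s (hs j)).trans ?_)
  refine mul_le_mul_of_nonneg_right (mul_le_mul_of_nonneg_left ?_ hC.le) (by positivity)
  refine (inv_mul_inv_rpow_le hw1).trans (le_mul_of_one_le_left (by positivity) ?_)
  exact Real.one_le_rpow hX (by norm_num)

open Classical in
-- In one variable w(αv) is at most |α| w(v), so comparability says that |α|/|β| and its inverse are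
-- at most X w(v). This trades 1/(ab) for (X w(v))^{1/2} a^{-3/2} b^{-1/2} with a ≥ b, still leaving
-- a convergent power -3/2 of w(v).
lemma exists_isPairKernel_skew {n : Fin 1 → ℕ} {N' : ∀ j, Seminorm ℝ (Fin (n j) → ℝ)}
    (hN' : ∀ j y, N' j y = 0 → y = 0) (hn : n 0 = 1) :
    ∃ C : ℝ, 0 ≤ C ∧ IsPairKernel N' (fun a b =>
      (if b ≤ a then ENNReal.ofReal ((a : ℝ) ^ (-(3 / 2) : ℝ) * (b : ℝ) ^ (-(1 / 2) : ℝ)) else 0) +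
      (if a ≤ b then ENNReal.ofReal ((b : ℝ) ^ (-(3 / 2) : ℝ) * (a : ℝ) ^ (-(1 / 2) : ℝ)) else 0))
      C := by
  obtain ⟨C, hC, h⟩ := exists_inv_weight_smul_mul_le hN'
  refine ⟨C, hC.le, fun X α β w hX hα hβ hw h₁ h₂ => ?_⟩
  obtain ⟨j, hj⟩ := h α β w hα hβ hw
  obtain rfl : j = 0 := Subsingleton.elim _ _
  have hj := hj 1 hn.ge
  simp only [pow_one] at hj
  have hw1 := one_le_weight N' w
  have hsm : ∀ γ : ℤ, γ ≠ 0 → weight N' (γ • w) ≤ (γ.natAbs : ℝ) * weight N' w := by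
    intro γ hγ
    have hγ1 := cast_natAbs_pos hγ
    simp only [weight, Fin.prod_univ_one, hn, pow_one, block_intToReal_smul, map_smul_eq_mul,
      Real.norm_eq_abs, abs_eq_natAbs]
    rw [mul_max_of_nonneg _ _ (by positivity)]
    exact max_le_max (by linarith) le_rfl
  rw [abs_eq_natAbs] at h₁ h₂
  have hα1 := cast_natAbs_pos hα
  have hβ1 := cast_natAbs_pos hβ
  set a : ℝ := (α.natAbs : ℝ)
  set b : ℝ := (β.natAbs : ℝ)
  set u := weight N' w
  have h₁' : b ≤ X * u * a := by
    refine h₁.le.trans ?_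
    calc X * weight N' (α • w) ≤ X * (a * u) := by gcongr; exact hsm α hα
      _ = _ := by ring
  have h₂' : a ≤ X * u * b := by
    refine h₂.le.trans ?_
    calc X * weight N' (β • w) ≤ X * (b * u) := by gcongr; exact hsm β hβ
      _ = _ := by ring
  have hu : (u⁻¹ * u⁻¹) * (X * u) ^ (1 / 2 : ℝ) = X ^ (1 / 2 : ℝ) * u ^ (-(3 / 2) : ℝ) := by
    have hu0 : 0 < u := by linarith
    rw [Real.mul_rpow (by positivity) hu0.le, mul_left_comm, ← Real.rpow_neg_one,
      ← Real.rpow_add hu0, ← Real.rpow_add hu0]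
    norm_num
  have hXu : 0 < X * u := by positivity
  beta_reduce
  rcases le_total β.natAbs α.natAbs with hab | hab
  · rw [if_pos hab]
    refine le_trans ?_ (mul_le_mul' le_rfl le_self_add)
    rw [← ENNReal.ofReal_mul (by positivity)]
    refine ENNReal.ofReal_le_ofReal (hj.trans ?_)
    calc _ ≤ C * (u⁻¹ * u⁻¹) * ((X * u) ^ (1 / 2 : ℝ) *
          (a ^ (-(3 / 2) : ℝ) * b ^ (-(1 / 2) : ℝ))) := by
          refine mul_le_mul_of_nonneg_left ?_ (by positivity)
          exact inv_mul_inv_le_skew (by linarith) (by linarith) hXu h₂'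
      _ = _ := by rw [← hu]; ring
  · rw [if_pos hab]
    refine le_trans ?_ (mul_le_mul' le_rfl le_add_self)
    rw [← ENNReal.ofReal_mul (by positivity)]
    refine ENNReal.ofReal_le_ofReal (hj.trans ?_)
    calc _ ≤ C * (u⁻¹ * u⁻¹) * ((X * u) ^ (1 / 2 : ℝ) *
          (b ^ (-(3 / 2) : ℝ) * a ^ (-(1 / 2) : ℝ))) := by
          rw [mul_comm a⁻¹]
          refine mul_le_mul_of_nonneg_left ?_ (by positivity)
          exact inv_mul_inv_le_skew (by linarith) (by linarith) hXu h₁'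
      _ = _ := by rw [← hu]; ring

open Classical in
-- The gain is one power of T against the trivial T^{2r}. For r ≥ 2 the kernel 1/(ab) gives T² ≤
-- T^{2r-1}; for r = 1 and n 0 ≥ 2 the kernel 1/(a²b²) is summable; only r = n 0 = 1 needs the skew
-- kernel, giving T.
lemma exists_isPairKernel (hr : 1 ≤ r) (hn : ∀ j, 1 ≤ n j) (hN' : ∀ j y, N' j y = 0 → y = 0)
    (A : ℝ) : ∃ (G : ℕ → ℕ → ℝ≥0∞) (C D : ℝ), 0 ≤ C ∧ 0 ≤ D ∧ IsPairKernel N' G C ∧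
      ∀ T : ℝ, 1 ≤ T →
        ∑' a : ℕ, ∑' b : ℕ, (if InRange A T a ∧ InRange A T b then G a b else 0) ≤
          ENNReal.ofReal (D * T ^ (2 * r - 1)) := by
  by_cases hr2 : 2 ≤ r
  · obtain ⟨C, hC, h⟩ := exists_isPairKernel_pow hN' 1 hn
    obtain ⟨D, hD, h'⟩ := exists_tsum_inv_le A
    refine ⟨_, C, D ^ 2, hC, by positivity, h, fun T hT => ?_⟩
    rw [tsum_ite_and_mul]
    simp only [pow_one]
    refine (pow_le_pow_left' (h' T hT) 2).trans ?_
    rw [← ENNReal.ofReal_pow (by positivity), mul_pow]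
    refine ENNReal.ofReal_le_ofReal ?_
    gcongr
    lia
  obtain rfl : r = 1 := by lia
  by_cases hn2 : 2 ≤ n 0
  · obtain ⟨C, hC, h⟩ := exists_isPairKernel_pow hN' 2 (fun j => by
      obtain rfl : j = 0 := Subsingleton.elim _ _
      exact hn2)
    have hs : Summable fun a : ℕ => ((a : ℝ) ^ 2)⁻¹ := Real.summable_nat_pow_inv.2 (by norm_num)
    refine ⟨_, C, (∑' a : ℕ, ((a : ℝ) ^ 2)⁻¹) ^ 2, hC, by positivity, h, fun T hT => ?_⟩
    rw [tsum_ite_and_mul]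
    refine le_trans (pow_le_pow_left' (b := ENNReal.ofReal (∑' a : ℕ, ((a : ℝ) ^ 2)⁻¹)) ?_ 2) ?_
    · rw [ENNReal.ofReal_tsum_of_nonneg (fun a => by positivity) hs]
      refine ENNReal.tsum_le_tsum fun a => ?_
      split_ifs
      · exact le_rfl
      · exact zero_le
    · rw [← ENNReal.ofReal_pow (tsum_nonneg fun a => by positivity)]
      refine ENNReal.ofReal_le_ofReal (le_mul_of_one_le_right (by positivity) ?_)
      exact one_le_pow₀ hT
  · obtain ⟨C, hC, h⟩ := exists_isPairKernel_skew hN' (by have := hn 0; lia)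
    obtain ⟨D, hD, h'⟩ := exists_tsum_skew_le A
    refine ⟨_, C, 2 * D, hC, by positivity, h, fun T hT => ?_⟩
    have e : ∀ a b : ℕ, (if InRange A T a ∧ InRange A T b then
        ((if b ≤ a then ENNReal.ofReal ((a : ℝ) ^ (-(3 / 2) : ℝ) * (b : ℝ) ^ (-(1 / 2) : ℝ))
          else 0) +
        (if a ≤ b then ENNReal.ofReal ((b : ℝ) ^ (-(3 / 2) : ℝ) * (a : ℝ) ^ (-(1 / 2) : ℝ))
          else 0)) else 0) =
        (if InRange A T a ∧ InRange A T b ∧ b ≤ a then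
          ENNReal.ofReal ((a : ℝ) ^ (-(3 / 2) : ℝ) * (b : ℝ) ^ (-(1 / 2) : ℝ)) else 0) +
        (if InRange A T b ∧ InRange A T a ∧ a ≤ b then
          ENNReal.ofReal ((b : ℝ) ^ (-(3 / 2) : ℝ) * (a : ℝ) ^ (-(1 / 2) : ℝ)) else 0) := by
      intro a b
      by_cases ha : InRange A T a <;> by_cases hb : InRange A T b <;> simp [ha, hb]
    simp only [e, ENNReal.tsum_add]
    rw [ENNReal.tsum_comm (f := fun a b : ℕ => if InRange A T b ∧ InRange A T a ∧ a ≤ b then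
          ENNReal.ofReal ((b : ℝ) ^ (-(3 / 2) : ℝ) * (a : ℝ) ^ (-(1 / 2) : ℝ)) else 0)]
    refine (add_le_add (h' T hT) (h' T hT)).trans_eq ?_
    rw [← ENNReal.ofReal_add (by positivity) (by positivity)]
    congr 1
    norm_num; ring

/-- Two parallel vectors whose multiples have comparable sizes. -/
def IsComparable (N' : ∀ j, Seminorm ℝ (Fin (n j) → ℝ)) (X : ℝ) (q q' : Idx n → ℤ) : Prop :=
  ∃ (α β : ℤ) (w : Idx n → ℤ), α ≠ 0 ∧ β ≠ 0 ∧ w ≠ 0 ∧ q = α • w ∧ q' = β • w ∧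
    |(β : ℝ)| < X * weight N' q ∧ |(α : ℝ)| < X * weight N' q'

/-- A pair is determined by its data (α, β, v), so the sum is at most one over triples. That sum
factors: the multipliers give T^{2r-1}, and the sum over v of w(v)^{-3/2} converges. -/
lemma exists_sum_comparable_le (hr : 1 ≤ r) (hn : ∀ j, 1 ≤ n j)
    (hN' : ∀ j y, N' j y = 0 → y = 0) :
    ∃ C : ℝ, 0 ≤ C ∧ ∀ T : ℝ, 1 ≤ T → ∀ X : ℝ, 1 ≤ X → ∀ Q, IsBoundedBy N' T Q →
      ∀ B : Finset ((Idx n → ℤ) × (Idx n → ℤ)), B ⊆ Q ×ˢ Q →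
      (∀ p ∈ B, IsComparable N' X p.1 p.2) →
      ∑ p ∈ B, ENNReal.ofReal ((weight N' p.1)⁻¹ * (weight N' p.2)⁻¹) ≤
        ENNReal.ofReal (C * T ^ (2 * r - 1) * X ^ (1 / 2 : ℝ)) := by
  classical
  obtain ⟨c₁, hc₁, -, hc⟩ := exists_le_seminorm_int hN'
  obtain ⟨G, C, D, hC, hD, hG, hD'⟩ := exists_isPairKernel hr hn hN' c₁⁻¹
  obtain ⟨S, hS, hS'⟩ := exists_tsum_weight_rpow_le hn hN'
  refine ⟨4 * C * D * S, by positivity, fun T hT X hX Q hQ B hB hBX => ?_⟩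
  choose! f g w hf hg hw hq hq' h₁ h₂ using hBX
  -- A nonzero integer block of v has norm at least c₁, hence |γ| ≤ c₁⁻¹ e^T.
  have hrange : ∀ (γ : ℤ) (v : Idx n → ℤ), γ ≠ 0 → v ≠ 0 → γ • v ∈ Q →
      InRange c₁⁻¹ T γ.natAbs := by
    intro γ v hγ hv hγv
    refine ⟨Int.natAbs_pos.2 hγ, ?_⟩
    obtain ⟨⟨j, t⟩, ht⟩ := exists_ne_zero_of_ne_zero hv
    have h3 := (hQ _ hγv).2 j
    rw [block_intToReal_smul, map_smul_eq_mul, Real.norm_eq_abs, abs_eq_natAbs] at h3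
    have h4 : c₁ ≤ N' j (block j (intToReal v)) :=
      hc j (fun t => v ⟨j, t⟩) fun h0 => ht (congrFun h0 t)
    rw [inv_mul_eq_div, le_div_iff₀ hc₁]
    exact le_trans (by gcongr) h3
  let H : ℤ × ℤ × (Idx n → ℤ) → ℝ≥0∞ := fun x =>
    ENNReal.ofReal (C * (X ^ (1 / 2 : ℝ) * weight N' x.2.2 ^ (-(3 / 2) : ℝ))) *
      (if InRange c₁⁻¹ T x.1.natAbs ∧ InRange c₁⁻¹ T x.2.1.natAbs then
        G x.1.natAbs x.2.1.natAbs else 0)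
  let F : B → ℤ × ℤ × (Idx n → ℤ) := fun p => (f p, g p, w p)
  have hF : Function.Injective F := by
    rintro ⟨p, hp⟩ ⟨p', hp'⟩ h
    simp only [F, Prod.mk.injEq] at h
    ext1
    refine Prod.ext ?_ ?_
    · rw [hq p hp, hq p' hp', h.1, h.2.2]
    · rw [hq' p hp, hq' p' hp', h.2.1, h.2.2]
  calc _ = ∑' p : B, ENNReal.ofReal ((weight N' p.1.1)⁻¹ * (weight N' p.1.2)⁻¹) := by
        rw [tsum_fintype]; exact (Finset.sum_coe_sort B fun p =>
          ENNReal.ofReal ((weight N' p.1)⁻¹ * (weight N' p.2)⁻¹)).symm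
    _ ≤ ∑' p : B, H (F p) := by
        refine ENNReal.tsum_le_tsum fun ⟨p, hp⟩ => ?_
        have hpQ := Finset.mem_product.1 (hB hp)
        have e1 := h₁ p hp
        have e2 := h₂ p hp
        have hk := hG X (f p) (g p) (w p) hX (hf p hp) (hg p hp) (hw p hp)
          (by rw [← hq p hp]; exact e1) (by rw [← hq' p hp]; exact e2)
        rw [← hq p hp, ← hq' p hp] at hk
        simp only [H, F]
        rw [if_pos ⟨hrange _ _ (hf p hp) (hw p hp) (hq p hp ▸ hpQ.1),
          hrange _ _ (hg p hp) (hw p hp) (hq' p hp ▸ hpQ.2)⟩]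
        exact hk
    _ ≤ ∑' x, H x := ENNReal.tsum_comp_le_tsum_of_injective hF H
    _ = (∑' α : ℤ, ∑' β : ℤ, (if InRange c₁⁻¹ T α.natAbs ∧ InRange c₁⁻¹ T β.natAbs then
          G α.natAbs β.natAbs else 0)) *
        (ENNReal.ofReal (C * X ^ (1 / 2 : ℝ)) *
          ∑' w : Idx n → ℤ, ENNReal.ofReal (weight N' w ^ (-(3 / 2) : ℝ))) := by
        rw [ENNReal.tsum_prod', ← ENNReal.tsum_mul_right]
        refine tsum_congr fun α => ?_
        rw [ENNReal.tsum_prod', ← ENNReal.tsum_mul_right]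
        refine tsum_congr fun β => ?_
        simp only [H]
        rw [ENNReal.tsum_mul_right, mul_comm]
        congr 1
        rw [← ENNReal.tsum_mul_left]
        refine tsum_congr fun w => ?_
        rw [← ENNReal.ofReal_mul (by positivity), mul_assoc]
    _ ≤ (2 * (2 * ENNReal.ofReal (D * T ^ (2 * r - 1)))) *
        (ENNReal.ofReal (C * X ^ (1 / 2 : ℝ)) * ENNReal.ofReal S) := by
        gcongr
        calc _ ≤ ∑' α : ℤ, 2 * ∑' b : ℕ, (if InRange c₁⁻¹ T α.natAbs ∧ InRange c₁⁻¹ T b then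
              G α.natAbs b else 0) := ENNReal.tsum_le_tsum fun α => tsum_int_natAbs_le (fun b =>
                if InRange c₁⁻¹ T α.natAbs ∧ InRange c₁⁻¹ T b then G α.natAbs b else 0)
          _ ≤ 2 * (2 * ∑' a : ℕ, ∑' b : ℕ, (if InRange c₁⁻¹ T a ∧ InRange c₁⁻¹ T b then
              G a b else 0)) := by
              rw [ENNReal.tsum_mul_left]
              gcongr
              exact tsum_int_natAbs_le (fun a => ∑' b : ℕ,
                (if InRange c₁⁻¹ T a ∧ InRange c₁⁻¹ T b then G a b else 0))
          _ ≤ _ := by gcongr; exact hD' T hT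
    _ = _ := by
        have h4 : (2 : ℝ≥0∞) = ENNReal.ofReal 2 := by simp
        rw [h4, ← ENNReal.ofReal_mul (by norm_num), ← ENNReal.ofReal_mul (by norm_num),
          ← ENNReal.ofReal_mul (by positivity), ← ENNReal.ofReal_mul (by positivity)]
        congr 1; ring

end PairSums

/-! ### Parallel integer vectors -/

section Parallel

/-- Two parallel nonzero integer vectors are coprime multiples of a third one. -/
lemma exists_coprime_smul {ι : Type} {q q' : ι → ℤ} (hq : q ≠ 0) (hq' : q' ≠ 0)
    (h : ∀ j l, q j * q' l - q l * q' j = 0) :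
    ∃ (α β : ℤ) (w : ι → ℤ), α ≠ 0 ∧ β ≠ 0 ∧ w ≠ 0 ∧ IsCoprime α β ∧ q = α • w ∧ q' = β • w := by
  obtain ⟨j, hj⟩ := exists_ne_zero_of_ne_zero hq
  have hg0 : (Int.gcd (q j) (q' j) : ℤ) ≠ 0 := by
    simp [hj]
  set g : ℤ := (Int.gcd (q j) (q' j) : ℤ)
  obtain ⟨α, hα⟩ : g ∣ q j := Int.gcd_dvd_left ..
  obtain ⟨β, hβ⟩ : g ∣ q' j := Int.gcd_dvd_right ..
  have hα0 : α ≠ 0 := fun h0 => hj (by rw [hα, h0, mul_zero])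
  have hcop : IsCoprime α β := by
    have hb := Int.gcd_eq_gcd_ab (q j) (q' j)
    refine ⟨Int.gcdA (q j) (q' j), Int.gcdB (q j) (q' j), mul_left_cancel₀ hg0 ?_⟩
    calc g * (Int.gcdA (q j) (q' j) * α + Int.gcdB (q j) (q' j) * β)
        = g * α * Int.gcdA (q j) (q' j) + g * β * Int.gcdB (q j) (q' j) := by ring
      _ = q j * Int.gcdA (q j) (q' j) + q' j * Int.gcdB (q j) (q' j) := by rw [← hα, ← hβ]
      _ = g := hb.symm
      _ = g * 1 := (mul_one g).symm
  have hl : ∀ l, α * q' l = β * q l := fun l => by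
    have h1 := h j l
    rw [hα, hβ] at h1
    refine mul_left_cancel₀ hg0 ?_
    linear_combination h1
  have hdvd : ∀ l, α ∣ q l := fun l => hcop.dvd_of_dvd_mul_left (Dvd.intro _ (hl l))
  choose w hw using hdvd
  have hw' : ∀ l, q' l = β * w l := fun l => by
    refine mul_left_cancel₀ hα0 ?_
    rw [hl l, hw l]; ring
  have hqw : q = α • w := funext hw
  have hqw' : q' = β • w := funext hw'
  refine ⟨α, β, w, hα0, ?_, ?_, hcop, hqw, hqw'⟩
  · rintro rfl; exact hq' (by rw [hqw', zero_smul])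
  · rintro rfl; exact hq (by rw [hqw, smul_zero])

/-- Two vectors that are small multiples of a third one. -/
def IsNear {ι : Type} (L : ℝ) (q q' : ι → ℤ) : Prop :=
  ∃ (α β : ℤ) (w : ι → ℤ), α ≠ 0 ∧ q = α • w ∧ q' = β • w ∧ |(α : ℝ)| ≤ L ∧ |(β : ℝ)| ≤ L

open Classical in
-- Once q is fixed, α determines w = q/α and then β determines q', so it suffices to count pairs (α,
-- β) of size at most L.
lemma card_isNear_le {ι : Type} {L : ℝ} (hL : 0 ≤ L) (q : ι → ℤ) (Q : Finset (ι → ℤ)) :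
    ((Q.filter fun q' => IsNear L q q').card : ℝ) ≤ (2 * L + 1) ^ 2 := by
  set M : ℕ := ⌊L⌋₊
  set I : Finset ℤ := Finset.Icc (-(M : ℤ)) M
  have hI : ∀ γ : ℤ, |(γ : ℝ)| ≤ L → γ ∈ I := by
    intro γ hγ
    have h1 : γ.natAbs ≤ M := Nat.le_floor (by rwa [abs_eq_natAbs] at hγ)
    rw [Finset.mem_Icc]; lia
  have hnear : ∀ q' ∈ Q.filter fun q' => IsNear L q q', IsNear L q q' :=
    fun q' hq' => (Finset.mem_filter.1 hq').2
  choose! α β w hα hq hq' hαL hβL using hnear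
  have hcard : (Q.filter fun q' => IsNear L q q').card ≤ (I ×ˢ I).card := by
    refine Finset.card_le_card_of_injOn (fun q' => (α q', β q')) (fun q' h => ?_) ?_
    · exact Finset.mem_product.2 ⟨hI _ (hαL q' h), hI _ (hβL q' h)⟩
    · intro q₁ h₁ q₂ h₂ h
      simp only [Prod.mk.injEq] at h
      have h3 : w q₁ = w q₂ := by
        have h4 : α q₁ • w q₁ = α q₁ • w q₂ := by
          rw [← hq q₁ h₁, h.1, ← hq q₂ h₂]
        exact smul_right_injective _ (hα q₁ h₁) h4
      rw [hq' q₁ h₁, hq' q₂ h₂, h.2, h3]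
  have hM : (M : ℝ) ≤ L := Nat.floor_le hL
  have hIc : I.card = 2 * M + 1 := by
    rw [Int.card_Icc]; lia
  calc ((Q.filter fun q' => IsNear L q q').card : ℝ) ≤ ((I ×ˢ I).card : ℝ) := by
        exact_mod_cast hcard
    _ = (2 * M + 1) ^ 2 := by rw [Finset.card_product, hIc]; push_cast; ring
    _ ≤ _ := by gcongr

end Parallel

/-! ### Second moment of the truncated count -/

section SecondMoment

variable {k r : ℕ} {m : Fin k → ℕ} {n : Fin r → ℕ} {N : ∀ i, Seminorm ℝ (Fin (m i) → ℝ)}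
  {N' : ∀ j, Seminorm ℝ (Fin (n j) → ℝ)} {η : Fin k → ℝ} {ε : ℝ}

open Classical in
-- Four cases: non-parallel vectors are uncorrelated; for q = αw, q' = βw with α, β coprime, either
-- both multipliers are at most L (trivial bound), or one dominates K L times the other vector's
-- weight (nearly sharp bound), or the pair is comparable with parameter KL and some multiplier
-- exceeds L (bound up to a constant).
lemma exists_lintegral_goodCount_mul_le (N : ∀ i, Seminorm ℝ (Fin (m i) → ℝ))
    (N' : ∀ j, Seminorm ℝ (Fin (n j) → ℝ)) (η : Fin k → ℝ) (ε : ℝ)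
    (hN : ∀ i x, N i x = 0 → x = 0) {P : ℕ} (hP : 1 ≤ P) :
    ∃ C : ℝ, 0 ≤ C ∧ ∀ (L K : ℝ), 0 < K → ∀ (a : Idx m → ℝ) (c : Idx m → ℤ),
      (P : ℝ) • a = intToReal c → ∀ (b : Idx m → Idx n → ℝ) (q q' : Idx n → ℤ), q ≠ 0 → q' ≠ 0 →
      ∫⁻ x, goodCount N N' η ε P c L q (a + rowMul (fun _ => q) x) *
        goodCount N N' η ε P c L q' (a + rowMul (fun _ => q') x) ∂boxMeasure₂ b ≤
      ENNReal.ofReal ((1 + C / K) ^ (2 * ∑ i, m i)) *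
        (volume (region N η ε (weight N' q)) * volume (region N η ε (weight N' q'))) +
      ((if IsNear L q q' then ENNReal.ofReal C * volume (region N η ε (weight N' q)) else 0) +
        if IsComparable N' (K * L) q q' then ENNReal.ofReal C *
          (volume (region N η ε (weight N' q)) * volume (region N η ε (weight N' q'))) else 0) := by
  obtain ⟨C₁, hC₁, h₁⟩ := exists_lintegral_goodCount_mul_sharp (n := n) (N' := N') (η := η)
    (ε := ε) N
  obtain ⟨C₂, hC₂, h₂⟩ := exists_lintegral_goodCount_mul_crude (n := n) (N' := N') (η := η)
    (ε := ε) hN hP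
  obtain ⟨C₃, hC₃, h₃⟩ := exists_lintegral_goodCount_mul_near (n := n) (N' := N') (η := η)
    (ε := ε) hN
  refine ⟨C₁ + C₂ + C₃, by positivity, fun L K hK a c ha b q q' hq hq' => ?_⟩
  by_cases hpar : ∃ j l, q j * q' l - q l * q' j ≠ 0
  · refine (lintegral_goodCount_mul_le hpar a b).trans (le_add_right ?_)
    refine le_mul_of_one_le_left' ?_
    rw [ENNReal.one_le_ofReal]
    exact one_le_pow₀ (le_add_of_nonneg_right (by positivity))
  push Not at hpar
  obtain ⟨α, β, w, hα, hβ, hw, hαβ, rfl, rfl⟩ := exists_coprime_smul hq hq' hpar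
  by_cases hnear : |(α : ℝ)| ≤ L ∧ |(β : ℝ)| ≤ L
  · refine le_add_left (le_add_right ?_)
    rw [if_pos ⟨α, β, w, hα, rfl, rfl, hnear⟩]
    refine (h₃ P c L _ _ hq a b).trans ?_
    gcongr
    linarith
  by_cases hs : K * L * weight N' (α • w) ≤ |(β : ℝ)| ∨ K * L * weight N' (β • w) ≤ |(α : ℝ)|
  · refine le_add_right ((h₁ P c L K hK α β hα hβ hαβ w hw hs a b).trans ?_)
    gcongr
    linarith
  · push Not at hs
    refine le_add_left (le_add_left ?_)
    rw [if_pos ⟨α, β, w, hα, hβ, hw, rfl, rfl, hs.1, hs.2⟩]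
    rw [not_and_or, not_le, not_le] at hnear
    refine (h₂ c L α β hα hβ hαβ w hw hnear a b ha).trans ?_
    gcongr
    linarith

variable (hk : 1 ≤ k) (hr : 1 ≤ r) (hm : ∀ i, 1 ≤ m i) (hn : ∀ j, 1 ≤ n j)
  (hN : ∀ i x, N i x = 0 → x = 0) (hN' : ∀ j y, N' j y = 0 → y = 0)
  (hη : ∀ i, 0 < η i) (hε : 0 < ε)
include hk hr hm hn hN hN' hη hε

lemma exists_sum_volume_region_le :
    ∃ C : ℝ, 0 ≤ C ∧ ∀ T : ℝ, 1 ≤ T → ∀ Q, IsBoundedBy N' T Q →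
      ∑ q ∈ Q, volume (region N η ε (weight N' q)) ≤ ENNReal.ofReal (C * T ^ (k + r - 1)) := by
  obtain ⟨C₁, hC₁, h₁⟩ := exists_volume_region_weight_le (N' := N') hk hm hN hη hε
  obtain ⟨C₂, hC₂, h₂⟩ := exists_sum_inv_weight_le hn hN'
  refine ⟨C₁ * C₂, by positivity, fun T hT Q hQ => ?_⟩
  calc _ ≤ ∑ q ∈ Q, ENNReal.ofReal (C₁ * T ^ (k - 1)) * ENNReal.ofReal (weight N' q)⁻¹ := by
        refine Finset.sum_le_sum fun q hq => ?_
        rw [← ENNReal.ofReal_mul (by positivity)]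
        exact h₁ T hT q (hQ q hq).2
    _ ≤ ENNReal.ofReal (C₁ * T ^ (k - 1)) * ENNReal.ofReal (C₂ * T ^ r) := by
        rw [← Finset.mul_sum]
        gcongr
        exact h₂ T hT Q hQ
    _ = _ := by
        rw [← ENNReal.ofReal_mul (by positivity), mul_mul_mul_comm, ← pow_add]
        congr 4; lia

/-- The second moment of the truncated counting function. -/
lemma exists_lintegral_sum_goodCount_sq_le {P : ℕ} (hP : 1 ≤ P) :
    ∃ C : ℝ, 0 ≤ C ∧ ∀ T : ℝ, 1 ≤ T → ∀ (L K : ℝ), 1 ≤ L → 1 ≤ K → ∀ Q, IsBoundedBy N' T Q →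
      ∀ (a : Idx m → ℝ) (c : Idx m → ℤ), (P : ℝ) • a = intToReal c →
      ∀ (b : Idx m → Idx n → ℝ),
      ∫⁻ x, (∑ q ∈ Q, goodCount N N' η ε P c L q (a + rowMul (fun _ => q) x)) ^ 2
        ∂boxMeasure₂ b ≤
      ENNReal.ofReal ((1 + C / K) ^ (2 * ∑ i, m i)) *
        (∑ q ∈ Q, volume (region N η ε (weight N' q))) ^ 2 +
      ENNReal.ofReal (C * (L ^ 2 * T ^ (k + r - 1) +
        T ^ (2 * (k + r - 1) - 1) * (K * L) ^ (1 / 2 : ℝ))) := by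
  classical
  obtain ⟨C₁, hC₁, h₁⟩ := exists_lintegral_goodCount_mul_le N N' η ε hN hP
  obtain ⟨C₂, hC₂, h₂⟩ := exists_sum_volume_region_le hk hr hm hn hN hN' hη hε
  obtain ⟨C₃, hC₃, h₃⟩ := exists_sum_comparable_le hr hn hN'
  obtain ⟨C₄, hC₄, h₄⟩ := exists_volume_region_weight_le (N' := N') hk hm hN hη hε
  refine ⟨C₁ + 9 * C₁ * C₂ + C₁ * C₄ ^ 2 * C₃, by positivity,
    fun T hT L K hL hK Q hQ a c ha b => ?_⟩
  set v : (Idx n → ℤ) → ℝ≥0∞ := fun q => volume (region N η ε (weight N' q)) with hv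
  set g : (Idx n → ℤ) → (Idx m → Idx n → ℝ) → ℝ≥0∞ := fun q x =>
    goodCount N N' η ε P c L q (a + rowMul (fun _ => q) x) with hg
  have hgm : ∀ q, Measurable (g q) := fun q =>
    (measurable_goodCount P c L q).comp (measurable_const.add (measurable_rowMul _))
  set S : ℝ≥0∞ := ENNReal.ofReal ((1 + C₁ / K) ^ (2 * ∑ i, m i)) with hS
  have hKL : 1 ≤ K * L := one_le_mul_of_one_le_of_one_le hK hL
  have hnear : ∑ p ∈ Q ×ˢ Q, (if IsNear L p.1 p.2 then ENNReal.ofReal C₁ * v p.1 else 0) ≤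
      ENNReal.ofReal (9 * C₁ * C₂ * (L ^ 2 * T ^ (k + r - 1))) := by
    rw [Finset.sum_product]
    calc _ ≤ ∑ q ∈ Q, ENNReal.ofReal (9 * L ^ 2 * C₁) * v q := by
          refine Finset.sum_le_sum fun q _ => ?_
          simp only
          rw [← Finset.sum_filter, Finset.sum_const, nsmul_eq_mul, ← mul_assoc,
            ← ENNReal.ofReal_natCast, ← ENNReal.ofReal_mul (by positivity)]
          gcongr
          refine (card_isNear_le (by linarith) q Q).trans ?_
          nlinarith
      _ ≤ ENNReal.ofReal (9 * L ^ 2 * C₁) * ENNReal.ofReal (C₂ * T ^ (k + r - 1)) := by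
          rw [← Finset.mul_sum]
          gcongr
          exact h₂ T hT Q hQ
      _ = _ := by
          rw [← ENNReal.ofReal_mul (by positivity)]
          congr 1; ring
  have hcomp : ∑ p ∈ Q ×ˢ Q, (if IsComparable N' (K * L) p.1 p.2 then
      ENNReal.ofReal C₁ * (v p.1 * v p.2) else 0) ≤
      ENNReal.ofReal (C₁ * C₄ ^ 2 * C₃ *
        (T ^ (2 * (k + r - 1) - 1) * (K * L) ^ (1 / 2 : ℝ))) := by
    rw [← Finset.sum_filter]
    calc _ ≤ ∑ p ∈ (Q ×ˢ Q).filter (fun p => IsComparable N' (K * L) p.1 p.2),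
          ENNReal.ofReal (C₁ * C₄ ^ 2 * T ^ (2 * (k - 1))) *
            ENNReal.ofReal ((weight N' p.1)⁻¹ * (weight N' p.2)⁻¹) := by
          refine Finset.sum_le_sum fun p hp => ?_
          have hpQ := Finset.mem_product.1 (Finset.mem_filter.1 hp).1
          have hw1 := weight_pos N' p.1
          have hw2 := weight_pos N' p.2
          refine (mul_le_mul' le_rfl (mul_le_mul' (h₄ T hT p.1 (hQ _ hpQ.1).2)
            (h₄ T hT p.2 (hQ _ hpQ.2).2))).trans_eq ?_
          rw [← ENNReal.ofReal_mul (by positivity), ← ENNReal.ofReal_mul (by positivity),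
            ← ENNReal.ofReal_mul (by positivity), mul_comm 2 (k - 1), pow_mul]
          congr 1; ring
      _ ≤ ENNReal.ofReal (C₁ * C₄ ^ 2 * T ^ (2 * (k - 1))) *
          ENNReal.ofReal (C₃ * T ^ (2 * r - 1) * (K * L) ^ (1 / 2 : ℝ)) := by
          rw [← Finset.mul_sum]
          gcongr
          exact h₃ T hT (K * L) hKL Q hQ _ (Finset.filter_subset _ _)
            fun p hp => (Finset.mem_filter.1 hp).2
      _ = _ := by
          rw [← ENNReal.ofReal_mul (by positivity)]
          have : T ^ (2 * (k + r - 1) - 1) = T ^ (2 * (k - 1)) * T ^ (2 * r - 1) := by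
            rw [← pow_add]; congr 1; lia
          rw [this]
          congr 1; ring
  calc ∫⁻ x, (∑ q ∈ Q, g q x) ^ 2 ∂boxMeasure₂ b
      = ∑ p ∈ Q ×ˢ Q, ∫⁻ x, g p.1 x * g p.2 x ∂boxMeasure₂ b := by
        rw [← lintegral_finsetSum _ fun p _ => (hgm p.1).mul (hgm p.2)]
        refine lintegral_congr fun x => ?_
        rw [pow_two, Finset.sum_mul_sum, Finset.sum_product]
    _ ≤ ∑ p ∈ Q ×ˢ Q, (S * (v p.1 * v p.2) +
          ((if IsNear L p.1 p.2 then ENNReal.ofReal C₁ * v p.1 else 0) +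
          if IsComparable N' (K * L) p.1 p.2 then
            ENNReal.ofReal C₁ * (v p.1 * v p.2) else 0)) := by
        refine Finset.sum_le_sum fun p hp => ?_
        have hpQ := Finset.mem_product.1 hp
        exact h₁ L K (by linarith) a c ha b p.1 p.2 (hQ _ hpQ.1).1 (hQ _ hpQ.2).1
    _ ≤ S * (∑ q ∈ Q, v q) ^ 2 + (ENNReal.ofReal (9 * C₁ * C₂ * (L ^ 2 * T ^ (k + r - 1))) +
          ENNReal.ofReal (C₁ * C₄ ^ 2 * C₃ *
            (T ^ (2 * (k + r - 1) - 1) * (K * L) ^ (1 / 2 : ℝ)))) := by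
        rw [Finset.sum_add_distrib, Finset.sum_add_distrib, ← Finset.mul_sum, pow_two,
          Finset.sum_mul_sum, ← Finset.sum_product Q Q fun p => v p.1 * v p.2]
        gcongr
    _ ≤ _ := by
        rw [← ENNReal.ofReal_add (by positivity) (by positivity), hS]
        have hA : 0 ≤ L ^ 2 * T ^ (k + r - 1) := by positivity
        have hB : 0 ≤ T ^ (2 * (k + r - 1) - 1) * (K * L) ^ (1 / 2 : ℝ) := by positivity
        have hC12 : 0 ≤ C₁ * C₂ := by positivity
        have hC143 : 0 ≤ C₁ * C₄ ^ 2 * C₃ := by positivity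
        gcongr
        · linarith
        · rw [mul_add]
          exact add_le_add (mul_le_mul_of_nonneg_right (by linarith) hA)
            (mul_le_mul_of_nonneg_right (by linarith) hB)

end SecondMoment

/-! ### A one-sided Chebyshev inequality -/

section Chebyshev

variable {Ω : Type*} [MeasurableSpace Ω] {μ : Measure Ω} [IsProbabilityMeasure μ]

/-- This is (y - M)² ≥ t² on y ≥ M + t, expanded so that no subtraction of extended nonnegative
numbers occurs. -/
lemma two_mul_add_sq_le {M t : ℝ} (hM : 0 ≤ M) (ht : 0 ≤ t) (y : ℝ≥0∞) :
    ENNReal.ofReal (2 * M) * y +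
      (if ENNReal.ofReal (M + t) ≤ y then ENNReal.ofReal (t ^ 2) else 0) ≤
      y ^ 2 + ENNReal.ofReal (M ^ 2) := by
  induction y with
  | top => simp
  | coe y =>
    have hy : (y : ℝ≥0∞) = ENNReal.ofReal y := (ENNReal.ofReal_coe_nnreal).symm
    have hy0 : (0 : ℝ) ≤ y := y.2
    rw [hy, ← ENNReal.ofReal_mul (by positivity), ← ENNReal.ofReal_pow hy0,
      ← ENNReal.ofReal_add (by positivity) (by positivity)]
    split_ifs with h
    · rw [ENNReal.ofReal_le_ofReal_iff hy0] at h
      rw [← ENNReal.ofReal_add (by positivity) (by positivity)]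
      refine ENNReal.ofReal_le_ofReal ?_
      nlinarith
    · rw [add_zero]
      refine ENNReal.ofReal_le_ofReal ?_
      nlinarith [sq_nonneg ((y : ℝ) - M)]

/-- A one-sided Chebyshev inequality for a function with a truncation. -/
lemma measure_gt_le_of_truncation {F G D : Ω → ℝ≥0∞} (hG : Measurable G) (hD : Measurable D)
    (hF : ∀ x, F x ≤ G x + D x) {M δ σ t : ℝ} (hM : 0 ≤ M) (hδ : 0 ≤ δ) (hσ : 0 ≤ σ) (ht : 0 < t)
    (h₁ : ENNReal.ofReal M ≤ ∫⁻ x, F x ∂μ) (h₂ : ∫⁻ x, D x ∂μ ≤ ENNReal.ofReal δ)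
    (h₃ : ∫⁻ x, G x ^ 2 ∂μ ≤ ENNReal.ofReal (M ^ 2 + σ)) :
    μ {x | ENNReal.ofReal (M + 2 * t) < F x} ≤
      ENNReal.ofReal (δ / t + (σ + 2 * M * δ) / t ^ 2) := by
  -- An excess of 2t in F forces an excess of t in G or a value of at least t in D.
  have hsub : {x | ENNReal.ofReal (M + 2 * t) < F x} ⊆
      {x | ENNReal.ofReal t ≤ D x} ∪ {x | ENNReal.ofReal (M + t) ≤ G x} := by
    intro x hx
    by_contra h
    simp only [Set.mem_union, Set.mem_ofPred_eq, not_or, not_le] at h hx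
    refine absurd hx (not_lt.2 ((hF x).trans ((add_le_add h.2.le h.1.le).trans_eq ?_)))
    rw [← ENNReal.ofReal_add (by positivity) ht.le]
    congr 1; ring
  have hDm : μ {x | ENNReal.ofReal t ≤ D x} ≤ ENNReal.ofReal (δ / t) := by
    rw [ENNReal.ofReal_div_of_pos ht,
      ENNReal.le_div_iff_mul_le (Or.inl (by simpa using ht)) (Or.inl ENNReal.ofReal_ne_top),
      mul_comm]
    exact (mul_meas_ge_le_lintegral hD _).trans h₂
  have hGm : μ {x | ENNReal.ofReal (M + t) ≤ G x} ≤
      ENNReal.ofReal ((σ + 2 * M * δ) / t ^ 2) := by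
    have hS : MeasurableSet {x | ENNReal.ofReal (M + t) ≤ G x} :=
      measurableSet_le measurable_const hG
    have ht2 : 0 < t ^ 2 := by positivity
    rw [ENNReal.ofReal_div_of_pos ht2,
      ENNReal.le_div_iff_mul_le (Or.inl (by simpa using ht.ne')) (Or.inl ENNReal.ofReal_ne_top),
      mul_comm]
    have h4 : ENNReal.ofReal (2 * M) * ∫⁻ x, G x ∂μ +
        ENNReal.ofReal (t ^ 2) * μ {x | ENNReal.ofReal (M + t) ≤ G x} ≤
        ENNReal.ofReal (2 * M ^ 2 + σ) := by
      classical
      calc _ = ∫⁻ x, (ENNReal.ofReal (2 * M) * G x + (if ENNReal.ofReal (M + t) ≤ G x then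
            ENNReal.ofReal (t ^ 2) else 0)) ∂μ := by
            rw [lintegral_add_left (hG.const_mul _), lintegral_const_mul _ hG,
              ← lintegral_indicator_const hS]
            simp only [Set.indicator_apply, Set.mem_ofPred_eq]
        _ ≤ ∫⁻ x, (G x ^ 2 + ENNReal.ofReal (M ^ 2)) ∂μ :=
            lintegral_mono fun x => two_mul_add_sq_le hM ht.le _
        _ = ∫⁻ x, G x ^ 2 ∂μ + ENNReal.ofReal (M ^ 2) := by
            rw [lintegral_add_right _ measurable_const, lintegral_const, measure_univ, mul_one]
        _ ≤ ENNReal.ofReal (M ^ 2 + σ) + ENNReal.ofReal (M ^ 2) := by gcongr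
        _ = _ := by
            rw [← ENNReal.ofReal_add (by positivity) (by positivity)]
            congr 1; ring
    -- Truncation lowers the mean by at most δ; a lower bound for the mean of G is what makes the
    -- second moment usable.
    have h5 : ENNReal.ofReal (2 * M * M) ≤
        ENNReal.ofReal (2 * M) * ∫⁻ x, G x ∂μ + ENNReal.ofReal (2 * M * δ) := by
      rw [ENNReal.ofReal_mul (p := 2 * M) (q := M) (by positivity),
        ENNReal.ofReal_mul (p := 2 * M) (q := δ) (by positivity), ← mul_add]
      gcongr
      refine h₁.trans ((lintegral_mono hF).trans ?_)
      rw [lintegral_add_left hG]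
      gcongr
    have h6 : ENNReal.ofReal (2 * M * M) +
        ENNReal.ofReal (t ^ 2) * μ {x | ENNReal.ofReal (M + t) ≤ G x} ≤
        ENNReal.ofReal (2 * M * M) + ENNReal.ofReal (σ + 2 * M * δ) := by
      calc _ ≤ (ENNReal.ofReal (2 * M) * ∫⁻ x, G x ∂μ + ENNReal.ofReal (2 * M * δ)) +
            ENNReal.ofReal (t ^ 2) * μ {x | ENNReal.ofReal (M + t) ≤ G x} := by gcongr
        _ = (ENNReal.ofReal (2 * M) * ∫⁻ x, G x ∂μ +
            ENNReal.ofReal (t ^ 2) * μ {x | ENNReal.ofReal (M + t) ≤ G x}) +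
            ENNReal.ofReal (2 * M * δ) := by ring
        _ ≤ ENNReal.ofReal (2 * M ^ 2 + σ) + ENNReal.ofReal (2 * M * δ) := by gcongr
        _ = _ := by
            rw [← ENNReal.ofReal_add (by positivity) (by positivity),
              ← ENNReal.ofReal_add (by positivity) (by positivity)]
            congr 1; ring
    exact (ENNReal.add_le_add_iff_left ENNReal.ofReal_ne_top).1 h6
  calc _ ≤ μ {x | ENNReal.ofReal t ≤ D x} + μ {x | ENNReal.ofReal (M + t) ≤ G x} :=
        (measure_mono hsub).trans (measure_union_le _ _)
    _ ≤ ENNReal.ofReal (δ / t) + ENNReal.ofReal ((σ + 2 * M * δ) / t ^ 2) := add_le_add hDm hGm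
    _ = _ := (ENNReal.ofReal_add (by positivity) (by positivity)).symm

end Chebyshev

/-! ### Deviation estimate for a class -/

section Deviation

variable {k r : ℕ} {m : Fin k → ℕ} {n : Fin r → ℕ} {N : ∀ i, Seminorm ℝ (Fin (m i) → ℝ)}
  {N' : ∀ j, Seminorm ℝ (Fin (n j) → ℝ)} {η : Fin k → ℝ} {ε : ℝ}

/-- The convex function on the left lies below its chord on [0, 1]. It shows that the distortion
factor (1 + C/L)^s exceeds 1 by only O(1/L). -/
lemma one_add_pow_le {x : ℝ} (hx : 0 ≤ x) (hx1 : x ≤ 1) {B : ℝ} (hB : 0 ≤ B) (s : ℕ) :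
    (1 + B * x) ^ s ≤ 1 + ((1 + B) ^ s - 1) * x := by
  induction s with
  | zero => simp
  | succ s ih =>
    have h1 : 1 ≤ (1 + B) ^ s := one_le_pow₀ (by linarith)
    have h2 : ((1 + B) ^ s - 1) * B * (x * x) ≤ ((1 + B) ^ s - 1) * B * x := by
      have : 0 ≤ (1 + B) ^ s - 1 := by linarith
      gcongr
      nlinarith
    calc (1 + B * x) ^ (s + 1) = (1 + B * x) ^ s * (1 + B * x) := pow_succ _ _
      _ ≤ (1 + ((1 + B) ^ s - 1) * x) * (1 + B * x) := by gcongr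
      _ = 1 + ((1 + B) ^ s - 1) * x + B * x + ((1 + B) ^ s - 1) * B * (x * x) := by ring
      _ ≤ 1 + ((1 + B) ^ s - 1) * x + B * x + ((1 + B) ^ s - 1) * B * x := by gcongr
      _ = _ := by rw [pow_succ]; ring

lemma measurable_badCount (P : ℕ) (c : Idx m → ℤ) (L : ℝ) (q : Idx n → ℤ) :
    Measurable (badCount N N' η ε P c L q) := by
  unfold badCount
  refine (Finset.measurable_sum _ fun i _ => measurable_perCount
    ((measurableSet_region _).inter
      (measurableSet_le (measurable_seminorm_block i) measurable_const))).add
    (Finset.measurable_sum _ fun i _ => Measurable.tsum fun e => ?_)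
  split_ifs
  · exact measurable_divCount (measurableSet_region _) P c e i
  · exact measurable_const

variable (hk : 1 ≤ k) (hr : 1 ≤ r) (hm : ∀ i, 1 ≤ m i) (hn : ∀ j, 1 ≤ n j)
  (hN : ∀ i x, N i x = 0 → x = 0) (hN' : ∀ j y, N' j y = 0 → y = 0)
  (hη : ∀ i, 0 < η i) (hε : 0 < ε)
include hk hr hm hn hN hN' hη hε

/-- The counting function rarely exceeds its mean by much. -/
lemma exists_measure_gt_le {P : ℕ} (hP : 1 ≤ P) {κ : ℝ} (hκ : 0 < κ) :
    ∃ C : ℝ, 0 ≤ C ∧ ∀ T : ℝ, 1 ≤ T → ∀ Q, IsBoundedBy N' T Q →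
      ∀ (a : Idx m → ℝ) (c : Idx m → ℤ), (P : ℝ) • a = intToReal c →
      ∀ (b : Idx m → Idx n → ℝ) (M : ℝ), 0 ≤ M →
      ∑ q ∈ Q, volume (region N η ε (weight N' q)) = ENNReal.ofReal M →
      boxMeasure₂ b {x | ENNReal.ofReal (M + κ * T ^ (k + r - 1)) <
        ∑ q ∈ Q, perCount (region N η ε (weight N' q)) (a + rowMul (fun _ => q) x)} ≤
      ENNReal.ofReal (C * T ^ (-(1 / 8) : ℝ)) := by
  obtain ⟨C₁, hC₁, h₁⟩ := exists_lintegral_badCount_le hk hr hm hn hN hN' hη hε hP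
  obtain ⟨C₂, hC₂, h₂⟩ := exists_lintegral_sum_goodCount_sq_le hk hr hm hn hN hN' hη hε hP
  obtain ⟨C₃, hC₃, h₃⟩ := exists_sum_volume_region_le hk hr hm hn hN hN' hη hε
  set s := 2 * ∑ i, m i with hs
  refine ⟨2 * C₁ / κ + 4 * (2 * C₂ + (1 + C₂) ^ s * C₃ ^ 2 + 2 * C₃ * C₁) / κ ^ 2,
    by positivity, fun T hT Q hQ a c ha b M hM hMQ => ?_⟩
  have hT0 : 0 < T := by linarith
  set R := k + r - 1 with hR
  have hR1 : 1 ≤ R := by lia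
  have hMC : M ≤ C₃ * T ^ R := by
    have := h₃ T hT Q hQ
    rwa [hMQ, ENNReal.ofReal_le_ofReal_iff (by positivity)] at this
  -- With K = L = T^{1/4} the loss is T^{R-1/8}, the near pairs give T^{R+1/2}, the comparable pairs
  -- T^{2R-3/4}, and the distortion of the main term T^{2R-1/4}. All are within T^{-1/8} of the
  -- normalisations T^R and T^{2R}.
  set L : ℝ := T ^ (1 / 4 : ℝ) with hL
  have hL1 : 1 ≤ L := Real.one_le_rpow hT (by norm_num)
  set E : ℝ := T ^ (-(1 / 8) : ℝ) with hE
  have hE0 : 0 < E := by positivity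
  have hLE : L ^ (-(1 / 2) : ℝ) = E := by
    rw [hL, hE, ← Real.rpow_mul hT0.le]; norm_num
  have hLinv : L⁻¹ ≤ E := by
    rw [← hLE, ← Real.rpow_neg_one]
    exact Real.rpow_le_rpow_of_exponent_le hL1 (by norm_num)
  set δ : ℝ := C₁ * T ^ R * E with hδ
  set σ : ℝ := (2 * C₂ + (1 + C₂) ^ s * C₃ ^ 2) * (T ^ R) ^ 2 * E with hσ
  have hpow1 : L ^ 2 * T ^ R ≤ (T ^ R) ^ 2 * E := by
    have h4 : L ^ 2 ≤ T ^ R * E := by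
      calc L ^ 2 = T ^ (1 / 2 : ℝ) := by
            rw [hL, ← Real.rpow_natCast, ← Real.rpow_mul hT0.le]; norm_num
        _ ≤ T ^ ((1 : ℝ) + -(1 / 8)) := Real.rpow_le_rpow_of_exponent_le hT (by norm_num)
        _ = T * E := by rw [Real.rpow_add hT0, Real.rpow_one]
        _ ≤ T ^ R * E := by
            gcongr
            exact le_self_pow₀ hT (by lia)
    calc L ^ 2 * T ^ R ≤ T ^ R * E * T ^ R := by gcongr
      _ = _ := by ring
  have hpow2 : T ^ (2 * R - 1) * (L * L) ^ (1 / 2 : ℝ) ≤ (T ^ R) ^ 2 * E := by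
    have h4 : (L * L) ^ (1 / 2 : ℝ) = L := by
      rw [← Real.sqrt_eq_rpow, Real.sqrt_mul_self (by linarith)]
    have h5 : (T ^ R) ^ 2 = T ^ (2 * R - 1) * T := by
      rw [← pow_mul, ← pow_succ]; congr 1; lia
    have h6 : L ≤ T * E := by
      calc L ≤ T ^ ((1 : ℝ) + -(1 / 8)) := Real.rpow_le_rpow_of_exponent_le hT (by norm_num)
        _ = T * E := by rw [Real.rpow_add hT0, Real.rpow_one]
    rw [h4, h5, mul_assoc]
    gcongr
  have hgm : ∀ q : Idx n → ℤ, Measurable fun x : Idx m → Idx n → ℝ =>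
      a + rowMul (fun _ => q) x := fun q => measurable_const.add (measurable_rowMul _)
  have hmain := measure_gt_le_of_truncation (μ := boxMeasure₂ b)
    (F := fun x => ∑ q ∈ Q, perCount (region N η ε (weight N' q)) (a + rowMul (fun _ => q) x))
    (G := fun x => ∑ q ∈ Q, goodCount N N' η ε P c L q (a + rowMul (fun _ => q) x))
    (D := fun x => ∑ q ∈ Q, badCount N N' η ε P c L q (a + rowMul (fun _ => q) x))
    (M := M) (δ := δ) (σ := σ) (t := κ / 2 * T ^ R)
    (Finset.measurable_sum _ fun q _ => (measurable_goodCount P c L q).comp (hgm q))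
    (Finset.measurable_sum _ fun q _ => (measurable_badCount P c L q).comp (hgm q))
    (fun x => by
      rw [← Finset.sum_add_distrib]
      exact Finset.sum_le_sum fun q _ => perCount_region_le_add (by linarith) P c q _)
    hM (by positivity) (by positivity) (by positivity) ?_ ?_ ?_
  · rw [show M + κ * T ^ R = M + 2 * (κ / 2 * T ^ R) by ring]
    refine hmain.trans (ENNReal.ofReal_le_ofReal ?_)
    have h7 : σ + 2 * M * δ ≤
        (2 * C₂ + (1 + C₂) ^ s * C₃ ^ 2 + 2 * C₃ * C₁) * (T ^ R) ^ 2 * E := by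
      calc σ + 2 * M * δ ≤ σ + 2 * (C₃ * T ^ R) * δ := by gcongr
        _ = _ := by rw [hσ, hδ]; ring
    calc δ / (κ / 2 * T ^ R) + (σ + 2 * M * δ) / (κ / 2 * T ^ R) ^ 2
        ≤ δ / (κ / 2 * T ^ R) + ((2 * C₂ + (1 + C₂) ^ s * C₃ ^ 2 + 2 * C₃ * C₁) *
          (T ^ R) ^ 2 * E) / (κ / 2 * T ^ R) ^ 2 := by gcongr
      _ = _ := by rw [hδ]; field_simp; ring
  · rw [← hMQ, lintegral_finsetSum _ fun q _ =>
      measurable_perCount_rowMul (measurableSet_region _) _ _]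
    refine (Finset.sum_congr rfl fun q hq => ?_).le
    obtain ⟨t, ht⟩ := exists_ne_zero_of_ne_zero (hQ q hq).1
    rw [lintegral_perCount (measurableSet_region _) b _ fun _ => ⟨t, ht⟩]
  · refine (h₁ T hT L hL1 Q hQ a c ha b).trans_eq ?_
    rw [hLE]
  · refine (h₂ T hT L L hL1 hL1 Q hQ a c ha b).trans ?_
    rw [hMQ, ← ENNReal.ofReal_pow hM, ← ENNReal.ofReal_mul (by positivity),
      ← ENNReal.ofReal_add (by positivity) (by positivity)]
    refine ENNReal.ofReal_le_ofReal ?_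
    have h8 : (1 + C₂ / L) ^ s ≤ 1 + (1 + C₂) ^ s * E := by
      have h9 := one_add_pow_le (x := L⁻¹) (by positivity) (inv_le_one_of_one_le₀ hL1) hC₂ s
      rw [← div_eq_mul_inv] at h9
      refine h9.trans ?_
      have h10 : (1 + C₂) ^ s - 1 ≤ (1 + C₂) ^ s := by linarith
      gcongr
    calc (1 + C₂ / L) ^ s * M ^ 2 + C₂ * (L ^ 2 * T ^ R + T ^ (2 * R - 1) * (L * L) ^ (1 / 2 : ℝ))
        ≤ (1 + (1 + C₂) ^ s * E) * M ^ 2 + C₂ * ((T ^ R) ^ 2 * E + (T ^ R) ^ 2 * E) := by gcongr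
      _ = M ^ 2 + ((1 + C₂) ^ s * E * M ^ 2 + 2 * C₂ * (T ^ R) ^ 2 * E) := by ring
      _ ≤ M ^ 2 + ((1 + C₂) ^ s * E * (C₃ * T ^ R) ^ 2 + 2 * C₂ * (T ^ R) ^ 2 * E) := by gcongr
      _ = _ := by rw [hσ]; ring

end Deviation

/-! ### Almost sure upper bound in a residue class -/

section ClassCount

variable {k r : ℕ} {m : Fin k → ℕ} {n : Fin r → ℕ} {N : ∀ i, Seminorm ℝ (Fin (m i) → ℝ)}
  {N' : ∀ j, Seminorm ℝ (Fin (n j) → ℝ)} {η : Fin k → ℝ} {ε : ℝ}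

lemma finite_bounded_int (hN' : ∀ j y, N' j y = 0 → y = 0) (X : ℝ) :
    {q : Idx n → ℤ | ∀ j, N' j (block j (intToReal q)) ≤ X}.Finite := by
  choose c hc hcN using fun j => exists_norm_le_seminorm (hN' j)
  refine (Set.finite_Icc (fun b : Idx n => -⌈c b.1 * X⌉) (fun b => ⌈c b.1 * X⌉)).subset
    fun q hq => ?_
  have key : ∀ b : Idx n, |q b| ≤ ⌈c b.1 * X⌉ := by
    intro b
    have h1 : |(q b : ℝ)| ≤ c b.1 * X := by
      calc |(q b : ℝ)| ≤ ‖block b.1 (intToReal q)‖ := norm_le_pi_norm (block b.1 (intToReal q)) b.2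
        _ ≤ c b.1 * N' b.1 (block b.1 (intToReal q)) := hcN _ _
        _ ≤ c b.1 * X := by have := hc b.1; gcongr; exact hq b.1
    have h2 : ((|q b| : ℤ) : ℝ) ≤ (⌈c b.1 * X⌉ : ℝ) := by
      rw [Int.cast_abs]; exact h1.trans (Int.le_ceil _)
    exact_mod_cast h2
  exact ⟨fun b => (abs_le.1 (key b)).1, fun b => (abs_le.1 (key b)).2⟩

/-- The nonzero integer vectors of norm at most `e ^ T` in a residue class. -/
def classSet (hN' : ∀ j y, N' j y = 0 → y = 0) (P : ℕ) (c' : Idx n → ℤ) (T : ℝ) :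
    Finset (Idx n → ℤ) :=
  ((finite_bounded_int hN' (Real.exp T)).inter_of_right
    {q | q ≠ 0 ∧ ∃ u, q = c' + (P : ℤ) • u}).toFinset

lemma mem_classSet {hN' : ∀ j y, N' j y = 0 → y = 0} {P : ℕ} {c' : Idx n → ℤ} {T : ℝ}
    {q : Idx n → ℤ} : q ∈ classSet hN' P c' T ↔ (q ≠ 0 ∧ ∃ u, q = c' + (P : ℤ) • u) ∧
      ∀ j, N' j (block j (intToReal q)) ≤ Real.exp T := by
  simp [classSet]

lemma isBoundedBy_classSet (hN' : ∀ j y, N' j y = 0 → y = 0) (P : ℕ) (c' : Idx n → ℤ) (T : ℝ) :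
    IsBoundedBy N' T (classSet hN' P c' T) := fun q hq => by
  rw [mem_classSet] at hq
  exact ⟨hq.1.1, hq.2⟩

lemma classSet_mono (hN' : ∀ j y, N' j y = 0 → y = 0) (P : ℕ) (c' : Idx n → ℤ) {S T : ℝ}
    (h : S ≤ T) : classSet hN' P c' S ⊆ classSet hN' P c' T := fun q hq => by
  rw [mem_classSet] at hq ⊢
  exact ⟨hq.1, fun j => (hq.2 j).trans (Real.exp_le_exp.2 h)⟩

/-- The density of the counting function of a residue class. -/
def classDensity (N : ∀ i, Seminorm ℝ (Fin (m i) → ℝ)) (N' : ∀ j, Seminorm ℝ (Fin (n j) → ℝ))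
    (ε : ℝ) (P : ℕ) : ℝ :=
  (∏ i, (ballVol (N i)).toReal) * ε * (∏ j, ((ballVol (N' j)).toReal / P ^ n j)) *
    ((cCoeff (k + r - 1) n : ℝ) / (k + r - 1)!)

/-- The sign of the alternating coefficient is seen by writing it as a limit of iterated integrals
of nonnegative functions. -/
lemma classDensity_nonneg (hk : 1 ≤ k) (hε : 0 < ε) {P : ℕ} : 0 ≤ classDensity N N' ε P := by
  have hkr : k - 1 + r = k + r - 1 := by lia
  have hlim := tendsto_altSum (k - 1) n 0 0
  rw [hkr] at hlim
  have h : 0 ≤ (cCoeff (k + r - 1) n : ℝ) / (k + r - 1)! := by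
    refine ge_of_tendsto hlim ?_
    filter_upwards [eventually_ge_atTop 0] with T hT
    have := altSum_nonneg (k - 1) (X := fun j => n j * T + 0) (fun j => by positivity) (le_refl 0)
    positivity
  exact mul_nonneg (mul_nonneg (mul_nonneg (Finset.prod_nonneg fun i _ => ENNReal.toReal_nonneg)
    hε.le) (Finset.prod_nonneg fun j _ => by positivity)) h

variable (hk : 1 ≤ k) (hr : 1 ≤ r) (hm : ∀ i, 1 ≤ m i) (hn : ∀ j, 1 ≤ n j)
  (hN : ∀ i x, N i x = 0 → x = 0) (hN' : ∀ j y, N' j y = 0 → y = 0)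
  (hη : ∀ i, 0 < η i) (hε : 0 < ε)
include hk hr hm hn hN hη hε

/-- The first moment bound loses a factor (1 + κ')^r from the block comparisons; κ' is chosen so
small that this costs less than κ. -/
lemma eventually_sum_volume_le {P : ℕ} (hP : 1 ≤ P) (c' : Idx n → ℤ) {κ : ℝ} (hκ : 0 < κ) :
    ∀ᶠ T : ℝ in atTop, ∑ q ∈ classSet hN' P c' T, volume (region N η ε (weight N' q)) ≤
      ENNReal.ofReal ((classDensity N N' ε P + κ) * T ^ (k + r - 1)) := by
  obtain ⟨κ', hκ', hκV⟩ : ∃ κ' : ℝ, 0 < κ' ∧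
      (1 + κ') ^ r * classDensity N N' ε P < classDensity N N' ε P + κ := by
    have h1 : Tendsto (fun x : ℝ => (1 + x) ^ r * classDensity N N' ε P) (nhdsWithin 0 (Set.Ioi 0))
        (nhds ((1 + 0) ^ r * classDensity N N' ε P)) :=
      (Continuous.tendsto (by fun_prop) 0).mono_left nhdsWithin_le_nhds
    have h2 := h1.eventually_lt_const (u := classDensity N N' ε P + κ) (by
      rw [add_zero, one_pow, one_mul]; linarith)
    obtain ⟨x, hx⟩ := (h2.and self_mem_nhdsWithin).exists
    exact ⟨x, hx.2, hx.1⟩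
  obtain ⟨C, hC, h⟩ := exists_tsum_volume_region_le hk hm hN hη hε hn hN' hP c' hκ'
  have hlim := (tendsto_altSum (k - 1) n C C).const_mul ((∏ i, (ballVol (N i)).toReal) * ε *
    (∏ j, ((1 + κ') * (ballVol (N' j)).toReal / P ^ n j)))
  have hkr : k - 1 + r = k + r - 1 := by lia
  rw [hkr] at hlim
  have hval : (∏ i, (ballVol (N i)).toReal) * ε *
      (∏ j, ((1 + κ') * (ballVol (N' j)).toReal / P ^ n j)) *
      ((cCoeff (k + r - 1) n : ℝ) / (k + r - 1)!) < classDensity N N' ε P + κ := by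
    refine lt_of_eq_of_lt ?_ hκV
    simp only [classDensity, mul_div_assoc, Finset.prod_mul_distrib, Finset.prod_const,
      Finset.card_univ, Fintype.card_fin]
    ring
  filter_upwards [hlim.eventually_lt_const hval, eventually_ge_atTop 1] with T hT hT1
  have hT0 : 0 < T ^ (k + r - 1) := by positivity
  rw [← mul_div_assoc, div_lt_iff₀ hT0] at hT
  refine le_trans ?_ ((h T (by linarith)).trans (ENNReal.ofReal_le_ofReal hT.le))
  have hex : ∀ q ∈ classSet hN' P c' T, ∃ u, q = c' + (P : ℤ) • u := fun q hq =>
    (mem_classSet.1 hq).1.2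
  choose! u hu using hex
  have hinj : Function.Injective fun q : classSet hN' P c' T => u q := by
    rintro ⟨q, hq⟩ ⟨q', hq'⟩ he
    ext1
    simp only at he ⊢
    rw [hu q hq, hu q' hq', he]
  calc _ = ∑' q : classSet hN' P c' T, volume (region N η ε (weight N' q.1)) := by
        rw [tsum_fintype]
        exact (Finset.sum_coe_sort (classSet hN' P c' T) fun q =>
          volume (region N η ε (weight N' q))).symm
    _ = ∑' q : classSet hN' P c' T,
        (if ∀ j, N' j (block j (intToReal (c' + (P : ℤ) • u q))) ≤ Real.exp T then
          volume (region N η ε (weight N' (c' + (P : ℤ) • u q))) else 0) := by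
        refine tsum_congr fun ⟨q, hq⟩ => ?_
        simp only
        rw [← hu q hq, if_pos (mem_classSet.1 hq).2]
    _ ≤ _ := ENNReal.tsum_comp_le_tsum_of_injective hinj (fun u : Idx n → ℤ =>
        (if ∀ j, N' j (block j (intToReal (c' + (P : ℤ) • u))) ≤ Real.exp T then
          volume (region N η ε (weight N' (c' + (P : ℤ) • u))) else 0))

/-- Along T = τ^j the exceptional probabilities are O(τ^{-j/8}), a convergent geometric series, so
Borel–Cantelli applies. -/
lemma ae_eventually_class_le_geometric {P : ℕ} (hP : 1 ≤ P) {a : Idx m → ℝ} {c : Idx m → ℤ}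
    (ha : (P : ℝ) • a = intToReal c) (c' : Idx n → ℤ) (b : Idx m → Idx n → ℝ) {κ : ℝ}
    (hκ : 0 < κ) {τ : ℝ} (hτ : 1 < τ) :
    ∀ᵐ x ∂boxMeasure₂ b, ∀ᶠ j : ℕ in atTop, ∑ q ∈ classSet hN' P c' (τ ^ j),
      perCount (region N η ε (weight N' q)) (a + rowMul (fun _ => q) x) ≤
      ENNReal.ofReal ((classDensity N N' ε P + κ) * (τ ^ j) ^ (k + r - 1)) := by
  have hκ2 : 0 < κ / 2 := by positivity
  obtain ⟨C, hC, h⟩ := exists_measure_gt_le hk hr hm hn hN hN' hη hε hP hκ2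
  have hτj : ∀ j : ℕ, 1 ≤ τ ^ j := fun j => one_le_pow₀ hτ.le
  have hfin : ∀ j : ℕ, ∑ q ∈ classSet hN' P c' (τ ^ j), volume (region N η ε (weight N' q)) ≠ ∞ := by
    obtain ⟨C', hC', h'⟩ := exists_sum_volume_region_le (N' := N') hk hr hm hn hN hN' hη hε
    exact fun j => ((h' (τ ^ j) (hτj j) _ (isBoundedBy_classSet hN' P c' _)).trans_lt
      ENNReal.ofReal_lt_top).ne
  set M : ℕ → ℝ := fun j =>
    (∑ q ∈ classSet hN' P c' (τ ^ j), volume (region N η ε (weight N' q))).toReal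
  have hsum : ∑' j : ℕ, boxMeasure₂ b {x | ENNReal.ofReal (M j + κ / 2 * (τ ^ j) ^ (k + r - 1)) <
      ∑ q ∈ classSet hN' P c' (τ ^ j),
        perCount (region N η ε (weight N' q)) (a + rowMul (fun _ => q) x)} ≠ ∞ := by
    have hs : Summable fun j : ℕ => C * (τ ^ j) ^ (-(1 / 8) : ℝ) := by
      refine Summable.mul_left C ((summable_geometric_of_lt_one (r := τ ^ (-(1 / 8) : ℝ))
        (by positivity) (Real.rpow_lt_one_of_one_lt_of_neg hτ (by norm_num))).congr fun j => ?_)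
      rw [← Real.rpow_natCast, ← Real.rpow_natCast, ← Real.rpow_mul (by linarith),
        ← Real.rpow_mul (by linarith), mul_comm]
    refine ne_top_of_le_ne_top ?_ (ENNReal.tsum_le_tsum fun j => h (τ ^ j) (hτj j) _
      (isBoundedBy_classSet hN' P c' _) a c ha b (M j) ENNReal.toReal_nonneg
      (ENNReal.ofReal_toReal (hfin j)).symm)
    rw [← ENNReal.ofReal_tsum_of_nonneg (fun j => by positivity) hs]
    exact ENNReal.ofReal_ne_top
  filter_upwards [ae_eventually_notMem hsum] with x hx
  have hmean := (tendsto_pow_atTop_atTop_of_one_lt hτ).eventually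
    (eventually_sum_volume_le (N := N) hk hr hm hn hN hN' hη hε hP c' hκ2)
  filter_upwards [hx, hmean] with j hj hmj
  simp only [not_lt] at hj
  refine hj.trans ?_
  have hV := classDensity_nonneg (N := N) (N' := N') (P := P) hk hε
  have hM : M j ≤ (classDensity N N' ε P + κ / 2) * (τ ^ j) ^ (k + r - 1) :=
    ENNReal.toReal_le_of_le_ofReal (by positivity) hmj
  refine ENNReal.ofReal_le_ofReal ?_
  linarith

/-- The count is monotone in T: between τ^j and τ^{j+1} it is bounded by its value at τ^{j+1}, at
the cost of a factor τ^{k+r-1} as close to 1 as desired. -/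
theorem ae_eventually_class_le {P : ℕ} (hP : 1 ≤ P) {a : Idx m → ℝ} {c : Idx m → ℤ}
    (ha : (P : ℝ) • a = intToReal c) (c' : Idx n → ℤ) (b : Idx m → Idx n → ℝ) {κ : ℝ}
    (hκ : 0 < κ) :
    ∀ᵐ x ∂boxMeasure₂ b, ∀ᶠ T : ℝ in atTop, ∑ q ∈ classSet hN' P c' T,
      perCount (region N η ε (weight N' q)) (a + rowMul (fun _ => q) x) ≤
      ENNReal.ofReal ((classDensity N N' ε P + κ) * T ^ (k + r - 1)) := by
  set V := classDensity N N' ε P with hVdef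
  have hV : 0 ≤ V := classDensity_nonneg hk hε
  obtain ⟨τ, hτ, hτV⟩ : ∃ τ : ℝ, 1 < τ ∧ (V + κ / 2) * τ ^ (k + r - 1) < V + κ := by
    have h1 : Tendsto (fun x : ℝ => (V + κ / 2) * x ^ (k + r - 1)) (nhdsWithin 1 (Set.Ioi 1))
        (nhds ((V + κ / 2) * 1 ^ (k + r - 1))) :=
      (Continuous.tendsto (by fun_prop) 1).mono_left nhdsWithin_le_nhds
    have h2 := h1.eventually_lt_const (u := V + κ) (by rw [one_pow, mul_one]; linarith)
    obtain ⟨x, hx⟩ := (h2.and self_mem_nhdsWithin).exists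
    exact ⟨x, hx.2, hx.1⟩
  filter_upwards [ae_eventually_class_le_geometric (N := N) hk hr hm hn hN hN' hη hε hP ha c' b
    (half_pos hκ) hτ] with x hx
  obtain ⟨J, hJ⟩ := eventually_atTop.1 hx
  filter_upwards [eventually_ge_atTop (τ ^ J)] with T hT
  have hT1 : 1 ≤ T := (one_le_pow₀ hτ.le).trans hT
  obtain ⟨j, hj, hj'⟩ := exists_nat_pow_near hT1 hτ
  have hJj : J ≤ j + 1 := ((pow_lt_pow_iff_right₀ hτ).1 (hT.trans_lt hj')).le
  calc _ ≤ ∑ q ∈ classSet hN' P c' (τ ^ (j + 1)),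
        perCount (region N η ε (weight N' q)) (a + rowMul (fun _ => q) x) :=
        Finset.sum_le_sum_of_subset (classSet_mono hN' P c' hj'.le)
    _ ≤ _ := hJ _ hJj
    _ ≤ _ := by
        refine ENNReal.ofReal_le_ofReal ?_
        calc (V + κ / 2) * (τ ^ (j + 1)) ^ (k + r - 1)
            = (V + κ / 2) * τ ^ (k + r - 1) * (τ ^ j) ^ (k + r - 1) := by
              rw [pow_succ, mul_pow]; ring
          _ ≤ (V + κ) * T ^ (k + r - 1) := by gcongr

end ClassCount

/-! ### The number of residue classes of primitive vectors -/

section Primitive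

variable {ι : Type} [Fintype ι]

/-- The residue classes modulo `P` of primitive integer vectors. -/
def primitiveClasses (ι : Type) [Fintype ι] (P : ℕ) [NeZero P] : Finset (ι → ZMod P) :=
  (Set.toFinite {s : ι → ZMod P | ∃ v : ι → ℤ, Finset.univ.gcd v = 1 ∧ ∀ b, s b = v b}).toFinset

lemma mem_primitiveClasses {P : ℕ} [NeZero P] {s : ι → ZMod P} : s ∈ primitiveClasses ι P ↔
    ∃ v : ι → ℤ, Finset.univ.gcd v = 1 ∧ ∀ b, s b = v b := by
  simp [primitiveClasses]

/-- Reducing the congruence modulo e', a divisor of P, shows that e' divides every coordinate of e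
v, hence their gcd, which is e. -/
lemma dvd_of_primitive {P e e' : ℕ} (he' : e' ∣ P) {v v' : ι → ℤ}
    (hv : Finset.univ.gcd v = 1) (h : ∀ b, ((e * v b : ℤ) : ZMod P) = ((e' * v' b : ℤ) : ZMod P)) :
    e' ∣ e := by
  have h1 : ∀ b ∈ Finset.univ, (e' : ℤ) ∣ e * v b := by
    intro b _
    have h2 := (ZMod.intCast_eq_intCast_iff_dvd_sub _ _ _).1 (h b)
    have h3 : (e' : ℤ) ∣ e' * v' b - e * v b := (Int.natCast_dvd_natCast.2 he').trans h2
    exact (dvd_sub_right (Dvd.intro _ rfl)).1 h3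
  have h4 := Finset.dvd_gcd h1
  rw [Finset.gcd_mul_left, hv, mul_one] at h4
  rw [← Int.natCast_dvd_natCast]
  simpa using h4

/-- A fibre of multiplication by e is a subset of a coset of its kernel, and for e dividing P that
kernel consists of the multiples of P/e in each coordinate. -/
lemma card_fiber_mul_le {P e : ℕ} [NeZero P] (he : 0 < e) (heP : e ∣ P) (S : Finset (ι → ZMod P))
    (x₀ : ι → ZMod P) :
    (S.filter fun x => (e : ZMod P) • x = (e : ZMod P) • x₀).card ≤ e ^ Fintype.card ι := by
  classical
  obtain ⟨f, rfl⟩ := heP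
  have hP : 0 < e * f := Nat.pos_of_ne_zero (NeZero.ne _)
  have hf : 0 < f := Nat.pos_of_mul_pos_left hP
  have hdvd : ∀ x ∈ S.filter fun x => (e : ZMod (e * f)) • x = (e : ZMod (e * f)) • x₀,
      ∀ b, f ∣ (x b - x₀ b).val := by
    intro x hx b
    have h1 := congrFun (Finset.mem_filter.1 hx).2 b
    simp only [Pi.smul_apply, smul_eq_mul] at h1
    have h2 : ((e * (x b - x₀ b).val : ℕ) : ZMod (e * f)) = 0 := by
      push_cast
      rw [ZMod.natCast_zmod_val, mul_sub, h1, sub_self]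
    rw [ZMod.natCast_eq_zero_iff] at h2
    exact Nat.dvd_of_mul_dvd_mul_left he h2
  have hcard : (Fintype.piFinset fun _ : ι => Finset.range e).card = e ^ Fintype.card ι := by
    simp
  rw [← hcard]
  refine Finset.card_le_card_of_injOn (fun x b => (x b - x₀ b).val / f) ?_ ?_
  · intro x hx
    refine Finset.mem_coe.2 (Fintype.mem_piFinset.2 fun b => Finset.mem_range.2 ?_)
    rw [Nat.div_lt_iff_lt_mul hf]
    exact ZMod.val_lt _
  · intro x hx y hy hxy
    ext1 b
    have h1 := congrFun hxy b
    simp only at h1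
    have h2 := (Nat.div_left_inj (hdvd x hx b) (hdvd y hy b)).1 h1
    exact sub_left_injective (ZMod.val_injective _ h2)

/-- The images eS of the set S of primitive classes, for e ≤ z, are pairwise disjoint by
`dvd_of_primitive`, and each has at least |S|/e^d elements. Packing them into the P^d classes yields
the partial sums of ζ(d) without an Euler product. -/
lemma card_primitiveClasses_mul_le {P z : ℕ} [NeZero P] (hP : ∀ e, 1 ≤ e → e ≤ z → e ∣ P) :
    ((primitiveClasses ι P).card : ℝ) * ∑ e ∈ Finset.Icc 1 z, ((e : ℝ) ^ Fintype.card ι)⁻¹ ≤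
      (P : ℝ) ^ Fintype.card ι := by
  classical
  set S := primitiveClasses ι P with hS
  set I : ℕ → Finset (ι → ZMod P) := fun e => S.image fun x => (e : ZMod P) • x
  have hdisj : Set.PairwiseDisjoint (Finset.Icc 1 z : Set ℕ) I := by
    intro e he e' he' hne
    rw [Function.onFun, Finset.disjoint_left]
    intro y hy hy'
    obtain ⟨x, hx, hxy⟩ := Finset.mem_image.1 hy
    obtain ⟨x', hx', hxy'⟩ := Finset.mem_image.1 hy'
    obtain ⟨v, hv, hvx⟩ := mem_primitiveClasses.1 hx
    obtain ⟨v', hv', hvx'⟩ := mem_primitiveClasses.1 hx'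
    have hee := Finset.mem_Icc.1 he
    have hee' := Finset.mem_Icc.1 he'
    have h : ∀ b, ((e * v b : ℤ) : ZMod P) = ((e' * v' b : ℤ) : ZMod P) := by
      intro b
      have h1 := congrFun (hxy.trans hxy'.symm) b
      simp only [Pi.smul_apply, smul_eq_mul, hvx, hvx'] at h1
      push_cast
      exact h1
    exact hne (Nat.dvd_antisymm (dvd_of_primitive (hP e hee.1 hee.2) hv' fun b => (h b).symm)
      (dvd_of_primitive (hP e' hee'.1 hee'.2) hv h))
  have hcard : ∀ e ∈ Finset.Icc 1 z, (S.card : ℝ) * ((e : ℝ) ^ Fintype.card ι)⁻¹ ≤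
      ((I e).card : ℝ) := by
    intro e he
    have hee := Finset.mem_Icc.1 he
    have he0 : (0 : ℝ) < e := by exact_mod_cast hee.1
    rw [← div_eq_mul_inv, div_le_iff₀ (by positivity), mul_comm]
    have h1 : S.card ≤ e ^ Fintype.card ι * (I e).card := by
      refine Finset.card_le_mul_card_image S _ fun y hy => ?_
      obtain ⟨x₀, -, rfl⟩ := Finset.mem_image.1 hy
      exact card_fiber_mul_le hee.1 (hP e hee.1 hee.2) S x₀
    exact_mod_cast h1
  rw [Finset.mul_sum]
  calc _ ≤ ∑ e ∈ Finset.Icc 1 z, ((I e).card : ℝ) := Finset.sum_le_sum hcard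
    _ = (((Finset.Icc 1 z).biUnion I).card : ℝ) := by
        rw [Finset.card_biUnion hdisj]; push_cast; rfl
    _ ≤ (Fintype.card (ι → ZMod P) : ℝ) := by exact_mod_cast Finset.card_le_univ _
    _ = _ := by simp [ZMod.card]

end Primitive

/-! ### From cardinalities of sets to counts of translates -/

section Encard

lemma encard_biUnion_le {α β : Type*} (S : Finset α) (f : α → Set β) :
    ((⋃ i ∈ S, f i).encard : ℝ≥0∞) ≤ ∑ i ∈ S, ((f i).encard : ℝ≥0∞) := by
  classical
  induction S using Finset.induction_on with
  | empty => simp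
  | insert i S hi ih =>
    rw [Finset.set_biUnion_insert, Finset.sum_insert hi]
    refine le_trans ?_ (add_le_add_right ih _)
    rw [← ENat.toENNReal_add]
    exact ENat.toENNReal_le.2 (Set.encard_union_le _ _)

lemma perCount_eq_encard {ι : Type} (X : Set (ι → ℝ)) (y : ι → ℝ) :
    perCount X y = ({z : ι → ℤ | intToReal z + y ∈ X}.encard : ℝ≥0∞) := by
  classical
  rw [← ENNReal.tsum_set_one]
  exact (tsum_subtype {z : ι → ℤ | intToReal z + y ∈ X} fun _ => (1 : ℝ≥0∞)).symm

end Encard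

/-! ### Reduction of the primitive count to residue classes -/

section Reduction

variable {k r : ℕ} {m : Fin k → ℕ} {n : Fin r → ℕ}

/-- The multiples of the given norms by a natural number. -/
def scaleNorm (P : ℕ) (N : ∀ i, Seminorm ℝ (Fin (m i) → ℝ)) : ∀ i, Seminorm ℝ (Fin (m i) → ℝ) :=
  fun i => (P : NNReal) • N i

lemma scaleNorm_apply (P : ℕ) (N : ∀ i, Seminorm ℝ (Fin (m i) → ℝ)) (i : Fin k)
    (x : Fin (m i) → ℝ) : scaleNorm P N i x = P * N i x := rfl

variable {N : ∀ i, Seminorm ℝ (Fin (m i) → ℝ)} {N' : ∀ j, Seminorm ℝ (Fin (n j) → ℝ)}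
  {η : Fin k → ℝ} {ε : ℝ}

lemma ballVol_scaleNorm {P : ℕ} (hP : 1 ≤ P) (i : Fin k) :
    (ballVol (scaleNorm P N i)).toReal = (ballVol (N i)).toReal / P ^ m i := by
  have hP0 : (0 : ℝ) < P := by positivity
  have h : {x : Fin (m i) → ℝ | scaleNorm P N i x ≤ 1} =
      (fun x => (P : ℝ) • x) ⁻¹' {x | N i x ≤ 1} := by
    ext x
    simp [scaleNorm_apply, map_smul_eq_mul]
  unfold ballVol
  rw [h, Measure.addHaar_preimage_smul _ hP0.ne', ENNReal.toReal_mul,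
    ENNReal.toReal_ofReal (by positivity), abs_of_pos (by positivity),
    Module.finrank_fintype_fun_eq_card, Fintype.card_fin, inv_mul_eq_div]

/-- The representatives of a residue class. -/
def classRep {ι : Type} {P : ℕ} (s : ι → ZMod P) : ι → ℤ := fun b => ((s b).val : ℤ)

lemma affineValue_eq (θ : Idx m → Idx n → ℝ) (p : Idx m → ℤ) (q : Idx n → ℤ) :
    affineValue θ p q = intToReal p + rowMul (fun _ => q) θ := by
  ext b
  simp [affineValue, rowMul, intToReal, Matrix.mulVec, dotProduct, mul_comm]

/-- Primitivity is used only through the residue class it forces, so this is an upper bound that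
sharpens as P becomes more divisible. The vector q = 0 is kept apart: it does not equidistribute,
but contributes a quantity independent of θ and T. -/
lemma countApprox_le (hN' : ∀ j y, N' j y = 0 → y = 0) {P : ℕ} [NeZero P]
    (θ : Idx m → Idx n → ℝ) (T : ℝ) :
    (countApprox N N' η ε θ T : ℝ≥0∞) ≤ perCount (region N η ε (weight N' 0)) 0 +
      ∑ s ∈ primitiveClasses (Idx m ⊕ Idx n) P,
        ∑ q ∈ classSet hN' P (classRep fun b => s (Sum.inr b)) T,
          perCount (region (scaleNorm P N) η ε (weight N' q))
            ((P : ℝ)⁻¹ • intToReal (classRep fun b => s (Sum.inl b)) +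
              rowMul (fun _ => q) ((P : ℝ)⁻¹ • θ)) := by
  classical
  have hP0 : (0 : ℝ) < P := by
    have := NeZero.ne P
    positivity
  set A : Set ((Idx m → ℤ) × (Idx n → ℤ)) := {v | IsApprox N N' η ε θ v.1 v.2 ∧
    maxNorm N' (intToReal v.2) ≤ Real.exp T}
  let y : (Idx m ⊕ Idx n → ZMod P) → (Idx n → ℤ) → Idx m → ℝ := fun s q =>
    (P : ℝ)⁻¹ • intToReal (classRep fun b => s (Sum.inl b)) +
      rowMul (fun _ => q) ((P : ℝ)⁻¹ • θ)
  let B₀ : Set ((Idx m → ℤ) × (Idx n → ℤ)) :=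
    (fun z => (z, 0)) '' {z | intToReal z + 0 ∈ region N η ε (weight N' 0)}
  let B : (Idx m ⊕ Idx n → ZMod P) → (Idx n → ℤ) → Set ((Idx m → ℤ) × (Idx n → ℤ)) := fun s q =>
    (fun z => ((classRep fun b => s (Sum.inl b)) + (P : ℤ) • z, q)) ''
      {z | intToReal z + y s q ∈ region (scaleNorm P N) η ε (weight N' q)}
  have hsub : A ⊆ B₀ ∪ ⋃ s ∈ primitiveClasses (Idx m ⊕ Idx n) P,
      ⋃ q ∈ classSet hN' P (classRep fun b => s (Sum.inr b)) T, B s q := by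
    rintro ⟨p, q⟩ ⟨hpq, hqT⟩
    by_cases hq : q = 0
    · subst hq
      refine Or.inl ⟨p, ?_, rfl⟩
      have h0 : affineValue θ p (0 : Idx n → ℤ) = intToReal p + 0 := by
        rw [affineValue_eq]
        congr 1
        ext b; simp [rowMul]
      have h1 := hpq.block_le
      have h2 := hpq.prod_le
      simp only [h0] at h1 h2
      exact ⟨h1, h2⟩
    · right
      let s : Idx m ⊕ Idx n → ZMod P := fun b => ((Sum.elim p q b : ℤ) : ZMod P)
      have hmod : ∀ x : ℤ, x = (((x : ZMod P)).val : ℤ) + P * (x / P) := fun x => by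
        rw [ZMod.val_intCast]; exact (Int.emod_add_mul_ediv x P).symm
      have hs : s ∈ primitiveClasses (Idx m ⊕ Idx n) P :=
        mem_primitiveClasses.2 ⟨Sum.elim p q, hpq.gcd_eq_one, fun _ => rfl⟩
      have hqj : ∀ j, N' j (block j (intToReal q)) ≤ Real.exp T := fun j =>
        (le_ciSup (f := fun j => N' j (block j (intToReal q))) (Set.finite_range _).bddAbove
          j).trans hqT
      have hqs : q ∈ classSet hN' P (classRep fun b => s (Sum.inr b)) T :=
        mem_classSet.2 ⟨⟨hq, fun b => q b / P, funext fun b => hmod (q b)⟩, hqj⟩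
      have hp : p = (classRep fun b => s (Sum.inl b)) + (P : ℤ) • fun b => p b / (P : ℤ) :=
        funext fun b => hmod (p b)
      refine Set.mem_biUnion hs (Set.mem_biUnion hqs ⟨fun b => p b / P, ?_, ?_⟩)
      -- With p = c + Pz and x = θ/P one has p + θq = P(z + c/P + qx); the outer factor P is moved
      -- into the norms, while η and ε are unchanged.
      · have h3 : affineValue θ p q = (P : ℝ) • (intToReal (fun b => p b / (P : ℤ)) + y s q) := by
          rw [affineValue_eq]
          conv_lhs => rw [hp]
          ext b
          simp only [y, intToReal, Pi.add_apply, Pi.smul_apply, smul_eq_mul, rowMul,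
            Int.cast_add, Int.cast_mul, Int.cast_natCast, mul_left_comm _ (P : ℝ)⁻¹,
            ← Finset.mul_sum]
          field_simp
          ring
        have h4 : ∀ i, N i (block i (affineValue θ p q)) =
            scaleNorm P N i (block i (intToReal (fun b => p b / (P : ℤ)) + y s q)) := by
          intro i
          have h5 : block i (affineValue θ p q) =
              (P : ℝ) • block i (intToReal (fun b => p b / (P : ℤ)) + y s q) := by
            rw [h3]; rfl
          rw [h5, map_smul_eq_mul, scaleNorm_apply, Real.norm_eq_abs, abs_of_pos hP0]
        have h1 := hpq.block_le
        have h2 := hpq.prod_le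
        simp only [h4] at h1 h2
        exact ⟨h1, h2⟩
      · exact Prod.ext hp.symm rfl
  calc (countApprox N N' η ε θ T : ℝ≥0∞) ≤ ((B₀ ∪ ⋃ s ∈ primitiveClasses (Idx m ⊕ Idx n) P,
        ⋃ q ∈ classSet hN' P (classRep fun b => s (Sum.inr b)) T, B s q).encard : ℝ≥0∞) :=
        ENat.toENNReal_le.2 (Set.encard_le_encard hsub)
    _ ≤ (B₀.encard : ℝ≥0∞) + ((⋃ s ∈ primitiveClasses (Idx m ⊕ Idx n) P,
        ⋃ q ∈ classSet hN' P (classRep fun b => s (Sum.inr b)) T, B s q).encard : ℝ≥0∞) := by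
        rw [← ENat.toENNReal_add]
        exact ENat.toENNReal_le.2 (Set.encard_union_le _ _)
    _ ≤ _ := by
        refine add_le_add ?_ ((encard_biUnion_le _ _).trans (Finset.sum_le_sum fun s _ =>
          (encard_biUnion_le _ _).trans (Finset.sum_le_sum fun q _ => ?_)))
        · rw [perCount_eq_encard]
          exact ENat.toENNReal_le.2 (Set.encard_image_le _ _)
        · rw [perCount_eq_encard]
          exact ENat.toENNReal_le.2 (Set.encard_image_le _ _)

end Reduction

/-! ### Letting the modulus grow -/

section Final

lemma ae_of_forall_box {ι κ : Type} [Fintype ι] [Fintype κ] {p : (ι → κ → ℝ) → Prop}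
    (h : ∀ b : ι → κ → ℤ, ∀ᵐ x ∂boxMeasure₂ (fun i j => (b i j : ℝ)), p x) : ∀ᵐ x, p x := by
  have hbox : ∀ b : ι → κ → ℤ, boxMeasure₂ (fun i j => (b i j : ℝ)) =
      volume.restrict (Set.univ.pi fun i => Set.univ.pi fun j =>
        Set.Ioc (b i j : ℝ) (b i j + 1)) := by
    intro b
    unfold boxMeasure₂
    simp only [boxMeasure_eq]
    exact (Measure.restrict_pi_pi _ _).symm
  simp only [hbox] at h
  rw [← ae_restrict_iUnion_iff] at h
  have hU : (⋃ b : ι → κ → ℤ, Set.univ.pi fun i => Set.univ.pi fun j =>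
      Set.Ioc (b i j : ℝ) (b i j + 1)) = Set.univ := by
    refine Set.eq_univ_of_forall fun x => Set.mem_iUnion.2 ⟨fun i j => ⌈x i j⌉ - 1, ?_⟩
    intro i _ j _
    have h1 := Int.ceil_lt_add_one (x i j)
    have h2 := Int.le_ceil (x i j)
    simp only [Int.cast_sub, Int.cast_one, Set.mem_Ioc]
    constructor <;> linarith
  rwa [hU, Measure.restrict_univ] at h

variable {k r : ℕ} {m : Fin k → ℕ} {n : Fin r → ℕ} {N : ∀ i, Seminorm ℝ (Fin (m i) → ℝ)}
  {N' : ∀ j, Seminorm ℝ (Fin (n j) → ℝ)} {η : Fin k → ℝ} {ε : ℝ}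

lemma maxNorm_le_one_iff (x : Idx m → ℝ) : maxNorm N x ≤ 1 ↔ ∀ i, N i (block i x) ≤ 1 := by
  refine ⟨fun h i => ?_, fun h => Real.iSup_le h zero_le_one⟩
  exact (le_ciSup (f := fun i => N i (block i x)) (Set.finite_range _).bddAbove i).trans h

lemma volume_unitBall (hN : ∀ i x, N i x = 0 → x = 0) (hN' : ∀ j y, N' j y = 0 → y = 0) :
    volume (unitBall N N') = (∏ i, ballVol (N i)) * ∏ j, ballVol (N' j) := by
  have h : unitBall N N' = {y : Idx m → ℝ | ∀ i, N i (block i y) ≤ 1} ×ˢ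
      {y : Idx n → ℝ | ∀ j, N' j (block j y) ≤ 1} := by
    ext z
    simp [unitBall, maxNorm_le_one_iff]
  rw [h, Measure.volume_eq_prod, Measure.prod_prod, volume_blocks_le_one hN,
    volume_blocks_le_one hN']

/-- Multiplying the norms by P contributes P^{-∑ m_i}, and restricting q to a class contributes
P^{-∑ n_j}. -/
lemma classDensity_scaleNorm {P : ℕ} (hP : 1 ≤ P) :
    classDensity (scaleNorm P N) N' ε P =
      classDensity N N' ε 1 / (P : ℝ) ^ Fintype.card (Idx m ⊕ Idx n) := by
  have hcard : Fintype.card (Idx m ⊕ Idx n) = ∑ i, m i + ∑ j, n j := by simp [Idx]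
  have hP0 : (P : ℝ) ≠ 0 := by positivity
  simp only [classDensity, ballVol_scaleNorm hP, Finset.prod_div_distrib, hcard, pow_add,
    Finset.prod_pow_eq_pow_sum, Nat.cast_one, one_pow, div_one]
  field_simp

lemma tendsto_sum_inv_pow_zeta {d : ℕ} (hd : 2 ≤ d) :
    Tendsto (fun z : ℕ => ∑ e ∈ Finset.Icc 1 z, ((e : ℝ) ^ d)⁻¹) atTop
      (nhds (riemannZeta (d : ℂ)).re) := by
  have hs : Summable fun e : ℕ => ((e : ℝ) ^ d)⁻¹ := Real.summable_nat_pow_inv.2 (by lia)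
  have hz : (riemannZeta (d : ℂ)).re = ∑' e : ℕ, ((e : ℝ) ^ d)⁻¹ := by
    rw [zeta_nat_eq_tsum_of_gt_one (by lia)]
    have : ∑' e : ℕ, 1 / (e : ℂ) ^ d = ((∑' e : ℕ, ((e : ℝ) ^ d)⁻¹ : ℝ) : ℂ) := by
      push_cast
      simp [one_div]
    rw [this, Complex.ofReal_re]
  rw [hz]
  refine ((tendsto_add_atTop_iff_nat 1).2 hs.hasSum.tendsto_sum_nat).congr fun z => ?_
  rw [Finset.range_eq_Ico, Finset.sum_eq_sum_Ico_succ_bot (by lia)]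
  have : (((0 : ℕ) : ℝ) ^ d)⁻¹ = 0 := by
    rw [Nat.cast_zero, zero_pow (by lia), inv_zero]
  rw [this, zero_add]
  rfl

variable (hk : 1 ≤ k) (hr : 1 ≤ r) (hm : ∀ i, 1 ≤ m i) (hn : ∀ j, 1 ≤ n j)
  (hN : ∀ i x, N i x = 0 → x = 0) (hN' : ∀ j y, N' j y = 0 → y = 0)
  (hη : ∀ i, 0 < η i) (hε : 0 < ε)
include hk hr hm hn hN hN' hη hε

/-- Sum the almost sure class bounds over the finitely many primitive classes. The term of q = 0 is
bounded, hence at most κT^{k+r-1} eventually, because k + r - 1 ≥ 1. -/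
lemma ae_limsup_le {P : ℕ} [NeZero P] {κ : ℝ} (hκ : 0 < κ) :
    ∀ᵐ θ : Idx m → Idx n → ℝ,
      limsup (fun T : ℝ =>
        (countApprox N N' η ε θ T : ℝ≥0∞) / ENNReal.ofReal (T ^ (k + r - 1))) atTop ≤
      ENNReal.ofReal (κ + (primitiveClasses (Idx m ⊕ Idx n) P).card *
        (classDensity (scaleNorm P N) N' ε P + κ)) := by
  have hP : 1 ≤ P := Nat.pos_of_ne_zero (NeZero.ne P)
  have hP0 : (P : ℝ) ≠ 0 := by positivity
  set S := primitiveClasses (Idx m ⊕ Idx n) P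
  set D := classDensity (scaleNorm P N) N' ε P
  have hD : 0 ≤ D := classDensity_nonneg hk hε
  have hNP : ∀ i x, scaleNorm P N i x = 0 → x = 0 := fun i x hx => by
    rw [scaleNorm_apply] at hx
    exact hN i x ((mul_eq_zero.1 hx).resolve_left hP0)
  have hclass : ∀ᵐ x : Idx m → Idx n → ℝ, ∀ s ∈ S, ∀ᶠ T : ℝ in atTop,
      ∑ q ∈ classSet hN' P (classRep fun b => s (Sum.inr b)) T,
        perCount (region (scaleNorm P N) η ε (weight N' q))
          ((P : ℝ)⁻¹ • intToReal (classRep fun b => s (Sum.inl b)) + rowMul (fun _ => q) x) ≤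
        ENNReal.ofReal ((D + κ) * T ^ (k + r - 1)) := by
    rw [Filter.eventually_all_finset]
    intro s _
    refine ae_of_forall_box fun b => ?_
    refine ae_eventually_class_le hk hr hm hn hNP hN' hη hε hP
      (c := classRep fun b => s (Sum.inl b)) ?_ _ _ hκ
    rw [smul_smul, mul_inv_cancel₀ hP0, one_smul]
  have hZ : perCount (region N η ε (weight N' (0 : Idx n → ℤ))) 0 ≠ ∞ := by
    obtain ⟨X, hX, h⟩ := exists_region_bound (η := η) (ε := ε) hN
    exact ((perCount_le hX (h _) 0).trans_lt ENNReal.ofReal_lt_top).ne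
  have hZT : ∀ᶠ T : ℝ in atTop, perCount (region N η ε (weight N' (0 : Idx n → ℤ))) 0 ≤
      ENNReal.ofReal (κ * T ^ (k + r - 1)) := by
    have h1 : Tendsto (fun T : ℝ => κ * T ^ (k + r - 1)) atTop atTop :=
      (tendsto_pow_atTop (by lia)).const_mul_atTop hκ
    filter_upwards [h1.eventually_ge_atTop
      (perCount (region N η ε (weight N' (0 : Idx n → ℤ))) 0).toReal] with T hT
    rw [← ENNReal.ofReal_toReal hZ]
    exact ENNReal.ofReal_le_ofReal hT
  -- The class bounds hold for almost every x; scaling by P⁻¹ preserves null sets, so they hold at x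
  -- = θ/P for almost every θ.
  have hq := (Measure.quasiMeasurePreserving_smul
    (volume : Measure (Idx m → Idx n → ℝ)) (inv_ne_zero hP0)).ae hclass
  filter_upwards [hq] with θ hθ
  rw [← Filter.eventually_all_finset] at hθ
  refine limsup_le_of_le (by isBoundedDefault) ?_
  filter_upwards [hθ, hZT, eventually_gt_atTop 0] with T hT hTZ hT0
  have hTR : 0 < T ^ (k + r - 1) := by positivity
  rw [ENNReal.div_le_iff (by simpa using hTR) ENNReal.ofReal_ne_top,
    ← ENNReal.ofReal_mul (by positivity)]
  refine (countApprox_le (P := P) hN' θ T).trans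
    ((add_le_add hTZ (Finset.sum_le_sum hT)).trans_eq ?_)
  rw [Finset.sum_const, nsmul_eq_mul, ← ENNReal.ofReal_natCast,
    ← ENNReal.ofReal_mul (by positivity), ← ENNReal.ofReal_add (by positivity) (by positivity)]
  congr 1; ring

/-- Take P = z!, which every e ≤ z divides. The powers of P in the class density and in the class
count cancel, leaving the full density over a partial sum of ζ(d). -/
theorem ae_limsup_le_zeta :
    ∀ᵐ θ : Idx m → Idx n → ℝ,
      limsup (fun T : ℝ =>
        (countApprox N N' η ε θ T : ℝ≥0∞) / ENNReal.ofReal (T ^ (k + r - 1))) atTop ≤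
      ENNReal.ofReal (classDensity N N' ε 1 /
        (riemannZeta ((∑ i, m i + ∑ j, n j : ℕ) : ℂ)).re) := by
  have hcard : Fintype.card (Idx m ⊕ Idx n) = ∑ i, m i + ∑ j, n j := by simp [Idx]
  have hd : 2 ≤ ∑ i, m i + ∑ j, n j := by
    have h1 : m ⟨0, hk⟩ ≤ ∑ i, m i := Finset.single_le_sum (fun _ _ => Nat.zero_le _)
      (Finset.mem_univ _)
    have h2 : n ⟨0, hr⟩ ≤ ∑ j, n j := Finset.single_le_sum (fun _ _ => Nat.zero_le _)
      (Finset.mem_univ _)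
    have := hm ⟨0, hk⟩
    have := hn ⟨0, hr⟩
    lia
  set d := ∑ i, m i + ∑ j, n j
  have hV : 0 ≤ classDensity N N' ε 1 := classDensity_nonneg hk hε
  -- Only countably many parameters, P = z! and κ = 1/(l + 1), so one null set serves for all of
  -- them; l → ∞ is taken first, then z → ∞.
  have hall : ∀ᵐ θ : Idx m → Idx n → ℝ, ∀ z l : ℕ,
      limsup (fun T : ℝ =>
        (countApprox N N' η ε θ T : ℝ≥0∞) / ENNReal.ofReal (T ^ (k + r - 1))) atTop ≤
      ENNReal.ofReal (1 / ((l : ℝ) + 1) + (haveI : NeZero z ! := ⟨z.factorial_ne_zero⟩;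
        primitiveClasses (Idx m ⊕ Idx n) z !).card *
        (classDensity (scaleNorm z ! N) N' ε z ! + 1 / ((l : ℝ) + 1))) := by
    refine ae_all_iff.2 fun z => ae_all_iff.2 fun l => ?_
    have : NeZero z ! := ⟨z.factorial_ne_zero⟩
    exact ae_limsup_le hk hr hm hn hN hN' hη hε (by positivity)
  filter_upwards [hall] with θ hθ
  set Λ := limsup (fun T : ℝ =>
    (countApprox N N' η ε θ T : ℝ≥0∞) / ENNReal.ofReal (T ^ (k + r - 1))) atTop
  have hzeta := tendsto_sum_inv_pow_zeta hd
  have hpos : ∀ z : ℕ, 1 ≤ z → 1 ≤ ∑ e ∈ Finset.Icc 1 z, ((e : ℝ) ^ d)⁻¹ := by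
    intro z hz
    have h1 : (((1 : ℕ) : ℝ) ^ d)⁻¹ ≤ ∑ e ∈ Finset.Icc 1 z, ((e : ℝ) ^ d)⁻¹ :=
      Finset.single_le_sum (f := fun e : ℕ => ((e : ℝ) ^ d)⁻¹) (fun e _ => by positivity)
        (Finset.mem_Icc.2 ⟨le_rfl, hz⟩)
    simpa using h1
  have hzeta1 : 1 ≤ (riemannZeta (d : ℂ)).re :=
    ge_of_tendsto hzeta ((eventually_ge_atTop 1).mono hpos)
  have hstep : ∀ z : ℕ, 1 ≤ z →
      Λ ≤ ENNReal.ofReal (classDensity N N' ε 1 / ∑ e ∈ Finset.Icc 1 z, ((e : ℝ) ^ d)⁻¹) := by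
    intro z hz
    have hne : NeZero z ! := ⟨z.factorial_ne_zero⟩
    have hP : 1 ≤ z ! := z.factorial_pos
    set S := primitiveClasses (Idx m ⊕ Idx n) z !
    have hlim : Tendsto (fun l : ℕ => ENNReal.ofReal (1 / ((l : ℝ) + 1) + S.card *
        (classDensity (scaleNorm z ! N) N' ε z ! + 1 / ((l : ℝ) + 1)))) atTop
        (nhds (ENNReal.ofReal (0 + S.card * (classDensity (scaleNorm z ! N) N' ε z ! + 0)))) :=
      ENNReal.tendsto_ofReal (tendsto_one_div_add_atTop_nhds_zero_nat.add
        ((tendsto_one_div_add_atTop_nhds_zero_nat.const_add _).const_mul _))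
    refine (ge_of_tendsto' hlim fun l => hθ z l).trans (ENNReal.ofReal_le_ofReal ?_)
    have h1 := card_primitiveClasses_mul_le (ι := Idx m ⊕ Idx n) (P := z !) (z := z)
      fun e he hez => Nat.dvd_factorial he hez
    have h2 := hpos z hz
    rw [zero_add, add_zero, classDensity_scaleNorm hP, le_div_iff₀ (by linarith)]
    rw [hcard] at h1 ⊢
    have hPd : (0 : ℝ) < ((z ! : ℕ) : ℝ) ^ d := by positivity
    calc (S.card : ℝ) * (classDensity N N' ε 1 / ((z ! : ℕ) : ℝ) ^ d) *
          ∑ e ∈ Finset.Icc 1 z, ((e : ℝ) ^ d)⁻¹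
        = classDensity N N' ε 1 * ((S.card * ∑ e ∈ Finset.Icc 1 z, ((e : ℝ) ^ d)⁻¹) /
          ((z ! : ℕ) : ℝ) ^ d) := by ring
      _ ≤ classDensity N N' ε 1 * 1 := by
          gcongr
          exact (div_le_one hPd).2 h1
      _ = _ := mul_one _
  refine ge_of_tendsto (ENNReal.tendsto_ofReal (Tendsto.div tendsto_const_nhds hzeta (by linarith)))
    ((eventually_ge_atTop 1).mono hstep)

end Final

end MultDioph

end

theorem mainTheorem8 (k r : ℕ) (hk : 1 ≤ k) (hr : 1 ≤ r)
    (m : Fin k → ℕ) (n : Fin r → ℕ) (hm : ∀ i, 1 ≤ m i) (hn : ∀ j, 1 ≤ n j)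
    (N : ∀ i, Seminorm ℝ (Fin (m i) → ℝ)) (N' : ∀ j, Seminorm ℝ (Fin (n j) → ℝ))
    (hN : ∀ i x, N i x = 0 → x = 0) (hN' : ∀ j y, N' j y = 0 → y = 0)
    (η : Fin k → ℝ) (hη : ∀ i, 0 < η i) (ε : ℝ) (hε : 0 < ε)
    (d : ℕ) (hd : d = ∑ i, m i + ∑ j, n j) :
    ∀ᵐ θ : MultDioph.Idx m → MultDioph.Idx n → ℝ,
      limsup (fun T : ℝ =>
          (MultDioph.countApprox N N' η ε θ T : ℝ≥0∞) / ENNReal.ofReal (T ^ (k + r - 1))) atTop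
        ≤ ENNReal.ofReal
            (ε / (riemannZeta (d : ℂ)).re
              * ((volume (MultDioph.unitBall N N')).toReal / ((k + r - 1)! : ℝ))
              * (MultDioph.cCoeff (k + r - 1) n : ℝ)) := by
  subst hd
  have h := MultDioph.ae_limsup_le_zeta hk hr hm hn hN hN' hη hε
  have hV : MultDioph.classDensity N N' ε 1 / (riemannZeta ((∑ i, m i + ∑ j, n j : ℕ) : ℂ)).re =
      ε / (riemannZeta ((∑ i, m i + ∑ j, n j : ℕ) : ℂ)).re
        * ((volume (MultDioph.unitBall N N')).toReal / ((k + r - 1)! : ℝ))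
        * (MultDioph.cCoeff (k + r - 1) n : ℝ) := by
    rw [MultDioph.volume_unitBall hN hN', ENNReal.toReal_mul, ENNReal.toReal_prod,
      ENNReal.toReal_prod]
    simp only [MultDioph.classDensity, Nat.cast_one, one_pow, div_one]
    ring
  rwa [hV] at h
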